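/- Let $t$ be a natural number and $\rho_1,\dots,\rho_t$ real numbers. For every $p\ge 1$ and $1\le l\le t$ let $X_l=X_l^{(p)}$ and $Y_l=Y_l^{(p)}$ be real random $p\times n_l$ matrices, $n_l=n_l(p)$, all defined on one probability space, such that: (i) for every $p$ the pairs $(X^{(l)}_{ij},Y^{(l)}_{ij})$, $1\le i\le p$, $1\le j\le n_l$, $1\le l\le t$, are independent; (ii) $\mathbb E X^{(l)}_{ij}=\mathbb E Y^{(l)}_{ij}=0$, $\mathbb E (X^{(l)}_{ij})^2=\mathbb E (Y^{(l)}_{ij})^2=1$ and $\mathbb E X^{(l)}_{ij}Y^{(l)}_{ij}=\rho_l$; (iii) for all $l$ and $k\ge1$, $\sup_{p,i,j}\mathbb E\big(|X^{(l)}_{ij}|^k+|Y^{(l)}_{ij}|^k\big)<\infty$; (iv) $n_l\to\infty$ and $p/n_l\to 0$ as $p\to\infty$, for every $l$. Put $C_l=n_l^{-1}X_lY_l^{*}$ and $E_l=\sqrt{n_l/p}\,(C_l-\rho_l I_p)$. In a $*$-probability space $(\mathcal A,\varphi)$ (a unital complex $*$-algebra with a unital positive linear functional) let $\kappa_n(a_1,\dots,a_n)=\sum_{\sigma\in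 NC(n)}\varphi_\sigma[a_1,\dots,a_n]\,\mu(\sigma,1_n)$ be the free cumulants, where $NC(n)$ is the poset of non-crossing partitions of $\{1,\dots,n\}$, $\mu$ its Möbius function and $\varphi_\sigma$ the product over the blocks of $\sigma$ of the corresponding moments. Variables $a_1,\dots,a_t$ are called free if all their mixed $*$-cumulants $\kappa_n(a_{\tau_1}^{\epsilon_1},\dots,a_{\tau_n}^{\epsilon_n})$ ($\epsilon_i\in\{1,*\}$, $\tau$ not constant) vanish. An element $e$ is elliptic with parameter $r\in[-1,1]$ if $\kappa_2(e,e)=\kappa_2(e^*,e^*)=r$, $\kappa_2(e,e^*)=\kappa_2(e^*,e)=1$, and all other free cumulants of $\{e,e^*\}$ vanish. The law of a self-adjoint $a$ is the unique probability measure on $\mathbb R$ with moments $\varphi(a^k)$, $k\ge1$. (a) The entries of the $E_l$ have finite moments of all orders, and there are a $*$-probability space $(\mathcal A,\varphi)$ with $\varphi$ tracial and free elliptic variables $e_1,\dots,e_t\in\mathcal A$ with parameters $\rho_1^2,\dots,\rho_t^2$ such that for every polynomial $\Pi$ with complex coefficients in $2t$ noncommuting indeterminates, $p^{-1}\mathbb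 E\,\mathrm{Tr}\,\Pi(E_l,E_l^*)\to\varphi(\Pi(e_l,e_l^*))$ as $p\to\infty$, and, almost surely, $p^{-1}\mathrm{Tr}\,\Pi(E_l,E_l^*)\to\varphi(\Pi(e_l,e_l^*))$. Moreover $e_l$ is a standard semicircular variable (self-adjoint, with $\kappa_2=1$ as its only non-zero free cumulant) if $\rho_l=\pm1$, and a standard circular variable ($e_l=(s_1+\sqrt{-1}\,s_2)/\sqrt2$ with $s_1,s_2$ free standard semicircular) if $\rho_l=0$. (b) With the same $(\mathcal A,\varphi)$ and $e_l$: let $\Pi$ be a polynomial with real coefficients in $2t$ noncommuting indeterminates such that for every $p$ the matrix $\Pi(E_l,E_l^*)$ is almost surely symmetric. Then $\Pi(e_l,e_l^*)$ is self-adjoint and has a compactly supported law, and almost surely the empirical spectral distribution of $\Pi(E_l,E_l^*)$ converges weakly to this law as $p\to\infty$. -/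

import Mathlib

open MeasureTheory ProbabilityTheory Filter Topology
open scoped ENNReal

noncomputable section

namespace CrossCov

/-! ### Noncommutative probability: states, free cumulants, freeness -/

/-- `a^ε` for `ε ∈ {1, *}`; `true` stands for `*`. -/
def starPow {A : Type*} [Star A] (a : A) (ε : Bool) : A := if ε then star a else a

section NCP

variable {A : Type*} [Ring A] [StarRing A] [Algebra ℂ A]

/-- A state on a unital complex star-algebra: a unital positive linear functional. The pair
`(A, φ)` is then a star-probability space. -/
structure IsState (φ : A →ₗ[ℂ] ℂ) : Prop where
  map_one : φ 1 = 1
  nonneg : ∀ a : A, 0 ≤ (φ (a * star a)).re ∧ (φ (a * star a)).im = 0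

/-- `φ` is tracial. -/
def IsTracial (φ : A →ₗ[ℂ] ℂ) : Prop := ∀ a b : A, φ (a * b) = φ (b * a)

/-- A partition of `{0, …, n-1}` is non-crossing if there are no `i < j < k < m` such that
`i, k` lie in one block and `j, m` lie in another block. -/
def IsNoncrossing {n : ℕ} (π : Finpartition (Finset.univ : Finset (Fin n))) : Prop :=
  ∀ V ∈ π.parts, ∀ W ∈ π.parts, ∀ i j k m : Fin n, i < j → j < k → k < m →
    i ∈ V → k ∈ V → j ∈ W → m ∈ W → V = W

/-- The poset `NC(n)` of non-crossing partitions, ordered by refinement (`π ≤ σ` iff every block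
of `π` is contained in a block of `σ`). -/
abbrev NC (n : ℕ) : Type :=
  {π : Finpartition (Finset.univ : Finset (Fin n)) // IsNoncrossing π}

instance instFintypeNC (n : ℕ) : Fintype (NC n) := Fintype.ofFinite _

open scoped Classical in
instance instLocallyFiniteOrderNC (n : ℕ) : LocallyFiniteOrder (NC n) :=
  Fintype.toLocallyFiniteOrder

theorem isNoncrossing_top (n : ℕ) :
    IsNoncrossing (⊤ : Finpartition (Finset.univ : Finset (Fin n))) := by
  intro V hV W hW i j k m _ _ _ _ _ _ _
  have h := Finpartition.parts_top_subsingleton (Finset.univ : Finset (Fin n))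
  exact h hV hW

/-- The partition `1_n` with a single block, the largest element of `NC(n)`. -/
def NC.one (n : ℕ) : NC n := ⟨⊤, isNoncrossing_top n⟩

/-- `φ(V)[a_1, …, a_n] = φ(a_{i_1} ⋯ a_{i_s})` for a block `V = {i_1 < ⋯ < i_s}`. -/
def blockMoment (φ : A →ₗ[ℂ] ℂ) {n : ℕ} (a : Fin n → A) (V : Finset (Fin n)) : ℂ :=
  φ ((V.sort.map a).prod)

/-- The multiplicative extension `φ_π[a_1, …, a_n] = ∏_{V ∈ π} φ(V)[a_1, …, a_n]`. -/
def partMoment (φ : A →ₗ[ℂ] ℂ) {n : ℕ} (a : Fin n → A) (π : NC n) : ℂ :=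
  ∏ V ∈ π.1.parts, blockMoment φ a V

open scoped Classical in
/-- The joint free cumulant
`κ_n(a_1, …, a_n) = ∑_{σ ∈ NC(n)} φ_σ[a_1, …, a_n] μ(σ, 1_n)`,
with `μ` the Möbius function of the poset `NC(n)`. -/
def freeCumulant (φ : A →ₗ[ℂ] ℂ) {n : ℕ} (a : Fin n → A) : ℂ :=
  ∑ σ : NC n, partMoment φ a σ * IncidenceAlgebra.mu ℂ σ (NC.one n)

/-- Variables `a_i` are free if all their mixed free cumulants (in the `a_i` and `a_i^*`)
vanish. -/
def IsFree (φ : A →ₗ[ℂ] ℂ) {ι : Type*} (a : ι → A) : Prop :=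
  ∀ (n : ℕ) (τ : Fin n → ι) (ε : Fin n → Bool), (∃ r s, τ r ≠ τ s) →
    freeCumulant φ (fun r => starPow (a (τ r)) (ε r)) = 0

/-- `e` is an elliptic variable with parameter `r ∈ [-1, 1]`: the free cumulants of `{e, e^*}` of
order one and of order greater than two vanish, `κ_2(e, e) = κ_2(e^*, e^*) = r` and
`κ_2(e, e^*) = κ_2(e^*, e) = 1`. -/
structure IsElliptic (φ : A →ₗ[ℂ] ℂ) (e : A) (r : ℝ) : Prop where
  neg_one_le : -1 ≤ r
  le_one : r ≤ 1
  cumulant_one : ∀ ε : Fin 1 → Bool, freeCumulant φ (fun i => starPow e (ε i)) = 0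
  cumulant_of_two_lt : ∀ (n : ℕ), 2 < n → ∀ ε : Fin n → Bool,
    freeCumulant φ (fun i => starPow e (ε i)) = 0
  cumulant_self_self : freeCumulant φ ![e, e] = (r : ℂ)
  cumulant_star_star : freeCumulant φ ![star e, star e] = (r : ℂ)
  cumulant_self_star : freeCumulant φ ![e, star e] = 1
  cumulant_star_self : freeCumulant φ ![star e, e] = 1

/-- A standard semicircular variable: self-adjoint, with `κ_2 = 1` and all other free cumulants
equal to zero. -/
structure IsSemicircular (φ : A →ₗ[ℂ] ℂ) (s : A) : Prop where
  isSelfAdjoint : IsSelfAdjoint s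
  cumulant : ∀ n : ℕ, 1 ≤ n →
    freeCumulant φ (fun _ : Fin n => s) = if n = 2 then 1 else 0

/-- A standard circular variable: `c = (s_1 + √-1 s_2) / √2` with `s_1, s_2` free standard
semicircular variables. -/
def IsCircular (φ : A →ₗ[ℂ] ℂ) (c : A) : Prop :=
  ∃ s : Fin 2 → A, (∀ i, IsSemicircular φ (s i)) ∧ IsFree φ s ∧
    c = ((Real.sqrt 2 : ℂ)⁻¹) • (s 0 + Complex.I • s 1)

/-- `μ` is the probability law of the self-adjoint variable `a`: the unique probability measure on
the real line whose moments (all of them finite) are the moments of `a`. -/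
structure IsLaw (φ : A →ₗ[ℂ] ℂ) (a : A) (μ : Measure ℝ) : Prop where
  isSelfAdjoint : IsSelfAdjoint a
  isProbabilityMeasure : IsProbabilityMeasure μ
  moments : ∀ k : ℕ, 1 ≤ k →
    Integrable (fun x : ℝ => x ^ k) μ ∧ φ (a ^ k) = ((∫ x, x ^ k ∂μ : ℝ) : ℂ)
  unique : ∀ ν : Measure ℝ, IsProbabilityMeasure ν →
    (∀ k : ℕ, 1 ≤ k →
      Integrable (fun x : ℝ => x ^ k) ν ∧ φ (a ^ k) = ((∫ x, x ^ k ∂ν : ℝ) : ℂ)) → ν = μ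

end NCP

/-- The evaluation `Π ↦ Π(a_l, a_l^*)` of noncommutative polynomials with coefficients in `𝕜` at
a family of elements of a star-algebra. The indeterminate `(l, false)` is sent to `a_l` and
`(l, true)` to `a_l^*`. -/
def polyEval (𝕜 : Type*) [CommSemiring 𝕜] {A : Type*} [Ring A] [StarRing A] [Algebra 𝕜 A]
    {ι : Type*} (a : ι → A) : FreeAlgebra 𝕜 (ι × Bool) →ₐ[𝕜] A :=
  FreeAlgebra.lift 𝕜 (fun x => starPow (a x.1) x.2)

/-! ### Random matrices -/

/-- The sample cross-covariance matrix `n⁻¹ X Y^*`. -/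
def crossCov {p n : ℕ} (X Y : Matrix (Fin p) (Fin n) ℝ) : Matrix (Fin p) (Fin p) ℝ :=
  (n : ℝ)⁻¹ • (X * Y.transpose)

/-- The centred and rescaled matrix `√(n p⁻¹) (C - ρ I_p)`, where `C = n⁻¹ X Y^*`. -/
def rescaledCov {p n : ℕ} (ρ : ℝ) (X Y : Matrix (Fin p) (Fin n) ℝ) :
    Matrix (Fin p) (Fin p) ℝ :=
  Real.sqrt ((n : ℝ) / (p : ℝ)) • (crossCov X Y - ρ • (1 : Matrix (Fin p) (Fin p) ℝ))

/-- A real matrix regarded as a complex matrix. -/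
def toComplex {p : ℕ} (M : Matrix (Fin p) (Fin p) ℝ) : Matrix (Fin p) (Fin p) ℂ :=
  M.map Complex.ofReal

/-- The normalised trace `p⁻¹ Tr`. -/
def ntr {p : ℕ} (M : Matrix (Fin p) (Fin p) ℂ) : ℂ := (p : ℂ)⁻¹ * M.trace

/-- Membership in the star-algebra of `p × p` complex random matrices all of whose entries have
finite moments of every order. -/
def MemRandomMatrix {Ω : Type*} [MeasurableSpace Ω] (P : Measure Ω) {p : ℕ}
    (M : Ω → Matrix (Fin p) (Fin p) ℂ) : Prop :=
  ∀ (i j : Fin p) (k : ℕ), MemLp (fun ω => M ω i j) k P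

/-- The state `φ_p(M) = p⁻¹ E[Tr M]` on random matrices. -/
def expNtr {Ω : Type*} [MeasurableSpace Ω] (P : Measure Ω) {p : ℕ}
    (M : Ω → Matrix (Fin p) (Fin p) ℂ) : ℂ :=
  (p : ℂ)⁻¹ * ∫ ω, (M ω).trace ∂P

/-- The empirical spectral distribution of a real symmetric `p × p` matrix: mass `p⁻¹` at each of
its `p` eigenvalues, counted with multiplicity (the roots of the characteristic polynomial, which
are all real). -/
def esd {p : ℕ} (M : Matrix (Fin p) (Fin p) ℝ) : Measure ℝ :=
  (p : ℝ≥0∞)⁻¹ • (M.charpoly.roots.map Measure.dirac).sum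

end CrossCov

end

/-! Expanding the matrix products, the trace of a word of length `m` in the `E_l`, `E_l^*` becomes a
weighted sum over closed walks `i` of length `m` on the `p` rows, each step being coloured by a
column. The expected product along a walk vanishes unless the walk is `Admissible`: every colour
occurs at least twice, and within a colour no vertex has degree one.

For admissible walks, vertices plus colours number at most `m + 1`. This is linear algebra. The step
vectors of a connected walk have rank at least the number of vertices minus one. Each colour class
without a vertex of degree one has at least as many edges as vertices, so it carries a non-zero
linear relation, and relations of distinct colours are independent. Rank-nullity gives the bound
(`card_add_card_le_of_relations`). In the case of equality these relations span all relations. Since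
the all-ones vector is one of them, every relation is constant on colour classes. For colourings
that are pairings this forces paired steps to be opposite and the pairing to be non-crossing.

Counting with weights, a colour used more than twice costs a factor `√(p/n_l)` and a missing vertex
costs `1/p`. Only the extremal walks survive. A non-crossing pairing has about `p^(m/2+1)` opposite
walks, and each pair contributes `ρ_l²` or `1` according to orientation (`integral_opposite`). Hence
moments converge to a Wick sum over non-crossing pairings. For two walks sharing a variable the
vertex bound improves by one, so the variance of a normalised trace is `O(p⁻²)`. This is summable
and gives almost sure convergence.

Möbius inversion on `NC(n)` turns the Wick formula into the vanishing of all free cumulants of order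
other than two, which yields ellipticity and freeness. For `ρ_l = 0` the Wick formula, extended to
linear spans, yields the circular decomposition. The limit space is concrete: sequences of matrices
that are polynomials in the `E_l` at one good sample point, with the limiting normalised trace as
state. It inherits positivity, traciality and exact self-adjointness from the matrices.

For (b), there are at most `2^m` non-crossing pairings, so the limiting moments of any polynomial
grow at most exponentially. The method of moments then gives a compactly supported limit law. -/

noncomputable section

namespace CrossCov

set_option linter.unusedSectionVars false

/-! ### Möbius inversion on the lattice of non-crossing partitions -/

/-- The non-crossing condition for a family of blocks. -/
def NoncrossingParts {n : ℕ} (S : Finset (Finset (Fin n))) : Prop :=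
  ∀ V ∈ S, ∀ W ∈ S, ∀ i j k m : Fin n, i < j → j < k → k < m →
    i ∈ V → k ∈ V → j ∈ W → m ∈ W → V = W

theorem NoncrossingParts.mono {n : ℕ} {S T : Finset (Finset (Fin n))} (h : NoncrossingParts T)
    (hST : S ⊆ T) : NoncrossingParts S :=
  fun V hV W hW => h V (hST hV) W (hST hW)

theorem isNoncrossing_bot (n : ℕ) :
    IsNoncrossing (⊥ : Finpartition (Finset.univ : Finset (Fin n))) := by
  intro V hV W hW i j k m hij hjk hkm hi hk hj hm
  obtain ⟨x, -, rfl⟩ := Finpartition.mem_bot_iff.1 hV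
  simp only [Finset.mem_singleton] at hi hk
  subst hi; subst hk
  exact absurd (hij.trans hjk) (lt_irrefl _)

/-- Möbius inversion over lower intervals is used in the form for orders with a least element. -/
instance instOrderBotNC (n : ℕ) : OrderBot (NC n) where
  bot := ⟨⊥, isNoncrossing_bot n⟩
  bot_le := fun π => (bot_le : ⊥ ≤ π.1)

/-- A block of a finer partition is never cut by `V`, so restriction only selects the blocks inside
`V`. -/
theorem mem_restrict_of_le {n : ℕ} {π σ : Finpartition (Finset.univ : Finset (Fin n))}
    (h : π ≤ σ) {V : Finset (Fin n)} (hV : V ∈ σ.parts) (B : Finset (Fin n)) :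
    B ∈ (π.restrict (Finset.subset_univ V)).parts ↔ B ∈ π.parts ∧ B ⊆ V := by
  simp only [Finpartition.restrict, Finset.mem_erase, Finset.mem_image, Finset.inf_eq_inter]
  constructor
  · rintro ⟨hne, C, hC, rfl⟩
    obtain ⟨W, hW, hCW⟩ := h hC
    obtain ⟨x, hx⟩ := Finset.nonempty_iff_ne_empty.2 hne
    have hWV : W = V := σ.eq_of_mem_parts hW hV (hCW (Finset.mem_inter.1 hx).1)
      (Finset.mem_inter.1 hx).2
    subst hWV
    have : C ∩ W = C := Finset.inter_eq_left.2 hCW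
    rw [this]
    exact ⟨hC, hCW⟩
  · rintro ⟨hB, hBV⟩
    exact ⟨π.ne_empty hB, B, hB, Finset.inter_eq_left.2 hBV⟩

open scoped Classical in
/-- The finset of non-crossing partitions of a subset `V` of `{0, …, n-1}`. -/
def ncOn {n : ℕ} (V : Finset (Fin n)) : Finset (Finpartition V) :=
  Finset.univ.filter fun ρ => NoncrossingParts ρ.parts

theorem mem_ncOn {n : ℕ} {V : Finset (Fin n)} {ρ : Finpartition V} :
    ρ ∈ ncOn V ↔ NoncrossingParts ρ.parts := by
  classical
  simp [ncOn]

/-- A crossing between parts of different blocks would already be a crossing of `σ`; otherwise it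
lies inside one block. -/
theorem isNoncrossing_bind {n : ℕ} (σ : NC n) (p : ∀ V ∈ σ.1.parts, Finpartition V)
    (hp : ∀ V hV, NoncrossingParts (p V hV).parts) : IsNoncrossing (σ.1.bind p) := by
  intro B hB C hC i j k m hij hjk hkm hi hk hj hm
  obtain ⟨V, hV, hBV⟩ := Finpartition.mem_bind.1 hB
  obtain ⟨W, hW, hCW⟩ := Finpartition.mem_bind.1 hC
  have hVW : V = W := σ.2 V hV W hW i j k m hij hjk hkm ((p V hV).subset hBV hi)
    ((p V hV).subset hBV hk) ((p W hW).subset hCW hj) ((p W hW).subset hCW hm)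
  subst hVW
  exact hp V hV B hBV C hCW i j k m hij hjk hkm hi hk hj hm

-- The lower interval of `σ` in `NC(n)` is the product of the posets of non-crossing partitions of
-- the blocks of `σ`; gluing and restriction are inverse bijections.
open scoped Classical in
theorem prod_sum_ncOn {n : ℕ} (K : Finset (Fin n) → ℂ) (σ : NC n) :
    ∏ V ∈ σ.1.parts, ∑ ρ ∈ ncOn V, ∏ B ∈ ρ.parts, K B =
      ∑ π ∈ Finset.Iic σ, ∏ B ∈ π.1.parts, K B := by
  rw [Finset.prod_sum]
  refine Finset.sum_bij' (fun p hp => ⟨σ.1.bind p, ?_⟩)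
    (fun π hπ V hV => π.1.restrict (Finset.subset_univ V)) ?_ ?_ ?_ ?_ ?_
  · exact isNoncrossing_bind σ p fun V hV => mem_ncOn.1 (Finset.mem_pi.1 hp V hV)
  · intro p hp
    rw [Finset.mem_Iic]
    intro B hB
    obtain ⟨V, hV, hBV⟩ := Finpartition.mem_bind.1 hB
    exact ⟨V, hV, (p V hV).subset hBV⟩
  · intro π hπ
    rw [Finset.mem_pi]
    intro V hV
    rw [mem_ncOn]
    have hle : π ≤ σ := Finset.mem_Iic.1 hπ
    replace hle : π.1 ≤ σ.1 := hle
    refine NoncrossingParts.mono (T := π.1.parts) π.2 fun B hB => ?_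
    exact ((mem_restrict_of_le hle hV B).1 hB).1
  · intro p hp
    funext V hV
    have hle : σ.1.bind p ≤ σ.1 := by
      intro B hB
      obtain ⟨V, hV, hBV⟩ := Finpartition.mem_bind.1 hB
      exact ⟨V, hV, (p V hV).subset hBV⟩
    ext B
    rw [mem_restrict_of_le hle hV, Finpartition.mem_bind]
    constructor
    · rintro ⟨⟨W, hW, hB⟩, hBV⟩
      obtain ⟨x, hx⟩ := (p W hW).nonempty_of_mem_parts hB
      have : W = V := σ.1.eq_of_mem_parts hW hV ((p W hW).subset hB hx) (hBV hx)
      subst this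
      exact hB
    · intro hB
      exact ⟨⟨V, hV, hB⟩, (p V hV).subset hB⟩
  · intro π hπ
    have hle : π ≤ σ := Finset.mem_Iic.1 hπ
    replace hle : π.1 ≤ σ.1 := hle
    apply Subtype.ext
    ext B
    rw [Finpartition.mem_bind]
    constructor
    · rintro ⟨V, hV, hB⟩
      exact ((mem_restrict_of_le hle hV B).1 hB).1
    · intro hB
      obtain ⟨V, hV, hBV⟩ := hle hB
      exact ⟨V, hV, (mem_restrict_of_le hle hV B).2 ⟨hB, hBV⟩⟩
  · intro p hp
    rw [Finpartition.bind_parts, Finset.prod_biUnion]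
    intro V _ W _ hVW
    rw [Function.onFun, Finset.disjoint_left]
    intro B hB hB'
    obtain ⟨x, hx⟩ := (p V.1 V.2).nonempty_of_mem_parts hB
    exact hVW (Subtype.ext (σ.1.eq_of_mem_parts V.2 W.2 ((p V.1 V.2).subset hB hx)
      ((p W.1 W.2).subset hB' hx)))

section Cumulant

variable {A : Type*} [Ring A] [Algebra ℂ A]

/-- The moment-cumulant formula read backwards: a family `K` producing all block moments must be the
cumulants. No value of the Möbius function has to be computed. -/
theorem freeCumulant_eq_prod (φ : A →ₗ[ℂ] ℂ) {n : ℕ} (a : Fin n → A) (K : Finset (Fin n) → ℂ)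
    (h : ∀ V : Finset (Fin n), blockMoment φ a V = ∑ ρ ∈ ncOn V, ∏ B ∈ ρ.parts, K B) :
    freeCumulant φ a = ∏ B ∈ (NC.one n).1.parts, K B := by
  classical
  have hm : ∀ σ : NC n, partMoment φ a σ = ∑ π ∈ Finset.Iic σ, ∏ B ∈ π.1.parts, K B := by
    intro σ
    rw [← prod_sum_ncOn, partMoment]
    exact Finset.prod_congr rfl fun V _ => h V
  have key := IncidenceAlgebra.moebius_inversion_bot (𝕜 := ℂ) (α := NC n)
    (fun π => ∏ B ∈ π.1.parts, K B) (fun σ => partMoment φ a σ) hm (NC.one n)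
  have htop : Finset.Iic (NC.one n) = Finset.univ := by
    ext π
    simp only [Finset.mem_Iic, Finset.mem_univ, iff_true]
    exact (le_top : π.1 ≤ ⊤)
  rw [htop] at key
  rw [key, freeCumulant]
  refine Finset.sum_congr rfl fun σ _ => ?_
  rw [mul_comm]

theorem blockMoment_univ (φ : A →ₗ[ℂ] ℂ) {n : ℕ} (a : Fin n → A) :
    blockMoment φ a Finset.univ = φ (List.ofFn a).prod := by
  rw [blockMoment]
  congr 2
  have : (Finset.univ : Finset (Fin n)).sort = List.finRange n := by
    refine List.Perm.eq_of_pairwise (le := (· ≤ ·)) (fun _ _ _ _ h1 h2 => le_antisymm h1 h2)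
      (Finset.pairwise_sort _ _) ?_ ?_
    · exact (List.pairwise_lt_finRange n).imp le_of_lt
    · refine (Finset.sort_perm_toList _ _).trans ?_
      rw [List.perm_ext_iff_of_nodup (Finset.nodup_toList _) (List.nodup_finRange n)]
      simp
  rw [this, List.ofFn_eq_map]

theorem blockMoment_map (φ : A →ₗ[ℂ] ℂ) {k n : ℕ} (e : Fin k ↪o Fin n) (a : Fin n → A)
    (B : Finset (Fin k)) :
    blockMoment φ (fun i => a (e i)) B = blockMoment φ a (B.map e.toEmbedding) := by
  rw [blockMoment, blockMoment]
  congr 2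
  have h := StrictMonoOn.map_finsetSort (s := B) (f := e.toEmbedding)
    (e.strictMono.strictMonoOn _)
  rw [← h, List.map_map]
  rfl

/-- The block function of a family all of whose free cumulants of order other than two vanish. -/
def pairBlock (φ : A →ₗ[ℂ] ℂ) {n : ℕ} (a : Fin n → A) (B : Finset (Fin n)) : ℂ :=
  if B.card = 2 then blockMoment φ a B else 0

theorem pairBlock_map (φ : A →ₗ[ℂ] ℂ) {k n : ℕ} (e : Fin k ↪o Fin n) (a : Fin n → A)
    (B : Finset (Fin k)) :
    pairBlock φ (fun i => a (e i)) B = pairBlock φ a (B.map e.toEmbedding) := by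
  simp only [pairBlock, Finset.card_map, blockMoment_map]

end Cumulant

theorem noncrossingParts_map {k n : ℕ} (e : Fin k ↪o Fin n) (S : Finset (Finset (Fin k))) :
    NoncrossingParts (S.map (Finset.mapEmbedding e.toEmbedding).toEmbedding) ↔
      NoncrossingParts S := by
  constructor
  · intro h V hV W hW i j l m hij hjl hlm hi hl hj hm
    have := h (V.map e.toEmbedding) (Finset.mem_map_of_mem _ hV) (W.map e.toEmbedding)
      (Finset.mem_map_of_mem _ hW) (e i) (e j) (e l) (e m) (e.lt_iff_lt.2 hij)
      (e.lt_iff_lt.2 hjl) (e.lt_iff_lt.2 hlm) (Finset.mem_map_of_mem _ hi)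
      (Finset.mem_map_of_mem _ hl) (Finset.mem_map_of_mem _ hj) (Finset.mem_map_of_mem _ hm)
    exact Finset.map_injective _ this
  · intro h V' hV' W' hW' i j l m hij hjl hlm hi hl hj hm
    obtain ⟨V, hV, rfl⟩ := Finset.mem_map.1 hV'
    obtain ⟨W, hW, rfl⟩ := Finset.mem_map.1 hW'
    obtain ⟨i, -, rfl⟩ := Finset.mem_map.1 hi
    obtain ⟨j, -, rfl⟩ := Finset.mem_map.1 hj
    obtain ⟨l, -, rfl⟩ := Finset.mem_map.1 hl
    obtain ⟨m, -, rfl⟩ := Finset.mem_map.1 hm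
    have h1 : V = W := h V hV W hW i j l m (e.lt_iff_lt.1 hij) (e.lt_iff_lt.1 hjl)
      (e.lt_iff_lt.1 hlm) ((Finset.mem_map' _).1 hi) ((Finset.mem_map' _).1 hl)
      ((Finset.mem_map' _).1 hj) ((Finset.mem_map' _).1 hm)
    rw [h1]

/-- Transport of a partition of `{0, …, k-1}` along an increasing map with image `V`. -/
def mapPart {k n : ℕ} (e : Fin k ↪o Fin n) {V : Finset (Fin n)}
    (hV : Finset.univ.map e.toEmbedding = V) (π : Finpartition (Finset.univ : Finset (Fin k))) :
    Finpartition V :=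
  Finpartition.ofExistsUnique (π.parts.map (Finset.mapEmbedding e.toEmbedding).toEmbedding)
    (by
      intro p hp
      obtain ⟨B, hB, rfl⟩ := Finset.mem_map.1 hp
      rw [← hV]
      exact Finset.map_subset_map.2 (Finset.subset_univ B))
    (by
      intro x hx
      rw [← hV] at hx
      obtain ⟨y, -, rfl⟩ := Finset.mem_map.1 hx
      obtain ⟨B, ⟨hB, hyB⟩, hu⟩ := π.existsUnique_mem (Finset.mem_univ y)
      refine ⟨B.map e.toEmbedding, ⟨Finset.mem_map_of_mem _ hB, Finset.mem_map_of_mem _ hyB⟩, ?_⟩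
      rintro C ⟨hC, hyC⟩
      obtain ⟨D, hD, rfl⟩ := Finset.mem_map.1 hC
      have : y ∈ D := (Finset.mem_map' e.toEmbedding).1 hyC
      rw [← hu D ⟨hD, this⟩]
      rfl)
    (by
      intro h
      obtain ⟨B, hB, hBe⟩ := Finset.mem_map.1 h
      exact π.ne_empty hB (Finset.map_eq_empty.1 hBe))

/-- Pull-back of a partition of the image of an increasing map. -/
def comapPart {k n : ℕ} (e : Fin k ↪o Fin n) {V : Finset (Fin n)}
    (hV : Finset.univ.map e.toEmbedding = V) (ρ : Finpartition V) :
    Finpartition (Finset.univ : Finset (Fin k)) :=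
  Finpartition.ofExistsUnique
    (ρ.parts.image fun B => Finset.univ.filter fun x => e x ∈ B)
    (fun _ _ => Finset.subset_univ _)
    (by
      intro x _
      have hx : e x ∈ V := by
        rw [← hV]; exact Finset.mem_map_of_mem _ (Finset.mem_univ x)
      obtain ⟨B, ⟨hB, hxB⟩, hu⟩ := ρ.existsUnique_mem hx
      refine ⟨Finset.univ.filter fun x => e x ∈ B,
        ⟨Finset.mem_image_of_mem _ hB, by simpa using hxB⟩, ?_⟩
      rintro C ⟨hC, hxC⟩
      obtain ⟨D, hD, rfl⟩ := Finset.mem_image.1 hC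
      have : e x ∈ D := by simpa using hxC
      rw [← hu D ⟨hD, this⟩])
    (by
      intro h
      obtain ⟨B, hB, hBe⟩ := Finset.mem_image.1 h
      obtain ⟨y, hy⟩ := ρ.nonempty_of_mem_parts hB
      have hyV := ρ.subset hB hy
      rw [← hV] at hyV
      obtain ⟨x, -, rfl⟩ := Finset.mem_map.1 hyV
      have : x ∈ (Finset.univ.filter fun x => e x ∈ B) := by simpa using hy
      rw [hBe] at this
      exact absurd this (Finset.notMem_empty x))

theorem map_filter_mem {k n : ℕ} (e : Fin k ↪o Fin n) {B : Finset (Fin n)}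
    (hB : B ⊆ Finset.univ.map e.toEmbedding) :
    (Finset.univ.filter fun x => e x ∈ B).map e.toEmbedding = B := by
  ext y
  simp only [Finset.mem_map, Finset.mem_filter, Finset.mem_univ, true_and]
  constructor
  · rintro ⟨x, hx, rfl⟩
    exact hx
  · intro hy
    obtain ⟨x, -, rfl⟩ := Finset.mem_map.1 (hB hy)
    exact ⟨x, hy, rfl⟩

theorem filter_mem_map {k n : ℕ} (e : Fin k ↪o Fin n) (B : Finset (Fin k)) :
    (Finset.univ.filter fun x => e x ∈ B.map e.toEmbedding) = B := by
  ext y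
  simp only [Finset.mem_filter, Finset.mem_univ, true_and]
  exact Finset.mem_map' e.toEmbedding

/-- Being non-crossing depends only on the order, so a formula for `k` points transfers to any
`k`-element subset `V`. -/
theorem sum_NC_eq_sum_ncOn {k n : ℕ} (e : Fin k ↪o Fin n) {V : Finset (Fin n)}
    (hV : Finset.univ.map e.toEmbedding = V) (K : Finset (Fin n) → ℂ) :
    ∑ π : NC k, ∏ B ∈ π.1.parts, K (B.map e.toEmbedding) =
      ∑ ρ ∈ ncOn V, ∏ B ∈ ρ.parts, K B := by
  have hparts : ∀ ρ : Finpartition V,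
      (comapPart e hV ρ).parts.map (Finset.mapEmbedding e.toEmbedding).toEmbedding = ρ.parts := by
    intro ρ
    ext B
    simp only [comapPart, Finpartition.ofExistsUnique_parts, Finset.mem_map, Finset.mem_image]
    constructor
    · rintro ⟨C, ⟨D, hD, rfl⟩, rfl⟩
      have := map_filter_mem e (B := D) (by rw [hV]; exact ρ.subset hD)
      change (Finset.univ.filter fun x => e x ∈ D).map e.toEmbedding ∈ ρ.parts
      rwa [this]
    · intro hB
      exact ⟨_, ⟨B, hB, rfl⟩, map_filter_mem e (B := B) (by rw [hV]; exact ρ.subset hB)⟩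
  refine Finset.sum_bij' (fun π _ => mapPart e hV π.1) (fun ρ hρ => ⟨comapPart e hV ρ, ?_⟩)
    ?_ ?_ ?_ ?_ ?_
  · have := mem_ncOn.1 hρ
    rw [← hparts ρ, noncrossingParts_map] at this
    exact this
  · intro π _
    rw [mem_ncOn]
    exact (noncrossingParts_map e _).2 π.2
  · intro ρ _
    exact Finset.mem_univ _
  · intro π _
    apply Subtype.ext
    ext B
    simp only [comapPart, mapPart, Finpartition.ofExistsUnique_parts, Finset.mem_image,
      Finset.mem_map]
    constructor
    · rintro ⟨C, ⟨D, hD, rfl⟩, rfl⟩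
      have := filter_mem_map e D
      change (Finset.univ.filter fun x => e x ∈ D.map e.toEmbedding) ∈ _
      rwa [this]
    · intro hB
      exact ⟨_, ⟨B, hB, rfl⟩, filter_mem_map e B⟩
  · intro ρ _
    ext1
    exact hparts ρ
  · intro π _
    simp only [mapPart, Finpartition.ofExistsUnique_parts, Finset.prod_map]
    rfl

section Cumulant

variable {A : Type*} [Ring A] [Algebra ℂ A]

/-- The Wick formula with respect to non-crossing pairings for tuples from a set `S`. -/
def IsWick (φ : A →ₗ[ℂ] ℂ) (S : Set A) : Prop :=
  ∀ (n : ℕ) (a : Fin n → A), (∀ i, a i ∈ S) →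
    φ (List.ofFn a).prod = ∑ π : NC n, ∏ B ∈ π.1.parts, pairBlock φ a B

/-- A block moment is the full moment of a shorter tuple from `S`, to which the Wick formula applies
as well. -/
theorem IsWick.blockMoment_eq {φ : A →ₗ[ℂ] ℂ} {S : Set A} (h : IsWick φ S) {n : ℕ}
    (a : Fin n → A) (ha : ∀ i, a i ∈ S) (V : Finset (Fin n)) :
    blockMoment φ a V = ∑ ρ ∈ ncOn V, ∏ B ∈ ρ.parts, pairBlock φ a B := by
  have hV := V.map_orderEmbOfFin_univ rfl
  rw [← sum_NC_eq_sum_ncOn (V.orderEmbOfFin rfl) hV]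
  have h1 := h V.card (fun i => a (V.orderEmbOfFin rfl i)) fun i => ha _
  simp only [pairBlock_map] at h1
  rw [← h1, ← blockMoment_univ, blockMoment_map, hV]

theorem blockMoment_pair (φ : A →ₗ[ℂ] ℂ) {n : ℕ} (a : Fin n → A) {i j : Fin n} (hij : i < j) :
    blockMoment φ a {i, j} = φ (a i * a j) := by
  rw [blockMoment]
  congr 1
  have : ({i, j} : Finset (Fin n)).sort = [i, j] := by
    rw [show ({i, j} : Finset (Fin n)) = insert i {j} from rfl, Finset.sort_insert]
    · simp
    · intro b hb
      rw [Finset.mem_singleton] at hb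
      exact hb ▸ hij.le
    · simpa using hij.ne
  rw [this]
  simp

/-- For `n = 0` there is no block at all, whence the condition on `n`. -/
theorem NC.one_parts {n : ℕ} (hn : 1 ≤ n) : (NC.one n).1.parts = {Finset.univ} := by
  have hne : (Finset.univ : Finset (Fin n)) ≠ ⊥ :=
    Finset.Nonempty.ne_empty ⟨⟨0, hn⟩, Finset.mem_univ _⟩
  obtain ⟨B, hB⟩ := (⊤ : Finpartition (Finset.univ : Finset (Fin n))).parts_nonempty hne
  have hB1 := Finset.mem_singleton.1 (Finpartition.parts_top_subset _ hB)
  apply Finset.Subset.antisymm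
  · exact Finpartition.parts_top_subset _
  · rw [Finset.singleton_subset_iff]
    exact Set.mem_of_eq_of_mem hB1.symm hB

/-- With `K = pairBlock` the inversion leaves the single block of `1_n`, and `pairBlock` kills it
unless it has two points. -/
theorem IsWick.freeCumulant_eq {φ : A →ₗ[ℂ] ℂ} {S : Set A} (h : IsWick φ S) {n : ℕ}
    (hn : 1 ≤ n) (a : Fin n → A) (ha : ∀ i, a i ∈ S) :
    freeCumulant φ a = if n = 2 then φ (List.ofFn a).prod else 0 := by
  rw [freeCumulant_eq_prod φ a _ (h.blockMoment_eq a ha), NC.one_parts hn, Finset.prod_singleton,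
    pairBlock, blockMoment_univ]
  simp

theorem pairBlock_update_of_notMem (φ : A →ₗ[ℂ] ℂ) {n : ℕ} (a : Fin n → A) {j : Fin n}
    {B : Finset (Fin n)} (hj : j ∉ B) (x : A) :
    pairBlock φ (Function.update a j x) B = pairBlock φ a B := by
  rw [pairBlock, pairBlock, blockMoment, blockMoment]
  congr 3
  refine List.map_congr_left fun i hi => ?_
  rw [Function.update_of_ne]
  rintro rfl
  exact hj ((Finset.mem_sort _).1 hi)

theorem exists_linear_pairBlock_update (φ : A →ₗ[ℂ] ℂ) {n : ℕ} (a : Fin n → A) {j : Fin n}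
    {B : Finset (Fin n)} (hj : j ∈ B) :
    ∃ L : A →ₗ[ℂ] ℂ, ∀ x, pairBlock φ (Function.update a j x) B = L x := by
  by_cases hB : B.card = 2
  · obtain ⟨r, s, hrs, rfl⟩ := Finset.card_eq_two.1 hB
    wlog hlt : r < s generalizing r s
    · rw [Finset.pair_comm] at hj hB ⊢
      exact this s r hrs.symm hj hB (lt_of_le_of_ne (not_lt.1 hlt) hrs.symm)
    simp only [pairBlock, hB, if_true, blockMoment_pair φ _ hlt]
    rcases Finset.mem_insert.1 hj with rfl | hj
    · refine ⟨φ ∘ₗ LinearMap.mulRight ℂ (a s), fun x => ?_⟩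
      simp [Function.update_of_ne hrs.symm]
    · rw [Finset.mem_singleton] at hj
      subst hj
      refine ⟨φ ∘ₗ LinearMap.mulLeft ℂ (a r), fun x => ?_⟩
      simp [Function.update_of_ne hrs]
  · exact ⟨0, fun x => by simp [pairBlock, hB]⟩

/-- Exactly one block of each partition contains `j`; it is linear in the `j`-th entry and the other
blocks do not see it. -/
theorem exists_linear_wick_update (φ : A →ₗ[ℂ] ℂ) {n : ℕ} (a : Fin n → A) (j : Fin n) :
    ∃ L : A →ₗ[ℂ] ℂ, ∀ x,
      ∑ π : NC n, ∏ B ∈ π.1.parts, pairBlock φ (Function.update a j x) B = L x := by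
  have h1 : ∀ π : NC n, ∃ L : A →ₗ[ℂ] ℂ, ∀ x,
      ∏ B ∈ π.1.parts, pairBlock φ (Function.update a j x) B = L x := by
    intro π
    obtain ⟨V, hV, hj⟩ := π.1.exists_mem (Finset.mem_univ j)
    obtain ⟨L, hL⟩ := exists_linear_pairBlock_update φ a hj
    refine ⟨(∏ B ∈ π.1.parts.erase V, pairBlock φ a B) • L, fun x => ?_⟩
    rw [← Finset.mul_prod_erase _ _ hV, hL, LinearMap.smul_apply, smul_eq_mul, mul_comm]
    congr 1
    refine Finset.prod_congr rfl fun B hB => pairBlock_update_of_notMem φ a (fun hjB => ?_) x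
    exact (Finset.mem_erase.1 hB).1 (π.1.eq_of_mem_parts (Finset.mem_erase.1 hB).2 hV hjB hj)
  choose L hL using h1
  refine ⟨∑ π, L π, fun x => ?_⟩
  rw [LinearMap.sum_apply]
  exact Finset.sum_congr rfl fun π _ => hL π x

/-- The Wick formula extends from a set to its linear span. -/
theorem IsWick.span {φ : A →ₗ[ℂ] ℂ} {S : Set A} (h : IsWick φ S) :
    IsWick φ (Submodule.span ℂ S : Set A) := by
  classical
  intro n
  -- The letters are freed one position at a time; `s` is the set of positions already allowed to
  -- range over the span.
  suffices H : ∀ (s : Finset (Fin n)) (a : Fin n → A),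
      (∀ i ∈ s, a i ∈ Submodule.span ℂ S) → (∀ i, i ∉ s → a i ∈ S) →
      φ (List.ofFn a).prod = ∑ π : NC n, ∏ B ∈ π.1.parts, pairBlock φ a B from
    fun a ha => H Finset.univ a (fun i _ => ha i) fun i hi => absurd (Finset.mem_univ i) hi
  intro s
  induction s using Finset.induction_on with
  | empty => exact fun a _ ha => h n a fun i => ha i (Finset.notMem_empty i)
  | insert j s hj ih =>
    intro a ha hS
    obtain ⟨L, hL⟩ := exists_linear_wick_update φ a j
    have hM : ∀ x, φ (List.ofFn (Function.update a j x)).prod =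
        (φ ∘ₗ (MultilinearMap.mkPiAlgebraFin ℂ n A).toLinearMap a j) x := fun x => by simp
    -- Both sides are linear in the `j`-th entry and agree on `S` by induction, hence on the span.
    have key : ∀ x ∈ Submodule.span ℂ S,
        (φ ∘ₗ (MultilinearMap.mkPiAlgebraFin ℂ n A).toLinearMap a j) x = L x := by
      have : Set.EqOn (φ ∘ₗ (MultilinearMap.mkPiAlgebraFin ℂ n A).toLinearMap a j) L S := by
        intro x hx
        rw [← hM, ← hL]
        apply ih
        · intro i hi
          rw [Function.update_of_ne (by rintro rfl; exact hj hi)]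
          exact ha i (Finset.mem_insert_of_mem hi)
        · intro i hi
          by_cases hij : i = j
          · subst hij; simpa using hx
          · rw [Function.update_of_ne hij]
            exact hS i (by simp [hij, hi])
      exact fun x hx => LinearMap.eqOn_span this hx
    have := key (a j) (ha j (Finset.mem_insert_self _ _))
    rwa [← hM, ← hL, Function.update_eq_self] at this

end Cumulant

/-! ### Closed walks with coloured steps -/

section Walk

open Finset

variable {R I C : Type*} [Fintype R] [DecidableEq R] [DecidableEq I] [DecidableEq C]

/-- The signed incidence vector of the step `r`, which leads from `i r` to `i (γ r)`. -/
def stepVec (γ : Equiv.Perm R) (i : R → I) (r : R) : I → ℚ :=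
  Pi.single (i (γ r)) 1 - Pi.single (i r) 1

/-- The space of linear relations between the steps. -/
def stepRel (γ : Equiv.Perm R) (i : R → I) : Submodule ℚ (R → ℚ) :=
  LinearMap.ker (Fintype.linearCombination ℚ (stepVec γ i))

theorem mem_stepRel {γ : Equiv.Perm R} {i : R → I} {μ : R → ℚ} :
    μ ∈ stepRel γ i ↔ ∑ r, μ r • stepVec γ i r = 0 := by
  rw [stepRel, LinearMap.mem_ker, Fintype.linearCombination_apply]

/-- Two vertices are linked if the difference of their indicators is a combination of steps. -/
def Linked (γ : Equiv.Perm R) (i : R → I) (a b : I) : Prop :=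
  (Pi.single a 1 - Pi.single b 1 : I → ℚ) ∈
    LinearMap.range (Fintype.linearCombination ℚ (stepVec γ i))

theorem Linked.refl (γ : Equiv.Perm R) (i : R → I) (a : I) : Linked γ i a a := by
  simp [Linked]

theorem Linked.symm {γ : Equiv.Perm R} {i : R → I} {a b : I} (h : Linked γ i a b) :
    Linked γ i b a := by
  have := Submodule.neg_mem _ h
  rwa [neg_sub] at this

theorem Linked.trans {γ : Equiv.Perm R} {i : R → I} {a b c : I} (h : Linked γ i a b)
    (h' : Linked γ i b c) : Linked γ i a c := by
  have := Submodule.add_mem _ h h'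
  rwa [sub_add_sub_cancel] at this

theorem linked_step (γ : Equiv.Perm R) (i : R → I) (r : R) : Linked γ i (i (γ r)) (i r) :=
  ⟨Pi.single r 1, by rw [Fintype.linearCombination_apply_single, one_smul]; rfl⟩

variable [Fintype I]

/-- Rank-nullity for the step vectors: their span together with the indicator of `a` contains the
indicators of all visited vertices, so the rank is at least the number of vertices minus one. -/
theorem card_image_add_finrank_stepRel_le (γ : Equiv.Perm R) (i : R → I) (a : I)
    (hconn : ∀ r, Linked γ i (i r) a) :
    (univ.image i).card + Module.finrank ℚ (stepRel γ i) ≤ Fintype.card R + 1 := by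
  set Φ := Fintype.linearCombination ℚ (stepVec γ i) with hΦ
  set T : Submodule ℚ (I → ℚ) := LinearMap.range Φ ⊔ Submodule.span ℚ {Pi.single a 1} with hT
  have hmem : ∀ b : (univ.image i : Finset I), (Pi.single b.1 1 : I → ℚ) ∈ T := by
    rintro ⟨b, hb⟩
    obtain ⟨r, -, rfl⟩ := mem_image.1 hb
    have h1 : (Pi.single (i r) 1 - Pi.single a 1 : I → ℚ) ∈ T := Submodule.mem_sup_left (hconn r)
    have h2 : (Pi.single a 1 : I → ℚ) ∈ T :=
      Submodule.mem_sup_right (Submodule.mem_span_singleton_self _)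
    have := Submodule.add_mem _ h1 h2
    rwa [sub_add_cancel] at this
  have hli : LinearIndependent ℚ fun b : (univ.image i : Finset I) =>
      (⟨Pi.single b.1 1, hmem b⟩ : T) := by
    apply LinearIndependent.of_comp T.subtype
    exact (Pi.linearIndependent_single_one I ℚ).comp _ Subtype.val_injective
  have h1 := hli.fintype_card_le_finrank
  rw [Fintype.card_coe] at h1
  have h2 : Module.finrank ℚ T ≤ Module.finrank ℚ (LinearMap.range Φ) + 1 :=
    (Submodule.finrank_add_le_finrank_add_finrank _ _).trans
      (Nat.add_le_add_left (finrank_span_singleton (by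
        rw [Ne, Pi.single_eq_zero_iff]; exact one_ne_zero)).le _)
  have h3 := LinearMap.finrank_range_add_finrank_ker Φ
  rw [Module.finrank_fintype_fun_eq_card] at h3
  have h4 : Module.finrank ℚ (stepRel γ i) = Module.finrank ℚ (LinearMap.ker Φ) := rfl
  omega

/-- The degree of a vertex in the multigraph formed by the steps of a given colour. -/
def colourDegree (γ : Equiv.Perm R) (i : R → I) (c : R → C) (x : C) (a : I) : ℕ :=
  (univ.filter fun r => c r = x ∧ i r = a).card +
    (univ.filter fun r => c r = x ∧ i (γ r) = a).card

/-- A non-zero relation supported on the steps of a colour without vertices of degree one. -/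
theorem exists_colour_relation (γ : Equiv.Perm R) (i : R → I) (c : R → C) (x : C)
    (hx : x ∈ univ.image c) (hdeg : ∀ a, colourDegree γ i c x a ≠ 1) :
    ∃ μ : R → ℚ, μ ∈ stepRel γ i ∧ (∀ r, c r ≠ x → μ r = 0) ∧ μ ≠ 0 := by
  set S : Finset R := univ.filter fun r => c r = x with hS
  set V : Finset I := S.image i ∪ S.image (fun r => i (γ r)) with hV
  obtain ⟨r0, -, hr0⟩ := mem_image.1 hx
  have hr0S : r0 ∈ S := by simp [hS, hr0]
  have ha0 : i r0 ∈ V := mem_union_left _ (mem_image_of_mem _ hr0S)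
  have hcard : V.card ≤ S.card := by
    have h1 : ∑ a ∈ V, colourDegree γ i c x a = 2 * S.card := by
      simp only [colourDegree, sum_add_distrib]
      have e1 : ∑ a ∈ V, (univ.filter fun r => c r = x ∧ i r = a).card = S.card := by
        rw [card_eq_sum_card_fiberwise (f := i) (t := V)
          (fun r hr => mem_union_left _ (mem_image_of_mem _ hr))]
        simp only [hS, filter_filter]
      have e2 : ∑ a ∈ V, (univ.filter fun r => c r = x ∧ i (γ r) = a).card = S.card := by
        rw [card_eq_sum_card_fiberwise (f := fun r => i (γ r)) (t := V)
          (fun r hr => mem_union_right _ (mem_image_of_mem (fun r => i (γ r)) hr))]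
        simp only [hS, filter_filter]
      rw [e1, e2, two_mul]
    have h2 : ∑ a ∈ V, 2 ≤ ∑ a ∈ V, colourDegree γ i c x a := by
      refine sum_le_sum fun a ha => ?_
      have hne : colourDegree γ i c x a ≠ 0 := by
        intro h0
        rw [colourDegree, Nat.add_eq_zero_iff, card_eq_zero, card_eq_zero] at h0
        rcases mem_union.1 ha with h | h
        · obtain ⟨r, hr, rfl⟩ := mem_image.1 h
          have : r ∈ (univ.filter fun s => c s = x ∧ i s = i r) := by simpa [hS] using hr
          rw [h0.1] at this
          exact absurd this (notMem_empty _)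
        · obtain ⟨r, hr, rfl⟩ := mem_image.1 h
          have : r ∈ (univ.filter fun s => c s = x ∧ i (γ s) = i (γ r)) := by
            simpa [hS] using hr
          rw [h0.2] at this
          exact absurd this (notMem_empty _)
      have := hdeg a
      omega
    rw [h1, sum_const, smul_eq_mul] at h2
    omega
  -- Step vectors have coordinate sum zero, so one coordinate may be dropped. What remains is
  -- `S.card` vectors in a space of smaller dimension.
  set W : Finset I := V.erase (i r0) with hW
  have hWcard : W.card < S.card := by
    rw [hW, card_erase_of_mem ha0]
    have : 0 < V.card := card_pos.2 ⟨_, ha0⟩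
    omega
  let proj : (I → ℚ) →ₗ[ℚ] (W → ℚ) := LinearMap.funLeft ℚ ℚ (Subtype.val : W → I)
  let v : S → (W → ℚ) := fun r => proj (stepVec γ i r.1)
  have hnot : ¬ LinearIndependent ℚ v := by
    intro hli
    have := hli.fintype_card_le_finrank
    rw [Module.finrank_fintype_fun_eq_card, Fintype.card_coe, Fintype.card_coe] at this
    omega
  obtain ⟨g, hg, ⟨s, hs⟩, hgs⟩ := Fintype.not_linearIndependent_iff.1 hnot
  refine ⟨fun r => if h : r ∈ S then g ⟨r, h⟩ else 0, ?_, ?_, ?_⟩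
  · rw [mem_stepRel]
    have hsum : ∑ r, (if h : r ∈ S then g ⟨r, h⟩ else 0) • stepVec γ i r =
        ∑ r : S, g r • stepVec γ i r.1 := by
      rw [← Finset.sum_subset (Finset.subset_univ S)
        (fun r _ hr => by rw [dif_neg hr, zero_smul]), ← Finset.sum_coe_sort S]
      refine Finset.sum_congr rfl fun r _ => ?_
      rw [dif_pos r.2]
    rw [hsum]
    set u : I → ℚ := ∑ r : S, g r • stepVec γ i r.1 with hu
    have hWz : ∀ a ∈ W, u a = 0 := by
      intro a ha
      have h1 : proj u = 0 := by
        rw [hu, map_sum, ← hg]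
        exact Finset.sum_congr rfl fun r _ => by rw [map_smul]
      exact congrFun h1 ⟨a, ha⟩
    have hVz : ∀ a, a ∉ V → u a = 0 := by
      intro a ha
      rw [hu, Finset.sum_apply]
      refine Finset.sum_eq_zero fun r _ => ?_
      have h1 : a ≠ i r.1 := by
        rintro rfl; exact ha (mem_union_left _ (mem_image_of_mem _ r.2))
      have h2 : a ≠ i (γ r.1) := by
        rintro rfl
        exact ha (mem_union_right _ (mem_image_of_mem (fun r => i (γ r)) r.2))
      simp [stepVec, Pi.single_eq_of_ne h1, Pi.single_eq_of_ne h2]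
    -- The zero total recovers the vanishing of the dropped coordinate.
    have htot : ∑ a, u a = 0 := by
      simp only [hu, Finset.sum_apply]
      rw [Finset.sum_comm]
      refine Finset.sum_eq_zero fun r _ => ?_
      simp only [Pi.smul_apply, ← Finset.smul_sum, stepVec, Pi.sub_apply, sum_sub_distrib]
      simp
    have hz : ∀ a, a ≠ i r0 → u a = 0 := fun a ha => by
      by_cases h : a ∈ V
      · exact hWz a (mem_erase.2 ⟨ha, h⟩)
      · exact hVz a h
    funext a
    by_cases ha : a = i r0
    · rw [Fintype.sum_eq_single (i r0) hz] at htot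
      rw [ha, htot]; rfl
    · exact hz a ha
  · intro r hr
    have : r ∉ S := by simp [hS, hr]
    simp only [dif_neg this]
  · intro h0
    apply hgs
    have := congrFun h0 s
    simpa [hs] using this

/-- Every colour occurs at least twice, and no colour has a vertex of degree one. -/
structure Admissible (γ : Equiv.Perm R) (i : R → I) (c : R → C) : Prop where
  exists_ne : ∀ r, ∃ s, s ≠ r ∧ c s = c r
  degree_ne_one : ∀ r a, colourDegree γ i c (c r) a ≠ 1

/-- The indicator of a colour class cut out of a relation. -/
def restrictColour (c : R → C) (x : C) (μ : R → ℚ) : R → ℚ := fun r => if c r = x then μ r else 0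

/-- Non-zero relations with disjoint supports are independent, so the nullity is at least the number
of colours. If the bound is attained they span, and cutting a relation down to a colour leaves a
multiple of the relation chosen for that colour. -/
theorem card_add_card_le_of_relations (γ : Equiv.Perm R) (i : R → I) (c : R → C) (a : I)
    (hconn : ∀ r, Linked γ i (i r) a)
    (hrel : ∀ x ∈ univ.image c, ∃ μ : R → ℚ, μ ∈ stepRel γ i ∧ (∀ r, c r ≠ x → μ r = 0) ∧ μ ≠ 0) :
    (univ.image i).card + (univ.image c).card ≤ Fintype.card R + 1 ∧
    ((univ.image i).card + (univ.image c).card = Fintype.card R + 1 →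
      ∀ x ∈ univ.image c, ∃ μ : R → ℚ, μ ∈ stepRel γ i ∧ (∀ r, c r ≠ x → μ r = 0) ∧
        ∀ ν ∈ stepRel γ i, ∃ t : ℚ, restrictColour c x ν = t • μ) := by
  choose! lam hlam hsupp hne using hrel
  have hli : LinearIndependent ℚ fun x : (univ.image c : Finset C) => lam x.1 := by
    rw [Fintype.linearIndependent_iff]
    intro g hg x
    obtain ⟨r, hr⟩ := Function.ne_iff.1 (hne x.1 x.2)
    have hrx : c r = x.1 := by
      by_contra h
      exact hr (hsupp x.1 x.2 r h)
    have h1 := congrFun hg r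
    rw [Finset.sum_apply, Fintype.sum_eq_single x] at h1
    · simpa using (mul_eq_zero.1 (by simpa using h1)).resolve_right hr
    · intro y hy
      rw [Pi.smul_apply, hsupp y.1 y.2 r, smul_zero]
      rw [hrx]
      exact fun h => hy (Subtype.ext h.symm)
  set N := Submodule.span ℚ (Set.range fun x : (univ.image c : Finset C) => lam x.1) with hN
  have hNle : N ≤ stepRel γ i := by
    rw [hN, Submodule.span_le]
    rintro _ ⟨x, rfl⟩
    exact hlam x.1 x.2
  have hNf : Module.finrank ℚ N = (univ.image c).card := by
    rw [hN, finrank_span_eq_card hli, Fintype.card_coe]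
  have h1 := card_image_add_finrank_stepRel_le γ i a hconn
  have h2 := Submodule.finrank_mono hNle
  refine ⟨by omega, fun heq => ?_⟩
  have hEq : N = stepRel γ i := Submodule.eq_of_le_of_finrank_le hNle (by omega)
  intro x hx
  refine ⟨lam x, hlam x hx, hsupp x hx, fun ν hν => ?_⟩
  rw [← hEq, hN, Submodule.mem_span_range_iff_exists_fun] at hν
  obtain ⟨g, rfl⟩ := hν
  refine ⟨g ⟨x, hx⟩, ?_⟩
  funext r
  rw [restrictColour]
  split_ifs with h
  · rw [Finset.sum_apply, Fintype.sum_eq_single ⟨x, hx⟩]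
    intro y hy
    rw [Pi.smul_apply, hsupp y.1 y.2 r, smul_zero]
    rw [h]
    exact fun h' => hy (Subtype.ext h'.symm)
  · rw [Pi.smul_apply, hsupp x hx r h, smul_zero]

theorem Admissible.relations {γ : Equiv.Perm R} {i : R → I} {c : R → C}
    (h : Admissible γ i c) (x : C) (hx : x ∈ univ.image c) :
    ∃ μ : R → ℚ, μ ∈ stepRel γ i ∧ (∀ r, c r ≠ x → μ r = 0) ∧ μ ≠ 0 := by
  refine exists_colour_relation γ i c x hx fun a => ?_
  obtain ⟨r, -, rfl⟩ := mem_image.1 hx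
  exact h.degree_ne_one r a

/-- An invariant set of steps is a union of closed walks, and the increments along a closed walk
cancel. -/
theorem indicator_mem_stepRel (γ : Equiv.Perm R) (i : R → I) (S : Finset R)
    (hS : ∀ r, r ∈ S ↔ γ r ∈ S) : (fun r => if r ∈ S then (1 : ℚ) else 0) ∈ stepRel γ i := by
  rw [mem_stepRel]
  simp only [ite_smul, one_smul, zero_smul, Finset.sum_ite_mem, Finset.univ_inter, stepVec,
    sum_sub_distrib]
  rw [sub_eq_zero]
  refine Finset.sum_bij (fun r _ => γ r) (fun r hr => (hS r).1 hr)
    (fun r _ s _ h => γ.injective h) (fun s hs => ⟨γ.symm s, ?_, by simp⟩) (fun r _ => rfl)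
  rw [hS]; simpa using hs

/-- If two closed walks share a colour, the bound on the number of vertices improves by one. -/
theorem Admissible.card_add_card_le_of_crossing {γ : Equiv.Perm R} {i : R → I} {c : R → C}
    (h : Admissible γ i c) (a : I) (hconn : ∀ r, Linked γ i (i r) a) (S : Finset R)
    (hS : ∀ r, r ∈ S ↔ γ r ∈ S) {r₁ r₂ : R} (h₁ : r₁ ∈ S) (h₂ : r₂ ∉ S) (hc : c r₁ = c r₂) :
    (univ.image i).card + (univ.image c).card ≤ Fintype.card R := by
  obtain ⟨hle, heq⟩ := card_add_card_le_of_relations γ i c a hconn h.relations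
  refine Nat.le_of_lt_succ (lt_of_le_of_ne hle fun hE => ?_)
  -- With equality, the indicators of `S` and of its complement, cut down to the common colour, are
  -- multiples of one vector. At `r₁` and `r₂` they are `(1, 0)` and `(0, 1)`, which is impossible.
  obtain ⟨μ, -, -, hμ⟩ := heq hE (c r₁) (mem_image_of_mem _ (mem_univ _))
  obtain ⟨t, ht⟩ := hμ _ (indicator_mem_stepRel γ i S hS)
  obtain ⟨u, hu⟩ := hμ _ (indicator_mem_stepRel γ i Sᶜ (fun r => by
    rw [mem_compl, mem_compl, hS r]))
  have a1 := congrFun ht r₁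
  have a2 := congrFun ht r₂
  have a3 := congrFun hu r₁
  have a4 := congrFun hu r₂
  simp [restrictColour, h₁, h₂, hc] at a1 a2 a3 a4
  rcases a2 with rfl | h2
  · simp at a1
  · simp [h2] at a4

/-- In the extremal case every non-zero relation is constant on each colour class. -/
theorem extremal_const {γ : Equiv.Perm R} {i : R → I} {c : R → C} (a : I)
    (hconn : ∀ r, Linked γ i (i r) a)
    (hrel : ∀ x ∈ univ.image c, ∃ μ : R → ℚ, μ ∈ stepRel γ i ∧ (∀ r, c r ≠ x → μ r = 0) ∧ μ ≠ 0)
    (hE : (univ.image i).card + (univ.image c).card = Fintype.card R + 1) :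
    (∀ ν ∈ stepRel γ i, ∀ r s, c r = c s → ν r = ν s) ∧
    ∀ x, restrictColour c x 1 ∈ stepRel γ i := by
  obtain ⟨-, heq⟩ := card_add_card_le_of_relations γ i c a hconn hrel
  have hone : (1 : R → ℚ) ∈ stepRel γ i := by
    have := indicator_mem_stepRel γ i Finset.univ (fun r => by simp)
    simp only [Finset.mem_univ, if_true] at this
    exact this
  constructor
  · intro ν hν r s hrs
    -- The all-ones relation cut down to the colour is a multiple of `μ`, so `μ` is a non-zero
    -- constant there, and every other relation is a multiple of it.
    obtain ⟨μ, -, -, hμ⟩ := heq hE (c r) (mem_image_of_mem _ (mem_univ _))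
    obtain ⟨t, ht⟩ := hμ 1 hone
    obtain ⟨u, hu⟩ := hμ ν hν
    have a1 := congrFun ht r
    have a2 := congrFun ht s
    have a3 := congrFun hu r
    have a4 := congrFun hu s
    simp [restrictColour, hrs] at a1 a2 a3 a4
    have ht0 : t ≠ 0 := by rintro rfl; simp at a1
    have : μ r = μ s := mul_left_cancel₀ ht0 (a1.symm.trans a2)
    rw [a3, a4, this]
  · intro x
    by_cases hx : x ∈ univ.image c
    · obtain ⟨μ, hm, -, hμ⟩ := heq hE x hx
      obtain ⟨t, ht⟩ := hμ 1 hone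
      rw [ht]
      exact Submodule.smul_mem _ _ hm
    · have : restrictColour c x (1 : R → ℚ) = 0 := by
        funext r
        rw [restrictColour, if_neg]
        · rfl
        · rintro rfl; exact hx (mem_image_of_mem _ (mem_univ _))
      rw [this]
      exact Submodule.zero_mem _

/-- In the extremal case the two steps of a colour class of size two are opposite. -/
theorem extremal_opposite {γ : Equiv.Perm R} {i : R → I} {c : R → C} (a : I)
    (hconn : ∀ r, Linked γ i (i r) a)
    (hrel : ∀ x ∈ univ.image c, ∃ μ : R → ℚ, μ ∈ stepRel γ i ∧ (∀ r, c r ≠ x → μ r = 0) ∧ μ ≠ 0)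
    (hE : (univ.image i).card + (univ.image c).card = Fintype.card R + 1)
    {r s : R} (hrs : r ≠ s) (hcl : ∀ u, c u = c r ↔ u = r ∨ u = s) :
    i (γ r) ≠ i r ∧ i (γ r) = i s ∧ i (γ s) = i r := by
  obtain ⟨hconst, hind⟩ := extremal_const a hconn hrel hE
  have hcs : c s = c r := (hcl s).2 (Or.inr rfl)
  have hsum : stepVec γ i r + stepVec γ i s = 0 := by
    have := mem_stepRel.1 (hind (c r))
    rw [← this, Finset.sum_eq_add_of_mem r s (mem_univ _) (mem_univ _) hrs]
    · simp [restrictColour, hcs]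
    · intro u _ hu
      have : c u ≠ c r := fun h => by
        rcases (hcl u).1 h with h | h
        · exact hu.1 h
        · exact hu.2 h
      simp [restrictColour, this]
  -- A loop would make `Pi.single r 1` a relation, although it is not constant on the pair.
  have hne : i (γ r) ≠ i r := by
    intro h
    have hm : (Pi.single r 1 : R → ℚ) ∈ stepRel γ i := by
      rw [mem_stepRel, Fintype.sum_eq_single r]
      · simp [stepVec, h]
      · intro u hu; simp [Pi.single_eq_of_ne hu]
    have := hconst _ hm r s hcs.symm
    rw [Pi.single_eq_same, Pi.single_eq_of_ne hrs.symm] at this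
    exact one_ne_zero this
  refine ⟨hne, ?_, ?_⟩
  -- The entry `1` at the end of step `r` can only be cancelled by the start of step `s`.
  · have := congrFun hsum (i (γ r))
    simp only [stepVec, Pi.add_apply, Pi.sub_apply, Pi.single_eq_same, Pi.single_eq_of_ne hne,
      Pi.zero_apply] at this
    by_contra h
    rw [Pi.single_eq_of_ne h] at this
    have h2 : (0 : ℚ) ≤ (Pi.single (i (γ s)) 1 : I → ℚ) (i (γ r)) := by
      by_cases h : i (γ r) = i (γ s)
      · rw [h, Pi.single_eq_same]; norm_num
      · rw [Pi.single_eq_of_ne h]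
    linarith
  · have := congrFun hsum (i r)
    simp only [stepVec, Pi.add_apply, Pi.sub_apply, Pi.single_eq_same, Pi.single_eq_of_ne hne.symm,
      Pi.zero_apply] at this
    by_contra h
    rw [Pi.single_eq_of_ne (Ne.symm h)] at this
    have h2 : (0 : ℚ) ≤ (Pi.single (i s) 1 : I → ℚ) (i r) := by
      by_cases h : i r = i s
      · rw [h, Pi.single_eq_same]; norm_num
      · rw [Pi.single_eq_of_ne h]
    linarith

end Walk

/-! ### Cyclic walks and non-crossing pairings -/

section Cyclic

open Finset

theorem finRotate_castSucc {k : ℕ} (r : Fin k) : finRotate (k + 1) r.castSucc = r.succ := by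
  rw [finRotate_apply, Fin.coeSucc_eq_succ]

theorem sum_Iio_sub {G : Type*} [AddCommGroup G] {k : ℕ} (f : Fin (k + 1) → G)
    (u : Fin (k + 1)) : ∑ r ∈ Iio u, (f (finRotate (k + 1) r) - f r) = f u - f 0 := by
  induction u using Fin.induction with
  | zero =>
    rw [show Iio (0 : Fin (k + 1)) = ∅ from by ext x; simp, Finset.sum_empty, sub_self]
  | succ u ih =>
    have : Iio u.succ = insert u.castSucc (Iio u.castSucc) := by
      ext x
      simp only [mem_Iio, mem_insert, Fin.lt_def, Fin.ext_iff, Fin.val_succ, Fin.val_castSucc]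
      omega
    rw [this, sum_insert (by simp), ih, finRotate_castSucc]
    abel

theorem sum_Ioo_sub {G : Type*} [AddCommGroup G] {k : ℕ} (f : Fin (k + 1) → G)
    {r s : Fin (k + 1)} (hrs : r < s) :
    ∑ u ∈ Ioo r s, (f (finRotate (k + 1) u) - f u) = f s - f (finRotate (k + 1) r) := by
  have h1 : Iio s = Iio r ∪ insert r (Ioo r s) := by
    ext x
    simp only [mem_Iio, mem_union, mem_insert, mem_Ioo]
    constructor
    · intro h
      rcases lt_trichotomy x r with h' | h' | h'
      · exact Or.inl h'
      · exact Or.inr (Or.inl h')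
      · exact Or.inr (Or.inr ⟨h', h⟩)
    · rintro (h | h | h)
      · exact h.trans hrs
      · exact h ▸ hrs
      · exact h.2
  have h2 := sum_Iio_sub f s
  rw [h1, sum_union, sum_insert (by simp), sum_Iio_sub] at h2
  · have h3 := congrArg (fun x => x - (f r - f 0) - (f (finRotate (k + 1) r) - f r)) h2
    convert h3 using 1 <;> abel
  · rw [Finset.disjoint_left]
    intro x hx hx'
    simp only [mem_Iio, mem_insert, mem_Ioo] at hx hx'
    rcases hx' with h | h
    · exact absurd (h ▸ hx) (lt_irrefl _)
    · exact absurd (hx.trans h.1) (lt_irrefl _)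

variable {I C : Type*} [DecidableEq I] [Fintype I] [DecidableEq C]

theorem linked_finRotate {k : ℕ} (i : Fin (k + 1) → I) (r : Fin (k + 1)) :
    Linked (finRotate (k + 1)) i (i r) (i 0) := by
  induction r using Fin.induction with
  | zero => exact Linked.refl _ _ _
  | succ r ih =>
    have := linked_step (finRotate (k + 1)) i r.castSucc
    rw [finRotate_castSucc] at this
    exact this.trans ih

/-- In the extremal case a pairing of the steps of a cyclic walk is non-crossing. -/
theorem extremal_noncrossing {k : ℕ} {i : Fin (k + 1) → I} {c : Fin (k + 1) → C}
    (hrel : ∀ x ∈ univ.image c, ∃ μ : Fin (k + 1) → ℚ, μ ∈ stepRel (finRotate (k + 1)) i ∧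
      (∀ r, c r ≠ x → μ r = 0) ∧ μ ≠ 0)
    (hE : (univ.image i).card + (univ.image c).card = Fintype.card (Fin (k + 1)) + 1)
    {r u s w : Fin (k + 1)} (hru : r < u) (hus : u < s) (hsw : s < w)
    (hcl : ∀ v, c v = c r ↔ v = r ∨ v = s) (huw : c u = c w) : False := by
  obtain ⟨hconst, -⟩ := extremal_const (i 0) (linked_finRotate i) hrel hE
  obtain ⟨-, h2, -⟩ := extremal_opposite (i 0) (linked_finRotate i) hrel hE
    (hru.trans hus).ne hcl
  -- Steps `r` and `s` are opposite, so the steps strictly between them form a closed walk. Its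
  -- indicator is a relation that takes different values at `u` and `w`.
  have hm : (fun v => if v ∈ Ioo r s then (1 : ℚ) else 0) ∈ stepRel (finRotate (k + 1)) i := by
    rw [mem_stepRel]
    simp only [ite_smul, one_smul, zero_smul, Finset.sum_ite_mem, Finset.univ_inter, stepVec]
    rw [sum_Ioo_sub (fun v => (Pi.single (i v) 1 : I → ℚ)) (hru.trans hus), h2, sub_self]
  have := hconst _ hm u w huw
  rw [if_pos (mem_Ioo.2 ⟨hru, hus⟩), if_neg (fun h => absurd ((mem_Ioo.1 h).2) hsw.le.not_gt)]
    at this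
  exact one_ne_zero this

section Count

variable {k : ℕ} {τ : Fin (k + 1) → Fin (k + 1)} {G : Type*} [AddCommGroup G]

/-- The antisymmetric function on the steps with prescribed values on the openers. -/
def antisymm (τ : Fin (k + 1) → Fin (k + 1)) (h : {r // r < τ r} → G) (r : Fin (k + 1)) : G :=
  -- The last value is a default, never reached when `τ` is an involution without fixed points.
  if hr : r < τ r then h ⟨r, hr⟩ else if hr' : τ r < τ (τ r) then -h ⟨τ r, hr'⟩ else 0

theorem antisymm_of_lt {h : {r // r < τ r} → G} {r : Fin (k + 1)} (hr : r < τ r) :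
    antisymm τ h r = h ⟨r, hr⟩ := dif_pos hr

theorem antisymm_apply_invol (hτ : ∀ r, τ (τ r) = r) (hne : ∀ r, τ r ≠ r)
    (h : {r // r < τ r} → G) (r : Fin (k + 1)) : antisymm τ h (τ r) = -antisymm τ h r := by
  rcases lt_or_gt_of_ne (hne r).symm with hr | hr
  · rw [antisymm_of_lt hr, antisymm, dif_neg (by rw [hτ]; exact hr.le.not_gt),
      dif_pos (by simpa only [hτ] using hr)]
    simp only [hτ]
  · have : τ r < τ (τ r) := by rwa [hτ]
    rw [antisymm_of_lt this, antisymm, dif_neg hr.le.not_gt, dif_pos this, neg_neg]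

theorem sum_antisymm_eq_zero {g : Fin (k + 1) → G} (hτ : ∀ r, τ (τ r) = r) (hne : ∀ r, τ r ≠ r)
    (hg : ∀ r, g (τ r) = -g r) (T : Finset (Fin (k + 1))) (hT : ∀ r ∈ T, τ r ∈ T) :
    ∑ r ∈ T, g r = 0 :=
  Finset.sum_involution (fun r _ => τ r) (fun r _ => by rw [hg, add_neg_cancel])
    (fun r _ _ => hne r) (fun r hr => hT r hr) (fun r _ => hτ r)

/-- The closed walk with given starting point and given steps. -/
def walkOfSteps (a : G) (g : Fin (k + 1) → G) (u : Fin (k + 1)) : G := a + ∑ r ∈ Iio u, g r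

theorem walkOfSteps_zero (a : G) (g : Fin (k + 1) → G) : walkOfSteps a g 0 = a := by
  rw [walkOfSteps, show Iio (0 : Fin (k + 1)) = ∅ from by ext x; simp, Finset.sum_empty, add_zero]

/-- The zero total is what makes the last step lead back to the starting point. -/
theorem walkOfSteps_rotate (a : G) (g : Fin (k + 1) → G) (hg : ∑ r, g r = 0) (u : Fin (k + 1)) :
    walkOfSteps a g (finRotate (k + 1) u) - walkOfSteps a g u = g u := by
  induction u using Fin.lastCases with
  | last =>
    rw [finRotate_last, walkOfSteps_zero, walkOfSteps]
    have : (univ : Finset (Fin (k + 1))) = insert (Fin.last k) (Iio (Fin.last k)) := by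
      ext x
      simp only [mem_univ, mem_insert, mem_Iio, true_iff]
      exact (Fin.le_last x).eq_or_lt
    rw [this, sum_insert (by simp)] at hg
    rw [sub_add_cancel_left, eq_neg_of_add_eq_zero_left hg]
  | cast u =>
    have : Iio u.succ = insert u.castSucc (Iio u.castSucc) := by
      ext x
      simp only [mem_Iio, mem_insert, Fin.lt_def, Fin.ext_iff, Fin.val_succ, Fin.val_castSucc]
      omega
    rw [finRotate_castSucc, walkOfSteps, walkOfSteps, this, sum_insert (by simp)]
    abel

/-- The closed walks in which paired steps are opposite to each other. -/
def OppositeWalk (τ : Fin (k + 1) → Fin (k + 1)) {I : Type*} (i : Fin (k + 1) → I) : Prop :=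
  ∀ r, i (finRotate (k + 1) r) = i (τ r)

/-- In a non-crossing pairing the steps strictly under an arc are paired among themselves. Their
increments cancel, so the walk is at the same vertex after `r` and before `τ r`. -/
theorem oppositeWalk_walkOfSteps (hτ : ∀ r, τ (τ r) = r) (hne : ∀ r, τ r ≠ r)
    (hnc : ∀ r u, r < u → u < τ r → r < τ u ∧ τ u < τ r) (a : G) {g : Fin (k + 1) → G}
    (hg : ∀ r, g (τ r) = -g r) : OppositeWalk τ (walkOfSteps a g) := by
  have hstep := walkOfSteps_rotate a g
    (sum_antisymm_eq_zero hτ hne hg Finset.univ fun r _ => mem_univ _)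
  have key : ∀ r, r < τ r →
      walkOfSteps a g (finRotate (k + 1) r) = walkOfSteps a g (τ r) := by
    intro r hr
    have h1 := sum_Ioo_sub (walkOfSteps a g) hr
    rw [Finset.sum_congr rfl fun u _ => hstep u, sum_antisymm_eq_zero hτ hne hg] at h1
    · exact (sub_eq_zero.1 h1.symm).symm
    · intro u hu
      rw [mem_Ioo] at hu ⊢
      exact hnc r u hu.1 hu.2
  intro r
  rcases lt_or_gt_of_ne (hne r).symm with hr | hr
  · exact key r hr
  · have h1 := key (τ r) (by rwa [hτ])
    rw [hτ] at h1
    have h2 := hstep r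
    have h3 := hstep (τ r)
    rw [hg, h1] at h3
    have h4 : walkOfSteps a g (finRotate (k + 1) r) = walkOfSteps a g r + g r := by
      rw [← h2]; abel
    have h5 : walkOfSteps a g (τ r) = walkOfSteps a g r + g r := by
      have h6 := neg_eq_iff_eq_neg.2 h3
      rw [← h6]; abel
    rw [h4, h5]

/-- For a non-crossing pairing an opposite walk is determined by its starting point and by the
steps which open a pair. -/
def oppositeWalkEquiv (hτ : ∀ r, τ (τ r) = r) (hne : ∀ r, τ r ≠ r)
    (hnc : ∀ r u, r < u → u < τ r → r < τ u ∧ τ u < τ r) :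
    {i : Fin (k + 1) → G // OppositeWalk τ i} ≃ G × ({r // r < τ r} → G) where
  toFun i := (i.1 0, fun r => i.1 (finRotate (k + 1) r.1) - i.1 r.1)
  invFun x := ⟨walkOfSteps x.1 (antisymm τ x.2),
    oppositeWalk_walkOfSteps hτ hne hnc x.1 (antisymm_apply_invol hτ hne x.2)⟩
  left_inv := by
    rintro ⟨i, hi⟩
    apply Subtype.ext
    funext u
    have hd : ∀ r, antisymm τ (fun r : {r // r < τ r} => i (finRotate (k + 1) r.1) - i r.1) r =
        i (finRotate (k + 1) r) - i r := by
      intro r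
      rcases lt_or_gt_of_ne (hne r).symm with hr | hr
      · rw [antisymm_of_lt hr]
      · have hr' : τ r < τ (τ r) := by rwa [hτ]
        rw [antisymm, dif_neg hr.le.not_gt, dif_pos hr']
        simp only [hi r, hi (τ r), hτ, neg_sub]
    simp only [walkOfSteps]
    rw [Finset.sum_congr rfl fun r _ => hd r, sum_Iio_sub]
    abel
  right_inv := by
    rintro ⟨a, h⟩
    refine Prod.ext (walkOfSteps_zero _ _) ?_
    funext r
    have := walkOfSteps_rotate a (antisymm τ h) (sum_antisymm_eq_zero hτ hne
      (antisymm_apply_invol hτ hne h) Finset.univ fun r _ => mem_univ _) r.1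
    rw [antisymm_of_lt r.2] at this
    exact this

/-- To speak of increments the vertices are identified with a cyclic group. A walk is then a free
choice of its start and of one increment for each of the `b` pairs. -/
theorem card_oppositeWalk {I : Type*} [Fintype I] [Nonempty I] [DecidableEq I]
    (hτ : ∀ r, τ (τ r) = r) (hne : ∀ r, τ r ≠ r)
    (hnc : ∀ r u, r < u → u < τ r → r < τ u ∧ τ u < τ r) {b : ℕ} (hb : 2 * b = k + 1) :
    Nat.card {i : Fin (k + 1) → I // OppositeWalk τ i} = Fintype.card I ^ (b + 1) := by
  classical
  have : NeZero (Fintype.card I) := ⟨Fintype.card_ne_zero⟩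
  let e : I ≃ ZMod (Fintype.card I) := Fintype.equivOfCardEq (ZMod.card _).symm
  have e1 : {i : Fin (k + 1) → I // OppositeWalk τ i} ≃
      {i : Fin (k + 1) → ZMod (Fintype.card I) // OppositeWalk τ i} :=
    Equiv.subtypeEquiv (Equiv.arrowCongr (Equiv.refl _) e) fun i => by
      simp [OppositeWalk]
  rw [Nat.card_congr (e1.trans (oppositeWalkEquiv hτ hne hnc)), Nat.card_eq_fintype_card,
    Fintype.card_prod, Fintype.card_fun, ZMod.card]
  have hcard : Fintype.card {r // r < τ r} = b := by
    have h1 : Fintype.card {r // r < τ r} = Fintype.card {r // ¬ r < τ r} := by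
      refine Fintype.card_congr ⟨fun r => ⟨τ r.1, by rw [hτ]; exact r.2.le.not_gt⟩,
        fun r => ⟨τ r.1, ?_⟩, fun r => Subtype.ext (hτ _), fun r => Subtype.ext (hτ _)⟩
      rw [hτ]
      exact lt_of_le_of_ne (not_lt.1 r.2) (hne _)
    have h2 := Fintype.card_subtype_compl (fun r : Fin (k + 1) => r < τ r)
    have h3 := Fintype.card_subtype_le (fun r : Fin (k + 1) => r < τ r)
    rw [Fintype.card_fin] at h2 h3
    omega
  rw [hcard, pow_succ']

end Count

end Cyclic

/-! ### Products of entries along a walk -/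

/-- Pairs `(x c i, y c i)` of real random variables, independent over the columns `c` and the rows
`i`, standardized, with correlation `ρ c` and with moments bounded by `B`. -/
structure IsEntryModel {Ω : Type*} [MeasurableSpace Ω] (P : Measure Ω) {C I : Type*}
    (x y : C → I → Ω → ℝ) (ρ : C → ℝ) (B : ℕ → ℝ) : Prop where
  measX : ∀ c i, Measurable (x c i)
  measY : ∀ c i, Measurable (y c i)
  indep : iIndepFun (fun (q : C × I) (ω : Ω) => ((x q.1 q.2 ω, y q.1 q.2 ω) : ℝ × ℝ)) P
  meanX : ∀ c i, ∫ ω, x c i ω ∂P = 0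
  meanY : ∀ c i, ∫ ω, y c i ω ∂P = 0
  varX : ∀ c i, ∫ ω, (x c i ω) ^ 2 ∂P = 1
  varY : ∀ c i, ∫ ω, (y c i ω) ^ 2 ∂P = 1
  corr : ∀ c i, ∫ ω, x c i ω * y c i ω ∂P = ρ c
  intX : ∀ c i k, Integrable (fun ω => |x c i ω| ^ k) P
  intY : ∀ c i k, Integrable (fun ω => |y c i ω| ^ k) P
  momX : ∀ c i k, ∫ ω, |x c i ω| ^ k ∂P ≤ B k
  momY : ∀ c i k, ∫ ω, |y c i ω| ^ k ∂P ≤ B k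

/-- The contribution of the column `c` to an entry of `X Y^* - n ρ` or of its transpose. -/
def centredTerm {Ω C I : Type*} [DecidableEq I] (x y : C → I → Ω → ℝ) (ρ : C → ℝ) (c : C)
    (b : Bool) (i j : I) (ω : Ω) : ℝ :=
  (if b then x c j ω * y c i ω else x c i ω * y c j ω) - if i = j then ρ c else 0

/-- The product of the contributions along a walk `i` with columns `c`. -/
def walkTerm {Ω C I R : Type*} [DecidableEq I] [Fintype R] (x y : C → I → Ω → ℝ) (ρ : C → ℝ)
    (γ : Equiv.Perm R) (β : R → Bool) (i : R → I) (c : R → C) (ω : Ω) : ℝ :=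
  ∏ r, centredTerm x y ρ (c r) (β r) (i r) (i (γ r)) ω

section Model

open Finset

variable {Ω : Type*} [MeasurableSpace Ω] {P : Measure Ω} [IsProbabilityMeasure P]
  {C I : Type*} [Fintype C] [Fintype I] [DecidableEq C] [DecidableEq I]
  {x y : C → I → Ω → ℝ} {ρ : C → ℝ} {B : ℕ → ℝ}

/-- The sigma-algebra generated by the entries with index in `S`. -/
abbrev entrySigma (x y : C → I → Ω → ℝ) (S : Set (C × I)) : MeasurableSpace Ω :=
  ⨆ q ∈ S, MeasurableSpace.comap (fun ω => ((x q.1 q.2 ω, y q.1 q.2 ω) : ℝ × ℝ)) inferInstance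

theorem measurable_entryX {S : Set (C × I)} {c : C} {i : I} (h : (c, i) ∈ S) :
    Measurable[entrySigma x y S] (x c i) := by
  have h1 : MeasurableSpace.comap (fun ω => ((x c i ω, y c i ω) : ℝ × ℝ)) inferInstance ≤
      entrySigma x y S :=
    le_iSup₂ (f := fun q _ => MeasurableSpace.comap
      (fun ω => ((x q.1 q.2 ω, y q.1 q.2 ω) : ℝ × ℝ)) inferInstance) (c, i) h
  exact (measurable_fst.comp (comap_measurable (fun ω => ((x c i ω, y c i ω) : ℝ × ℝ)))).mono
    h1 le_rfl

theorem measurable_entryY {S : Set (C × I)} {c : C} {i : I} (h : (c, i) ∈ S) :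
    Measurable[entrySigma x y S] (y c i) := by
  have h1 : MeasurableSpace.comap (fun ω => ((x c i ω, y c i ω) : ℝ × ℝ)) inferInstance ≤
      entrySigma x y S :=
    le_iSup₂ (f := fun q _ => MeasurableSpace.comap
      (fun ω => ((x q.1 q.2 ω, y q.1 q.2 ω) : ℝ × ℝ)) inferInstance) (c, i) h
  exact (measurable_snd.comp (comap_measurable (fun ω => ((x c i ω, y c i ω) : ℝ × ℝ)))).mono
    h1 le_rfl

theorem measurable_centredTerm {S : Set (C × I)} {c : C} (b : Bool) {i j : I} (hi : (c, i) ∈ S)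
    (hj : (c, j) ∈ S) : Measurable[entrySigma x y S] (centredTerm x y ρ c b i j) := by
  have h1 := measurable_entryX (x := x) (y := y) hi
  have h2 := measurable_entryX (x := x) (y := y) hj
  have h3 := measurable_entryY (x := x) (y := y) hi
  have h4 := measurable_entryY (x := x) (y := y) hj
  unfold centredTerm
  cases b
  · simpa using (h1.mul h4).sub_const _
  · simpa using (h2.mul h3).sub_const _

namespace IsEntryModel

variable (h : IsEntryModel P x y ρ B)
include h

theorem entrySigma_le (S : Set (C × I)) : entrySigma x y S ≤ ‹MeasurableSpace Ω› :=
  iSup₂_le fun q _ => ((h.measX q.1 q.2).prodMk (h.measY q.1 q.2)).comap_le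

theorem integral_mul_of_disjoint {S T : Set (C × I)} (hST : Disjoint S T) {f g : Ω → ℝ}
    (hf : Measurable[entrySigma x y S] f) (hg : Measurable[entrySigma x y T] g) :
    ∫ ω, f ω * g ω ∂P = (∫ ω, f ω ∂P) * ∫ ω, g ω ∂P := by
  have hi : Indep (entrySigma x y S) (entrySigma x y T) P := by
    refine indep_iSup_of_disjoint (fun q => ?_) ?_ hST
    · exact ((h.measX q.1 q.2).prodMk (h.measY q.1 q.2)).comap_le
    · exact h.indep
  have hfg : IndepFun f g P := by
    rw [IndepFun_iff_Indep]
    exact indep_of_indep_of_le_left (indep_of_indep_of_le_right hi hg.comap_le) hf.comap_le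
  exact hfg.integral_fun_mul_eq_mul_integral
    (hf.mono (h.entrySigma_le S) le_rfl).aestronglyMeasurable
    (hg.mono (h.entrySigma_le T) le_rfl).aestronglyMeasurable

theorem measurable_centred (c : C) (b : Bool) (i j : I) :
    Measurable (centredTerm x y ρ c b i j) :=
  (measurable_centredTerm b (S := Set.univ) (Set.mem_univ _) (Set.mem_univ _)).mono
    (h.entrySigma_le _) le_rfl

theorem abs_corr_le_one (c : C) (i : I) : |ρ c| ≤ 1 := by
  have h1 : Integrable (fun ω => (x c i ω) ^ 2) P := by simpa using h.intX c i 2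
  have h2 : Integrable (fun ω => (y c i ω) ^ 2) P := by simpa using h.intY c i 2
  rw [← h.corr c i]
  calc |∫ ω, x c i ω * y c i ω ∂P| ≤ ∫ ω, |x c i ω * y c i ω| ∂P := abs_integral_le_integral_abs
    _ ≤ ∫ ω, ((x c i ω) ^ 2 + (y c i ω) ^ 2) / 2 ∂P := by
      refine integral_mono_of_nonneg (ae_of_all _ fun ω => abs_nonneg _)
        ((h1.add h2).div_const 2) (ae_of_all _ fun ω => ?_)
      simp only [abs_mul]
      nlinarith [sq_nonneg (|x c i ω| - |y c i ω|), sq_abs (x c i ω), sq_abs (y c i ω)]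
    _ = 1 := by
      rw [integral_div, integral_add h1 h2, h.varX, h.varY]; norm_num

/-- All four entries appear on the right so that one bound serves both orientations `b`. The factor
`2 ^ k` comes from `(u + 1) ^ k ≤ 2 ^ k * (u ^ k + 1)`. -/
theorem abs_centredTerm_pow_le (c : C) (b : Bool) (i j : I) (k : ℕ) (ω : Ω) :
    |centredTerm x y ρ c b i j ω| ^ k ≤
      2 ^ k * (|x c i ω| ^ (2 * k) + |y c j ω| ^ (2 * k) +
        (|x c j ω| ^ (2 * k) + |y c i ω| ^ (2 * k)) + 1) := by
  have hρ : |if i = j then ρ c else 0| ≤ 1 := by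
    split_ifs
    · exact h.abs_corr_le_one c i
    · simp
  have hprod : ∀ u v : ℝ, (|u| * |v|) ^ k ≤ |u| ^ (2 * k) + |v| ^ (2 * k) := by
    intro u v
    rw [mul_pow, mul_comm 2 k, pow_mul, pow_mul]
    have h1 := pow_nonneg (abs_nonneg u) k
    have h2 := pow_nonneg (abs_nonneg v) k
    nlinarith [sq_nonneg (|u| ^ k - |v| ^ k), mul_nonneg h1 h2]
  have hsum : ∀ u : ℝ, 0 ≤ u → (u + 1) ^ k ≤ 2 ^ k * (u ^ k + 1) := by
    intro u hu
    rcases le_total u 1 with h1 | h1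
    · calc (u + 1) ^ k ≤ 2 ^ k := pow_le_pow_left₀ (by linarith) (by linarith) k
        _ ≤ 2 ^ k * (u ^ k + 1) := by nlinarith [pow_nonneg hu k, pow_pos (two_pos (α := ℝ)) k]
    · calc (u + 1) ^ k ≤ (2 * u) ^ k := pow_le_pow_left₀ (by linarith) (by linarith) k
        _ ≤ 2 ^ k * (u ^ k + 1) := by
          rw [mul_pow]; nlinarith [pow_nonneg hu k, pow_pos (two_pos (α := ℝ)) k]
  have hp : ∀ u : ℝ, 0 ≤ |u| ^ (2 * k) := fun u => pow_nonneg (abs_nonneg u) _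
  have gen : ∀ u v : ℝ, |u * v - if i = j then ρ c else 0| ^ k ≤
      2 ^ k * (|u| ^ (2 * k) + |v| ^ (2 * k) + 1) := by
    intro u v
    calc |u * v - if i = j then ρ c else 0| ^ k ≤ (|u| * |v| + 1) ^ k := by
          refine pow_le_pow_left₀ (abs_nonneg _) ?_ k
          refine (abs_sub _ _).trans ?_
          rw [abs_mul]
          linarith
      _ ≤ 2 ^ k * ((|u| * |v|) ^ k + 1) := hsum _ (by positivity)
      _ ≤ _ := by
        have := hprod u v
        gcongr
  rw [centredTerm]
  cases b
  · refine (gen _ _).trans (mul_le_mul_of_nonneg_left ?_ (by positivity))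
    linarith [hp (x c j ω), hp (y c i ω)]
  · refine (gen _ _).trans (mul_le_mul_of_nonneg_left ?_ (by positivity))
    linarith [hp (x c i ω), hp (y c j ω)]

theorem integrable_bound (c : C) (i j : I) (k : ℕ) : Integrable (fun ω =>
    2 ^ k * (|x c i ω| ^ (2 * k) + |y c j ω| ^ (2 * k) +
        (|x c j ω| ^ (2 * k) + |y c i ω| ^ (2 * k)) + 1)) P :=
  ((((h.intX _ _ _).add (h.intY _ _ _)).add ((h.intX _ _ _).add (h.intY _ _ _))).add
    (integrable_const 1)).const_mul _

theorem integrable_centredTerm_pow (c : C) (b : Bool) (i j : I) (k : ℕ) :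
    Integrable (fun ω => |centredTerm x y ρ c b i j ω| ^ k) P := by
  refine (h.integrable_bound c i j k).mono'
    ((h.measurable_centred c b i j).norm.pow_const k).aestronglyMeasurable (ae_of_all _ fun ω => ?_)
  rw [Real.norm_of_nonneg (pow_nonneg (abs_nonneg _) _)]
  exact h.abs_centredTerm_pow_le c b i j k ω

theorem integral_centredTerm_pow_le (c : C) (b : Bool) (i j : I) (k : ℕ) :
    ∫ ω, |centredTerm x y ρ c b i j ω| ^ k ∂P ≤ 2 ^ k * (4 * B (2 * k) + 1) := by
  refine (integral_mono (h.integrable_centredTerm_pow c b i j k) (h.integrable_bound c i j k)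
    fun ω => h.abs_centredTerm_pow_le c b i j k ω).trans ?_
  rw [integral_const_mul, integral_add, integral_add, integral_add (h.intX _ _ _) (h.intY _ _ _),
    integral_add (h.intX _ _ _) (h.intY _ _ _)]
  rotate_left
  · exact (h.intX _ _ _).add (h.intY _ _ _)
  · exact (h.intX _ _ _).add (h.intY _ _ _)
  · exact ((h.intX _ _ _).add (h.intY _ _ _)).add ((h.intX _ _ _).add (h.intY _ _ _))
  · exact integrable_const 1
  have h1 := h.momX c i (2 * k)
  have h2 := h.momY c i (2 * k)
  have h3 := h.momX c j (2 * k)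
  have h4 := h.momY c j (2 * k)
  simp only [integral_const, probReal_univ, smul_eq_mul, mul_one]
  gcongr
  linarith

-- A substitute for Hölder's inequality: the product is at most a power of its largest factor.
omit h in
theorem _root_.CrossCov.prod_le_sum_pow {R : Type*} [Fintype R] [Nonempty R] (a : R → ℝ)
    (ha : ∀ r, 0 ≤ a r) : ∏ r, a r ≤ ∑ r, a r ^ Fintype.card R := by
  obtain ⟨s, -, hs⟩ := Finset.exists_max_image Finset.univ a Finset.univ_nonempty
  calc ∏ r, a r ≤ ∏ _r : R, a s := Finset.prod_le_prod (fun r _ => ha r) fun r hr => hs r hr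
    _ = a s ^ Fintype.card R := by simp
    _ ≤ _ := Finset.single_le_sum (f := fun r => a r ^ Fintype.card R)
      (fun r _ => pow_nonneg (ha r) _) (Finset.mem_univ s)

variable {R : Type*} [Fintype R] [DecidableEq R] (γ : Equiv.Perm R) (β : R → Bool)

theorem measurable_walkTerm (i : R → I) (c : R → C) : Measurable (walkTerm x y ρ γ β i c) :=
  Finset.measurable_fun_prod _ fun _ _ => h.measurable_centred _ _ _ _

theorem abs_walkTerm_le [Nonempty R] (i : R → I) (c : R → C) (ω : Ω) :
    |walkTerm x y ρ γ β i c ω| ≤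
      ∑ r, |centredTerm x y ρ (c r) (β r) (i r) (i (γ r)) ω| ^ Fintype.card R := by
  rw [walkTerm, Finset.abs_prod]
  exact prod_le_sum_pow _ fun r => abs_nonneg _

theorem integrable_walkTerm (i : R → I) (c : R → C) :
    Integrable (walkTerm x y ρ γ β i c) P := by
  rcases isEmpty_or_nonempty R with hR | hR
  · have : walkTerm x y ρ γ β i c = fun _ => 1 := by
      funext ω; simp [walkTerm]
    rw [this]; exact integrable_const 1
  · refine (integrable_finsetSum Finset.univ fun r _ =>
      h.integrable_centredTerm_pow (c r) (β r) (i r) (i (γ r)) (Fintype.card R)).mono'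
      (h.measurable_walkTerm γ β i c).aestronglyMeasurable (ae_of_all _ fun ω => ?_)
    exact h.abs_walkTerm_le γ β i c ω

theorem abs_integral_walkTerm_le [Nonempty R] (i : R → I) (c : R → C) :
    |∫ ω, walkTerm x y ρ γ β i c ω ∂P| ≤
      Fintype.card R * (2 ^ Fintype.card R * (4 * B (2 * Fintype.card R) + 1)) := by
  refine abs_integral_le_integral_abs.trans ?_
  refine (integral_mono_of_nonneg (ae_of_all _ fun ω => abs_nonneg _)
    (integrable_finsetSum Finset.univ fun r _ =>
      h.integrable_centredTerm_pow (c r) (β r) (i r) (i (γ r)) (Fintype.card R))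
    (ae_of_all _ fun ω => h.abs_walkTerm_le γ β i c ω)).trans ?_
  rw [integral_finsetSum _ fun r _ => h.integrable_centredTerm_pow _ _ _ _ _]
  refine (Finset.sum_le_sum fun r _ =>
    h.integral_centredTerm_pow_le (c r) (β r) (i r) (i (γ r)) (Fintype.card R)).trans ?_
  simp

theorem integral_centredTerm (c : C) (b : Bool) (i j : I) :
    ∫ ω, centredTerm x y ρ c b i j ω ∂P = 0 := by
  by_cases hij : i = j
  · subst hij
    have h0 : Integrable (fun ω => x c i ω * y c i ω) P := by
      have h1 : Integrable (fun ω => (x c i ω) ^ 2) P := by simpa using h.intX c i 2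
      have h2 : Integrable (fun ω => (y c i ω) ^ 2) P := by simpa using h.intY c i 2
      refine (h1.add h2).mono' ((h.measX c i).mul (h.measY c i)).aestronglyMeasurable
        (ae_of_all _ fun ω => ?_)
      simp only [Real.norm_eq_abs, abs_mul, Pi.add_apply]
      nlinarith [sq_nonneg (|x c i ω| - |y c i ω|), sq_abs (x c i ω), sq_abs (y c i ω)]
    simp only [centredTerm, if_true, ite_self]
    rw [integral_sub h0 (integrable_const _), h.corr]
    simp
  · have hd : ∀ a b : I, a ≠ b → ∫ ω, x c a ω * y c b ω ∂P = 0 := by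
      intro a b hab
      rw [h.integral_mul_of_disjoint (S := {(c, a)}) (T := {(c, b)}) (by simp [hab])
        (measurable_entryX (Set.mem_singleton _)) (measurable_entryY (Set.mem_singleton _)),
        h.meanX, zero_mul]
    simp only [centredTerm, if_neg hij, sub_zero]
    cases b
    · simpa using hd i j hij
    · simpa using hd j i (Ne.symm hij)

/-- A centred factor `w` depending only on entries in `S`, which nothing else in the product uses,
splits off by independence. -/
theorem integral_walkTerm_eq_zero_of_mul (i : R → I) (c : R → C) (r : R) {S : Set (C × I)}
    {w u : Ω → ℝ} (hw : Measurable[entrySigma x y S] w) (hu : Measurable[entrySigma x y Sᶜ] u)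
    (hr : ∀ ω, centredTerm x y ρ (c r) (β r) (i r) (i (γ r)) ω = w ω * u ω)
    (hs : ∀ s, s ≠ r → (c s, i s) ∈ Sᶜ ∧ (c s, i (γ s)) ∈ Sᶜ) (h0 : ∫ ω, w ω ∂P = 0) :
    ∫ ω, walkTerm x y ρ γ β i c ω ∂P = 0 := by
  have h1 : ∀ ω, walkTerm x y ρ γ β i c ω = w ω * (u ω * ∏ s ∈ Finset.univ.erase r,
      centredTerm x y ρ (c s) (β s) (i s) (i (γ s)) ω) := by
    intro ω
    rw [walkTerm, ← Finset.mul_prod_erase _ _ (Finset.mem_univ r), hr, mul_assoc]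
  simp only [h1]
  rw [h.integral_mul_of_disjoint (g := fun ω => u ω * _) (disjoint_compl_right (a := S)) hw
    (hu.mul ?_), h0, zero_mul]
  refine Finset.measurable_fun_prod _ fun s hs' => ?_
  obtain ⟨h2, h3⟩ := hs s (Finset.ne_of_mem_erase hs')
  exact measurable_centredTerm _ h2 h3

/-- If a colour has a vertex of degree one, the corresponding entry occurs once, linearly, in an
off-diagonal factor, and it has mean zero. If a colour occurs only once, the whole centred term of
that step is independent of the rest. -/
theorem integral_walkTerm_eq_zero (i : R → I) (c : R → C) (hadm : ¬ Admissible γ i c) :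
    ∫ ω, walkTerm x y ρ γ β i c ω ∂P = 0 := by
  by_cases h1 : ∀ r, ∃ s, s ≠ r ∧ c s = c r
  · have h2 : ∃ r a, colourDegree γ i c (c r) a = 1 := by
      by_contra hcon
      push Not at hcon
      exact hadm ⟨h1, hcon⟩
    obtain ⟨r', a, hdeg⟩ := h2
    set z := c r' with hz
    rw [colourDegree] at hdeg
    have hcases : ((univ.filter fun r => c r = z ∧ i r = a).card = 1 ∧
        (univ.filter fun r => c r = z ∧ i (γ r) = a).card = 0) ∨
        ((univ.filter fun r => c r = z ∧ i r = a).card = 0 ∧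
        (univ.filter fun r => c r = z ∧ i (γ r) = a).card = 1) := by omega
    -- The only incidence is either the start or the end of a step of this colour, and
    -- correspondingly the entry is an `x` or a `y` according to the orientation.
    rcases hcases with ⟨hA, hB⟩ | ⟨hA, hB⟩
    · obtain ⟨r, hr⟩ := card_eq_one.1 hA
      rw [card_eq_zero] at hB
      have hrm : c r = z ∧ i r = a := by
        have : r ∈ (univ.filter fun r => c r = z ∧ i r = a) := by rw [hr]; exact mem_singleton_self r
        simpa using this
      have hno : ∀ s, c s = z → i (γ s) ≠ a := fun s hs hs' =>
        filter_eq_empty_iff.1 hB (mem_univ s) ⟨hs, hs'⟩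
      have hun : ∀ s, s ≠ r → c s = z → i s ≠ a := fun s hs hs' hs'' => by
        have : s ∈ (univ.filter fun r => c r = z ∧ i r = a) := by simp [hs', hs'']
        rw [hr, mem_singleton] at this
        exact hs this
      have hne : i r ≠ i (γ r) := by
        rw [hrm.2]; exact (hno r hrm.1).symm
      have hSc : (z, i (γ r)) ∈ ({(z, a)} : Set (C × I))ᶜ := by
        simpa using hno r hrm.1
      refine h.integral_walkTerm_eq_zero_of_mul γ β i c r (S := {(z, a)})
        (w := if β r then y z a else x z a) (u := if β r then x z (i (γ r)) else y z (i (γ r)))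
        ?_ ?_ ?_ ?_ ?_
      · split_ifs
        · exact measurable_entryY (Set.mem_singleton _)
        · exact measurable_entryX (Set.mem_singleton _)
      · split_ifs
        · exact measurable_entryX hSc
        · exact measurable_entryY hSc
      · intro ω
        rw [centredTerm, if_neg hne, sub_zero, hrm.1, hrm.2]
        split_ifs
        · rw [mul_comm]
        · rfl
      · intro s hs
        constructor
        · simp only [Set.mem_compl_iff, Set.mem_singleton_iff, Prod.mk.injEq, not_and]
          exact hun s hs
        · simp only [Set.mem_compl_iff, Set.mem_singleton_iff, Prod.mk.injEq, not_and]
          exact hno s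
      · split_ifs
        · exact h.meanY _ _
        · exact h.meanX _ _
    · obtain ⟨r, hr⟩ := card_eq_one.1 hB
      rw [card_eq_zero] at hA
      have hrm : c r = z ∧ i (γ r) = a := by
        have : r ∈ (univ.filter fun r => c r = z ∧ i (γ r) = a) := by
          rw [hr]; exact mem_singleton_self r
        simpa using this
      have hno : ∀ s, c s = z → i s ≠ a := fun s hs hs' =>
        filter_eq_empty_iff.1 hA (mem_univ s) ⟨hs, hs'⟩
      have hun : ∀ s, s ≠ r → c s = z → i (γ s) ≠ a := fun s hs hs' hs'' => by
        have : s ∈ (univ.filter fun r => c r = z ∧ i (γ r) = a) := by simp [hs', hs'']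
        rw [hr, mem_singleton] at this
        exact hs this
      have hne : i r ≠ i (γ r) := by
        rw [hrm.2]; exact hno r hrm.1
      have hSc : (z, i r) ∈ ({(z, a)} : Set (C × I))ᶜ := by
        simpa using hno r hrm.1
      refine h.integral_walkTerm_eq_zero_of_mul γ β i c r (S := {(z, a)})
        (w := if β r then x z a else y z a) (u := if β r then y z (i r) else x z (i r))
        ?_ ?_ ?_ ?_ ?_
      · split_ifs
        · exact measurable_entryX (Set.mem_singleton _)
        · exact measurable_entryY (Set.mem_singleton _)
      · split_ifs
        · exact measurable_entryY hSc
        · exact measurable_entryX hSc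
      · intro ω
        rw [centredTerm, if_neg hne, sub_zero, hrm.1, hrm.2]
        split_ifs
        · rfl
        · rw [mul_comm]
      · intro s hs
        constructor
        · simp only [Set.mem_compl_iff, Set.mem_singleton_iff, Prod.mk.injEq, not_and]
          exact hno s
        · simp only [Set.mem_compl_iff, Set.mem_singleton_iff, Prod.mk.injEq, not_and]
          exact hun s hs
      · split_ifs
        · exact h.meanX _ _
        · exact h.meanY _ _
  -- A colour occurring once: the factor itself is centred, so `u` is the constant one.
  · push Not at h1
    obtain ⟨r, hr⟩ := h1
    refine h.integral_walkTerm_eq_zero_of_mul γ β i c r (S := {q | q.1 = c r})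
      (w := centredTerm x y ρ (c r) (β r) (i r) (i (γ r))) (u := fun _ => 1)
      (measurable_centredTerm _ rfl rfl) measurable_const (fun ω => (mul_one _).symm)
      (fun s hs => ⟨hr s hs, hr s hs⟩) (h.integral_centredTerm _ _ _ _)

/-- Distinct columns are independent, so the expectation factors over the colours. -/
theorem integral_walkTerm_eq_prod (i : R → I) (c : R → C) :
    ∫ ω, walkTerm x y ρ γ β i c ω ∂P = ∏ z ∈ univ.image c, ∫ ω, ∏ r ∈ univ.filter (c · = z),
      centredTerm x y ρ (c r) (β r) (i r) (i (γ r)) ω ∂P := by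
  have h1 : ∀ s : Finset C, ∫ ω, ∏ z ∈ s, ∏ r ∈ univ.filter (c · = z),
      centredTerm x y ρ (c r) (β r) (i r) (i (γ r)) ω ∂P =
      ∏ z ∈ s, ∫ ω, ∏ r ∈ univ.filter (c · = z),
        centredTerm x y ρ (c r) (β r) (i r) (i (γ r)) ω ∂P := by
    intro s
    induction s using Finset.induction_on with
    | empty => simp
    | insert z s hz ih =>
      simp only [prod_insert hz]
      rw [h.integral_mul_of_disjoint (S := {q | q.1 = z}) (T := {q | q.1 ∈ s}), ih]
      · rw [Set.disjoint_left]
        rintro ⟨a, b⟩ h1 h2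
        simp only [Set.mem_ofPred_eq] at h1 h2
        exact hz (h1 ▸ h2)
      · refine Finset.measurable_fun_prod _ fun r hr => ?_
        have : c r = z := by simpa using hr
        exact measurable_centredTerm _ this this
      · refine Finset.measurable_fun_prod _ fun z' hz' =>
          Finset.measurable_fun_prod _ fun r hr => ?_
        have : c r = z' := by simpa using hr
        have h3 : c r ∈ s := this ▸ hz'
        exact measurable_centredTerm _ h3 h3
  rw [← h1]
  congr 1
  funext ω
  rw [walkTerm, Finset.prod_fiberwise_of_maps_to]
  exact fun r _ => mem_image_of_mem c (mem_univ r)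

/-- This is the source of the elliptic parameter. With equal orientations the product regroups as
`(x_a y_a)(x_b y_b)` with mean `ρ²`; with different ones it is a product of two squares with mean
one. -/
theorem integral_opposite (c : C) {a b : I} (hab : a ≠ b) (u v : Bool) :
    ∫ ω, centredTerm x y ρ c u a b ω * centredTerm x y ρ c v b a ω ∂P =
      if u = v then ρ c ^ 2 else 1 := by
  have hd : Disjoint ({(c, a)} : Set (C × I)) {(c, b)} := by simp [hab]
  have hd' : Disjoint ({(c, b)} : Set (C × I)) {(c, a)} := hd.symm
  have xa := measurable_entryX (x := x) (y := y) (Set.mem_singleton (c, a))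
  have ya := measurable_entryY (x := x) (y := y) (Set.mem_singleton (c, a))
  have xb := measurable_entryX (x := x) (y := y) (Set.mem_singleton (c, b))
  have yb := measurable_entryY (x := x) (y := y) (Set.mem_singleton (c, b))
  have e1 : ∫ ω, (x c a ω * y c a ω) * (x c b ω * y c b ω) ∂P = ρ c ^ 2 := by
    rw [h.integral_mul_of_disjoint (f := fun ω => x c a ω * y c a ω)
      (g := fun ω => x c b ω * y c b ω) hd (xa.mul ya) (xb.mul yb), h.corr, h.corr, sq]
  have e2 : ∫ ω, (x c a ω) ^ 2 * (y c b ω) ^ 2 ∂P = 1 := by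
    rw [h.integral_mul_of_disjoint (f := fun ω => x c a ω ^ 2) (g := fun ω => y c b ω ^ 2) hd
      (xa.pow_const 2) (yb.pow_const 2), h.varX, h.varY, one_mul]
  have e3 : ∫ ω, (x c b ω) ^ 2 * (y c a ω) ^ 2 ∂P = 1 := by
    rw [h.integral_mul_of_disjoint (f := fun ω => x c b ω ^ 2) (g := fun ω => y c a ω ^ 2) hd'
      (xb.pow_const 2) (ya.pow_const 2), h.varX, h.varY, one_mul]
  simp only [centredTerm, if_neg hab, if_neg hab.symm, sub_zero]
  cases u <;> cases v <;> simp
  · rw [← e1]; congr 1; funext ω; ring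
  · rw [← e2]; congr 1; funext ω; ring
  · rw [← e3]; congr 1; funext ω; ring
  · rw [← e1]; congr 1; funext ω; ring

variable {R' : Type*} [Fintype R'] [DecidableEq R'] (γ' : Equiv.Perm R') (β' : R' → Bool)

omit h in
theorem _root_.CrossCov.walkTerm_sum (i : R ⊕ R' → I) (c : R ⊕ R' → C) (ω : Ω) :
    walkTerm x y ρ (Equiv.sumCongr γ γ') (Sum.elim β β') i c ω =
      walkTerm x y ρ γ β (i ∘ Sum.inl) (c ∘ Sum.inl) ω *
        walkTerm x y ρ γ' β' (i ∘ Sum.inr) (c ∘ Sum.inr) ω := by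
  simp [walkTerm, Fintype.prod_sum_type]

omit h in
theorem _root_.CrossCov.colourDegree_sum (i : R ⊕ R' → I) (c : R ⊕ R' → C) (z : C) (a : I) :
    colourDegree (Equiv.sumCongr γ γ') i c z a =
      colourDegree γ (i ∘ Sum.inl) (c ∘ Sum.inl) z a +
        colourDegree γ' (i ∘ Sum.inr) (c ∘ Sum.inr) z a := by
  simp only [colourDegree, Finset.card_filter, Fintype.sum_sum_type]
  simp only [Function.comp_apply, Equiv.sumCongr_apply, Sum.map_inl, Sum.map_inr]
  ring

omit h in
theorem _root_.CrossCov.exists_colour_of_degree {i : R → I} {c : R → C} {z : C} {a : I}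
    (hd : colourDegree γ i c z a ≠ 0) : ∃ r, c r = z := by
  by_contra hcon
  push Not at hcon
  apply hd
  rw [colourDegree, Nat.add_eq_zero_iff, card_eq_zero, card_eq_zero, filter_eq_empty_iff,
    filter_eq_empty_iff]
  exact ⟨fun r _ hr => hcon r hr.1, fun r _ hr => hcon r hr.1⟩

-- Degrees add over the two walks, so a degree one in the union is a degree one in one of them.
omit h in
theorem _root_.CrossCov.not_admissible_sum {i : R ⊕ R' → I} {c : R ⊕ R' → C}
    (hadm : ¬ Admissible (Equiv.sumCongr γ γ') i c) :
    ¬ Admissible γ (i ∘ Sum.inl) (c ∘ Sum.inl) ∨ ¬ Admissible γ' (i ∘ Sum.inr) (c ∘ Sum.inr) := by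
  by_contra hcon
  push Not at hcon
  obtain ⟨h1, h2⟩ := hcon
  apply hadm
  have hdeg : ∀ z a, colourDegree (Equiv.sumCongr γ γ') i c z a ≠ 1 := by
    intro z a hd
    rw [colourDegree_sum] at hd
    have : (colourDegree γ (i ∘ Sum.inl) (c ∘ Sum.inl) z a = 1) ∨
        (colourDegree γ' (i ∘ Sum.inr) (c ∘ Sum.inr) z a = 1) := by omega
    rcases this with h3 | h3
    · obtain ⟨r, rfl⟩ := exists_colour_of_degree γ (by rw [h3]; exact one_ne_zero)
      exact h1.degree_ne_one r a h3
    · obtain ⟨r, rfl⟩ := exists_colour_of_degree γ' (by rw [h3]; exact one_ne_zero)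
      exact h2.degree_ne_one r a h3
  refine ⟨?_, fun r a => hdeg _ a⟩
  rintro (r | r)
  · obtain ⟨s, hs, hs'⟩ := h1.exists_ne r
    exact ⟨Sum.inl s, fun h => hs (Sum.inl_injective h), hs'⟩
  · obtain ⟨s, hs, hs'⟩ := h2.exists_ne r
    exact ⟨Sum.inr s, fun h => hs (Sum.inr_injective h), hs'⟩

/-- The covariance of two products vanishes unless the joint walk is admissible and the two walks
share a variable. -/
theorem cov_walkTerm_eq_zero (i : R ⊕ R' → I) (c : R ⊕ R' → C)
    (hadm : ¬ (Admissible (Equiv.sumCongr γ γ') i c ∧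
      ∃ r r', c (Sum.inl r) = c (Sum.inr r') ∧
        ∃ a, (a = i (Sum.inl r) ∨ a = i (Sum.inl (γ r))) ∧
          (a = i (Sum.inr r') ∨ a = i (Sum.inr (γ' r'))))) :
    ∫ ω, walkTerm x y ρ (Equiv.sumCongr γ γ') (Sum.elim β β') i c ω ∂P =
      (∫ ω, walkTerm x y ρ γ β (i ∘ Sum.inl) (c ∘ Sum.inl) ω ∂P) *
        ∫ ω, walkTerm x y ρ γ' β' (i ∘ Sum.inr) (c ∘ Sum.inr) ω ∂P := by
  by_cases h1 : Admissible (Equiv.sumCongr γ γ') i c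
  · have h2 : ∀ r r', c (Sum.inl r) = c (Sum.inr r') →
        ∀ a, (a = i (Sum.inl r) ∨ a = i (Sum.inl (γ r))) →
          (a = i (Sum.inr r') ∨ a = i (Sum.inr (γ' r'))) → False := by
      intro r r' hc a ha ha'
      exact hadm ⟨h1, r, r', hc, a, ha, ha'⟩
    simp only [walkTerm_sum]
    refine h.integral_mul_of_disjoint
      (S := {q | ∃ r, q.1 = c (Sum.inl r) ∧ (q.2 = i (Sum.inl r) ∨ q.2 = i (Sum.inl (γ r)))})
      (T := {q | ∃ r, q.1 = c (Sum.inr r) ∧ (q.2 = i (Sum.inr r) ∨ q.2 = i (Sum.inr (γ' r)))})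
      ?_ ?_ ?_
    · rw [Set.disjoint_left]
      rintro ⟨z, a⟩ ⟨r, hr, hr'⟩ ⟨s, hs, hs'⟩
      exact h2 r s (hr.symm.trans hs) a hr' hs'
    · exact Finset.measurable_fun_prod _ fun r _ =>
        measurable_centredTerm _ ⟨r, rfl, Or.inl rfl⟩ ⟨r, rfl, Or.inr rfl⟩
    · exact Finset.measurable_fun_prod _ fun r _ =>
        measurable_centredTerm _ ⟨r, rfl, Or.inl rfl⟩ ⟨r, rfl, Or.inr rfl⟩
  -- Without joint admissibility both sides vanish, since one of the two walks is not admissible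
  -- either.
  · rw [h.integral_walkTerm_eq_zero _ _ _ _ h1]
    rcases not_admissible_sum γ γ' h1 with h2 | h2
    · rw [h.integral_walkTerm_eq_zero _ _ _ _ h2, zero_mul]
    · rw [h.integral_walkTerm_eq_zero γ' _ _ _ h2, mul_zero]

end IsEntryModel

end Model

/-! ### Weighted counting of coloured walks -/

section Counting

open Finset

variable {R I C : Type*} [Fintype R] [DecidableEq R] [Fintype I] [DecidableEq I]
  [DecidableEq C]

/-- The partition of the steps into colour classes. -/
def kerPart (c : R → C) : Finpartition (univ : Finset R) :=
  Finpartition.ofExistsUnique (univ.image fun r => univ.filter fun s => c s = c r)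
    (fun _ _ => subset_univ _)
    (by
      intro r _
      refine ⟨univ.filter fun s => c s = c r, ⟨mem_image_of_mem _ (mem_univ r), by simp⟩, ?_⟩
      rintro V ⟨hV, hrV⟩
      obtain ⟨s, -, rfl⟩ := mem_image.1 hV
      have : c r = c s := by simpa using hrV
      rw [this])
    (by
      intro h
      obtain ⟨s, -, hs⟩ := mem_image.1 h
      have : s ∈ (univ.filter fun r => c r = c s) := by simp
      rw [hs] at this
      exact notMem_empty _ this)

theorem mem_kerPart {c : R → C} {V : Finset R} :
    V ∈ (kerPart c).parts ↔ ∃ r, V = univ.filter fun s => c s = c r := by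
  simp [kerPart, eq_comm]

theorem card_kerPart (c : R → C) : (kerPart c).parts.card = (univ.image c).card := by
  symm
  refine Finset.card_bij (fun z _ => univ.filter fun s => c s = z) ?_ ?_ ?_
  · intro z hz
    obtain ⟨r, -, rfl⟩ := mem_image.1 hz
    exact mem_kerPart.2 ⟨r, rfl⟩
  · intro z hz z' hz' h
    obtain ⟨r, -, rfl⟩ := mem_image.1 hz
    have : r ∈ (univ.filter fun s => c s = c r) := by simp
    rw [h] at this
    simpa using this
  · intro V hV
    obtain ⟨r, rfl⟩ := mem_kerPart.1 hV
    exact ⟨c r, mem_image_of_mem _ (mem_univ r), rfl⟩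

/-- A colouring is constant on the blocks of a partition. -/
def ConstOn (π : Finpartition (univ : Finset R)) (c : R → C) : Prop :=
  ∀ V ∈ π.parts, ∀ r ∈ V, ∀ s ∈ V, c r = c s

theorem constOn_kerPart (c : R → C) : ConstOn (kerPart c) c := by
  intro V hV r hr s hs
  obtain ⟨u, rfl⟩ := mem_kerPart.1 hV
  simp only [mem_filter, mem_univ, true_and] at hr hs
  rw [hr, hs]

theorem prod_parts {M : Type*} [CommMonoid M] (π : Finpartition (univ : Finset R)) (f : R → M) :
    ∏ V ∈ π.parts, ∏ r ∈ V, f r = ∏ r, f r := by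
  conv_rhs => rw [← π.biUnion_parts]
  rw [Finset.prod_biUnion]
  · rfl
  · exact π.disjoint

variable [Fintype C]

open scoped Classical in
/-- The total weight of the colourings which are constant on the blocks of a partition. -/
theorem sum_constOn (π : Finpartition (univ : Finset R)) (a : R → C → ℝ) :
    ∑ c ∈ univ.filter (ConstOn π), ∏ r, a r (c r) =
      ∏ V ∈ π.parts, ∑ z, ∏ r ∈ V, a r z := by
  have key : ∀ (h : ∀ V ∈ π.parts, C) (V W : Finset R), V = W → ∀ hV hW, h V hV = h W hW := by
    rintro h V _ rfl _ _; rfl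
  rw [Finset.prod_sum]
  symm
  refine Finset.sum_bij (fun h _ r => h (π.part r) (π.part_mem.2 (mem_univ r))) ?_ ?_ ?_ ?_
  · intro h _
    rw [mem_filter]
    refine ⟨mem_univ _, fun V hV r hr s hs => ?_⟩
    exact key h _ _ ((π.part_eq_of_mem hV hr).trans (π.part_eq_of_mem hV hs).symm) _ _
  · intro h _ h' _ heq
    funext V hV
    obtain ⟨r, hr⟩ := π.nonempty_of_mem_parts hV
    have h1 := π.part_eq_of_mem hV hr
    subst h1
    exact congrFun heq r
  · intro c hc
    have hc' := (mem_filter.1 hc).2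
    choose f hf using fun V (hV : V ∈ π.parts) => π.nonempty_of_mem_parts hV
    refine ⟨fun V hV => c (f V hV), by simp, ?_⟩
    funext r
    exact hc' _ (π.part_mem.2 (mem_univ r)) _ (hf _ _) _ (π.mem_part_self.2 (mem_univ r))
  · intro h _
    rw [← prod_parts π]
    refine Eq.trans ?_ (Finset.prod_attach π.parts _)
    refine Finset.prod_congr rfl fun V _ => Finset.prod_congr rfl fun r hr => ?_
    exact congrArg (a r) (key h _ _ (π.part_eq_of_mem V.2 hr).symm _ _)

/-- Weights for the colours such that the joint weight of a block decays with its size. -/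
structure IsWeight (a : R → C → ℝ) (δ : ℝ) : Prop where
  nonneg : ∀ r c, 0 ≤ a r c
  block : ∀ V : Finset R, 2 ≤ V.card → ∑ z, ∏ r ∈ V, a r z ≤ δ ^ (V.card - 2)

theorem two_mul_card_le (π : Finpartition (univ : Finset R)) (hπ : ∀ V ∈ π.parts, 2 ≤ V.card) :
    2 * π.parts.card ≤ Fintype.card R := by
  have h1 := π.sum_card_parts
  have h2 := Finset.sum_le_sum hπ
  rw [sum_const, smul_eq_mul, h1, card_univ] at h2
  omega

-- The weight factors over the blocks, and the exponents `V.card - 2` add up.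
open scoped Classical in
theorem IsWeight.sum_constOn_le {a : R → C → ℝ} {δ : ℝ} (ha : IsWeight a δ)
    (π : Finpartition (univ : Finset R)) (hπ : ∀ V ∈ π.parts, 2 ≤ V.card) :
    ∑ c ∈ univ.filter (ConstOn π), ∏ r, a r (c r) ≤
      δ ^ (Fintype.card R - 2 * π.parts.card) := by
  rw [sum_constOn]
  calc ∏ V ∈ π.parts, ∑ z, ∏ r ∈ V, a r z ≤ ∏ V ∈ π.parts, δ ^ (V.card - 2) :=
        Finset.prod_le_prod (fun V _ => Finset.sum_nonneg fun z _ =>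
          Finset.prod_nonneg fun r _ => ha.nonneg r z) fun V hV => ha.block V (hπ V hV)
    _ = _ := by
      rw [Finset.prod_pow_eq_pow_sum]
      congr 1
      have h1 := π.sum_card_parts
      rw [Finset.sum_tsub_distrib _ hπ, h1, card_univ, sum_const, smul_eq_mul, mul_comm]

/-- A map with at most `v` values factors through `Fin v`. -/
theorem card_filter_image_le [Nonempty I] (v : ℕ) :
    (univ.filter fun i : R → I => (univ.image i).card ≤ v).card ≤
      v ^ Fintype.card R * Fintype.card I ^ v := by
  have h1 : (univ : Finset ((R → Fin v) × (Fin v → I))).card =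
      v ^ Fintype.card R * Fintype.card I ^ v := by
    rw [card_univ, Fintype.card_prod, Fintype.card_fun, Fintype.card_fun, Fintype.card_fin]
  rw [← h1]
  refine Finset.card_le_card_of_surjOn (fun x r => x.2 (x.1 r)) ?_
  intro i hi
  have hi' : (univ.image i).card ≤ v := by simpa using hi
  have e : (univ.image i : Finset I) ↪ Fin v := by
    refine (Function.Embedding.nonempty_of_card_le ?_).some
    rw [Fintype.card_coe, Fintype.card_fin]
    exact hi'
  let h : R → Fin v := fun r => e ⟨i r, mem_image_of_mem _ (mem_univ r)⟩
  refine ⟨(h, fun k => Function.extend e Subtype.val (fun _ => Classical.arbitrary I) k),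
    by simp, ?_⟩
  funext r
  simp only [h]
  rw [e.injective.extend_apply]

/-- Upper bound for the weight of a set of coloured walks with few vertices and colours. -/
theorem IsWeight.sum_le [Nonempty I] {a : R → C → ℝ} {η s : ℝ} (hs : 0 < s)
    (ha : IsWeight a (η / s)) (hη : 0 ≤ η) (hη1 : η ≤ 1) (hI : (Fintype.card I : ℝ) = s ^ 2)
    (S : Finset ((R → I) × (R → C))) (N e : ℕ)
    (hN : Fintype.card R ≤ 2 * N)
    (hS : ∀ x ∈ S, (∀ V ∈ (kerPart x.2).parts, 2 ≤ V.card) ∧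
      (univ.image x.1).card + (univ.image x.2).card ≤ N ∧
      2 * (univ.image x.2).card + e ≤ Fintype.card R) :
    ∑ x ∈ S, ∏ r, a r (x.2 r) ≤ Fintype.card (Finpartition (univ : Finset R)) *
      (N ^ Fintype.card R * η ^ e * s ^ (2 * N - Fintype.card R)) := by
  classical
  have hw : ∀ c : R → C, 0 ≤ ∏ r, a r (c r) := fun c =>
    Finset.prod_nonneg fun r _ => ha.nonneg r _
  -- Summing over the kernel partition costs only a constant number of cases.
  rw [← Finset.sum_fiberwise S (fun x => kerPart x.2)]
  have hbound : ∀ π : Finpartition (univ : Finset R),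
      ∑ x ∈ S.filter (fun x => kerPart x.2 = π), ∏ r, a r (x.2 r) ≤
        N ^ Fintype.card R * η ^ e * s ^ (2 * N - Fintype.card R) := by
    intro π
    rcases (S.filter fun x => kerPart x.2 = π).eq_empty_or_nonempty with hemp | ⟨x0, hx0⟩
    · rw [hemp, sum_empty]; positivity
    · obtain ⟨hx0S, rfl⟩ := mem_filter.1 hx0
      obtain ⟨h1, h2, h3⟩ := hS x0 hx0S
      set π := kerPart x0.2 with hπ
      have hb : π.parts.card = (univ.image x0.2).card := card_kerPart _
      set b := π.parts.card with hbdef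
      calc ∑ x ∈ S.filter (fun x => kerPart x.2 = π), ∏ r, a r (x.2 r)
          ≤ ∑ x ∈ (univ.filter fun i : R → I => (univ.image i).card ≤ N - b) ×ˢ
              (univ.filter (ConstOn (C := C) π)), ∏ r, a r (x.2 r) := by
            refine Finset.sum_le_sum_of_subset_of_nonneg ?_ fun x _ _ => hw _
            intro x hx
            obtain ⟨hxS, hxπ⟩ := mem_filter.1 hx
            have h4 := (hS x hxS).2.1
            rw [← card_kerPart x.2, hxπ] at h4
            rw [mem_product]
            refine ⟨?_, ?_⟩
            · simp only [mem_filter, mem_univ, true_and]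
              omega
            · simp only [mem_filter, mem_univ, true_and]
              rw [← hxπ]
              exact constOn_kerPart _
        _ = (univ.filter fun i : R → I => (univ.image i).card ≤ N - b).card *
              ∑ c ∈ univ.filter (ConstOn (C := C) π), ∏ r, a r (c r) := by
            simp only [Finset.sum_product, sum_const, nsmul_eq_mul]
        _ ≤ ((N - b : ℕ) ^ Fintype.card R * (s ^ 2) ^ (N - b)) *
              (η / s) ^ (Fintype.card R - 2 * b) := by
            refine mul_le_mul ?_ (ha.sum_constOn_le π h1)
              (Finset.sum_nonneg fun c _ => hw c) (by positivity)
            rw [← hI]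
            exact_mod_cast card_filter_image_le (N - b)
        -- The powers of `s` combine to `2 (N - b) - (card R - 2 b) = 2 N - card R`, which does not
        -- depend on the number `b` of colours; a surplus of repeated colours shows only in the
        -- power of `η`.
        _ = (N - b : ℕ) ^ Fintype.card R * η ^ (Fintype.card R - 2 * b) *
              s ^ (2 * N - Fintype.card R) := by
            have h5 : s ^ (2 * (N - b)) =
                s ^ (2 * N - Fintype.card R) * s ^ (Fintype.card R - 2 * b) := by
              rw [← pow_add]; congr 1; omega
            rw [div_pow, ← pow_mul, h5]
            field_simp
        _ ≤ _ := by
            have h6 : η ^ (Fintype.card R - 2 * b) ≤ η ^ e :=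
              pow_le_pow_of_le_one hη hη1 (by omega)
            have h7 : ((N - b : ℕ) : ℝ) ≤ N := by exact_mod_cast Nat.sub_le N b
            gcongr
  refine (Finset.sum_le_sum fun π _ => hbound π).trans ?_
  rw [sum_const, nsmul_eq_mul, card_univ]

omit [Fintype C] in
theorem Admissible.two_le_card {γ : Equiv.Perm R} {i : R → I} {c : R → C}
    (h : Admissible γ i c) (V : Finset R) (hV : V ∈ (kerPart c).parts) : 2 ≤ V.card := by
  obtain ⟨r, rfl⟩ := mem_kerPart.1 hV
  obtain ⟨s, hs, hcs⟩ := h.exists_ne r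
  exact Finset.one_lt_card.2 ⟨s, by simpa using hcs, r, by simp, hs⟩

/-! ### Pairings -/

/-- All blocks have two elements. -/
def IsPairing (π : Finpartition (univ : Finset R)) : Prop := ∀ V ∈ π.parts, V.card = 2

theorem IsPairing.two_mul_card {π : Finpartition (univ : Finset R)} (h : IsPairing π) :
    2 * π.parts.card = Fintype.card R := by
  have h1 := π.sum_card_parts
  rw [Finset.sum_congr rfl h, sum_const, smul_eq_mul, card_univ] at h1
  omega

theorem isPairing_of_two_mul_card {π : Finpartition (univ : Finset R)}
    (h2 : ∀ V ∈ π.parts, 2 ≤ V.card) (h : 2 * π.parts.card = Fintype.card R) : IsPairing π := by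
  have h1 := π.sum_card_parts
  have h3 : ∑ V ∈ π.parts, 2 = ∑ V ∈ π.parts, V.card := by
    rw [h1, sum_const, smul_eq_mul, card_univ]; omega
  exact fun V hV => ((Finset.sum_eq_sum_iff_of_le h2).1 h3 V hV).symm

/-- The partner of a step in a pairing. -/
theorem IsPairing.exists_partner {π : Finpartition (univ : Finset R)} (h : IsPairing π) :
    ∃ τ : R → R, (∀ r, τ r ≠ r) ∧ (∀ r, τ (τ r) = r) ∧ ∀ r, π.part r = {r, τ r} := by
  have h1 : ∀ r, ∃ s, s ≠ r ∧ π.part r = {r, s} := by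
    intro r
    have hc := h _ (π.part_mem.2 (mem_univ r))
    have hr : r ∈ π.part r := π.mem_part_self.2 (mem_univ r)
    obtain ⟨u, v, huv, hV⟩ := card_eq_two.1 hc
    rw [hV] at hr ⊢
    rcases mem_insert.1 hr with rfl | hr
    · exact ⟨v, huv.symm, rfl⟩
    · rw [mem_singleton] at hr
      subst hr
      exact ⟨u, huv, pair_comm _ _⟩
  choose τ hne hτ using h1
  refine ⟨τ, hne, fun r => ?_, hτ⟩
  have hm : τ r ∈ π.part r := by rw [hτ]; simp
  have h2 := π.part_eq_of_mem (π.part_mem.2 (mem_univ r)) hm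
  rw [hτ, hτ] at h2
  have h3 : τ (τ r) ∈ ({r, τ r} : Finset R) := by rw [← h2]; simp
  rcases mem_insert.1 h3 with h3 | h3
  · exact h3
  · exact absurd (mem_singleton.1 h3) (hne _)

theorem part_eq_part_iff {π : Finpartition (univ : Finset R)} {τ : R → R}
    (hτ : ∀ r, π.part r = {r, τ r}) (r u : R) : π.part u = π.part r ↔ u = r ∨ u = τ r := by
  rw [← π.mem_part_iff_part_eq_part (mem_univ _) (mem_univ _), hτ]
  simp

omit [Fintype C] in
theorem kerPart_part (c : R → C) (r : R) :
    (kerPart c).part r = univ.filter fun s => c s = c r :=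
  (kerPart c).part_eq_of_mem (mem_kerPart.2 ⟨r, rfl⟩) (by simp)

omit [Fintype C] in
theorem kerPart_part_eq_iff (c : R → C) (r s : R) :
    (kerPart c).part s = (kerPart c).part r ↔ c s = c r := by
  rw [← (kerPart c).mem_part_iff_part_eq_part (mem_univ _) (mem_univ _), kerPart_part]
  simp

omit [Fintype C] in
/-- A colouring which is constant on the blocks of a pairing but has a coarser kernel has
fewer colours. -/
theorem card_image_lt_of_constOn {π : Finpartition (univ : Finset R)} (h : IsPairing π)
    {c : R → C} (hc : ConstOn π c) (hne : kerPart c ≠ π) :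
    (∀ V ∈ (kerPart c).parts, 2 ≤ V.card) ∧ 2 * (kerPart c).parts.card + 1 ≤ Fintype.card R := by
  have hsub : ∀ r, π.part r ⊆ (kerPart c).part r := by
    intro r s hs
    rw [kerPart_part, mem_filter]
    exact ⟨mem_univ _, hc _ (π.part_mem.2 (mem_univ r)) _ hs _ (π.mem_part_self.2 (mem_univ r))⟩
  have h2 : ∀ V ∈ (kerPart c).parts, 2 ≤ V.card := by
    intro V hV
    obtain ⟨r, hr⟩ := (kerPart c).nonempty_of_mem_parts hV
    rw [← (kerPart c).part_eq_of_mem hV hr, ← h _ (π.part_mem.2 (mem_univ r))]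
    exact card_le_card (hsub r)
  refine ⟨h2, ?_⟩
  have h3 := two_mul_card_le _ h2
  refine Nat.succ_le_of_lt (lt_of_le_of_ne h3 fun heq => hne ?_)
  have hp := isPairing_of_two_mul_card h2 heq
  have hpart : ∀ r, π.part r = (kerPart c).part r := fun r =>
    eq_of_subset_of_card_le (hsub r) (by
      rw [h _ (π.part_mem.2 (mem_univ r)), hp _ ((kerPart c).part_mem.2 (mem_univ r))])
  ext V
  constructor
  · intro hV
    obtain ⟨r, hr⟩ := (kerPart c).nonempty_of_mem_parts hV
    rw [← (kerPart c).part_eq_of_mem hV hr, ← hpart]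
    exact π.part_mem.2 (mem_univ r)
  · intro hV
    obtain ⟨r, hr⟩ := π.nonempty_of_mem_parts hV
    rw [← π.part_eq_of_mem hV hr, hpart]
    exact (kerPart c).part_mem.2 (mem_univ r)

open scoped Classical in
/-- The weight of the colourings with kernel equal to a given pairing. -/
theorem IsWeight.abs_sum_ker_sub_le {a : R → C → ℝ} {δ : ℝ} (ha : IsWeight a δ) (hδ : 0 ≤ δ)
    (hδ1 : δ ≤ 1) {π : Finpartition (univ : Finset R)} (h : IsPairing π) :
    |∑ c ∈ univ.filter (fun c : R → C => kerPart c = π), ∏ r, a r (c r) -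
      ∏ V ∈ π.parts, ∑ z, ∏ r ∈ V, a r z| ≤
      Fintype.card (Finpartition (univ : Finset R)) * δ := by
  have hw : ∀ c : R → C, 0 ≤ ∏ r, a r (c r) := fun c =>
    Finset.prod_nonneg fun r _ => ha.nonneg r _
  rw [← sum_constOn]
  -- The colourings constant on `π` whose kernel is strictly coarser use fewer colours and gain a
  -- factor `δ`.
  have hsplit : ∑ c ∈ univ.filter (ConstOn (C := C) π), ∏ r, a r (c r) =
      ∑ c ∈ univ.filter (fun c : R → C => kerPart c = π), ∏ r, a r (c r) +
      ∑ c ∈ univ.filter (fun c : R → C => ConstOn π c ∧ kerPart c ≠ π), ∏ r, a r (c r) := by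
    rw [← Finset.sum_filter_add_sum_filter_not (univ.filter (ConstOn (C := C) π))
      (fun c => kerPart c = π), filter_filter, filter_filter]
    congr 2
    ext c
    simp only [mem_filter, mem_univ, true_and, and_iff_right_iff_imp]
    rintro rfl
    exact constOn_kerPart c
  rw [hsplit, sub_add_cancel_left, abs_neg, abs_of_nonneg (Finset.sum_nonneg fun c _ => hw c),
    ← Finset.sum_fiberwise _ (fun c : R → C => kerPart c)]
  have hb : ∀ σ : Finpartition (univ : Finset R),
      ∑ c ∈ (univ.filter (fun c : R → C => ConstOn π c ∧ kerPart c ≠ π)).filter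
        (fun c => kerPart c = σ), ∏ r, a r (c r) ≤ δ := by
    intro σ
    rcases ((univ.filter (fun c : R → C => ConstOn π c ∧ kerPart c ≠ π)).filter
        (fun c => kerPart c = σ)).eq_empty_or_nonempty with hemp | ⟨c0, hc0⟩
    · rw [hemp, sum_empty]; exact hδ
    · obtain ⟨hc1, rfl⟩ := mem_filter.1 hc0
      have hc2 := (mem_filter.1 hc1).2
      obtain ⟨h1, h2⟩ := card_image_lt_of_constOn h hc2.1 hc2.2
      calc _ ≤ ∑ c ∈ univ.filter (ConstOn (C := C) (kerPart c0)), ∏ r, a r (c r) := by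
            refine Finset.sum_le_sum_of_subset_of_nonneg ?_ fun c _ _ => hw c
            intro c hc
            obtain ⟨-, hc⟩ := mem_filter.1 hc
            rw [mem_filter, ← hc]
            exact ⟨mem_univ _, constOn_kerPart c⟩
        _ ≤ δ ^ (Fintype.card R - 2 * (kerPart c0).parts.card) := ha.sum_constOn_le _ h1
        _ ≤ δ ^ 1 := pow_le_pow_of_le_one hδ hδ1 (by omega)
        _ = δ := pow_one δ
  refine (Finset.sum_le_sum fun σ _ => hb σ).trans ?_
  rw [sum_const, nsmul_eq_mul, card_univ]

end Counting

/-! ### Weighted sums of expectations along walks -/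

section Opposite

open Finset

variable {k : ℕ} {I C : Type*} [Fintype I] [DecidableEq I] [DecidableEq C]

/-- Steps of the same colour are opposite. -/
def OppositeColour (i : Fin (k + 1) → I) (c : Fin (k + 1) → C) : Prop :=
  ∀ r s, r ≠ s → c r = c s → i (finRotate (k + 1) r) = i s

theorem colour_eq_iff {c : Fin (k + 1) → C} {τ : Fin (k + 1) → Fin (k + 1)}
    (hτ : ∀ r, (kerPart c).part r = {r, τ r}) (r u : Fin (k + 1)) :
    c u = c r ↔ u = r ∨ u = τ r := by
  rw [← kerPart_part_eq_iff, part_eq_part_iff hτ]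

/-- Opposite steps cancel, so a pair supplies its relation directly and admissibility is not needed
for the vertex bound. -/
theorem OppositeColour.relations {i : Fin (k + 1) → I} {c : Fin (k + 1) → C}
    (h : OppositeColour i c) (hc : IsPairing (kerPart c)) :
    ∀ x ∈ univ.image c, ∃ μ : Fin (k + 1) → ℚ, μ ∈ stepRel (finRotate (k + 1)) i ∧
      (∀ r, c r ≠ x → μ r = 0) ∧ μ ≠ 0 := by
  obtain ⟨τ, hne, hinv, hτ⟩ := hc.exists_partner
  intro x hx
  obtain ⟨r, -, rfl⟩ := mem_image.1 hx
  refine ⟨restrictColour c (c r) 1, ?_, fun s hs => if_neg hs, ?_⟩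
  · rw [mem_stepRel, Finset.sum_eq_add_of_mem r (τ r) (mem_univ _) (mem_univ _) (hne r).symm]
    · have h1 : c (τ r) = c r := (colour_eq_iff hτ r _).2 (Or.inr rfl)
      simp only [restrictColour, h1, if_true, Pi.one_apply, one_smul, stepVec]
      rw [h r (τ r) (hne r).symm h1.symm, h (τ r) r (hne r) h1]
      abel
    · intro u _ hu
      have : c u ≠ c r := fun h => by
        rcases (colour_eq_iff hτ r u).1 h with h | h
        · exact hu.1 h
        · exact hu.2 h
      simp [restrictColour, this]
  · intro h0
    have := congrFun h0 r
    simp [restrictColour] at this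

/-- The consequences of equality, in a form independent of the partner function. -/
theorem extremal_oppositeColour {i : Fin (k + 1) → I} {c : Fin (k + 1) → C}
    (hc : IsPairing (kerPart c)) (hrel : ∀ x ∈ univ.image c, ∃ μ : Fin (k + 1) → ℚ,
      μ ∈ stepRel (finRotate (k + 1)) i ∧ (∀ r, c r ≠ x → μ r = 0) ∧ μ ≠ 0)
    (hE : (univ.image i).card + (univ.image c).card = k + 2) :
    OppositeColour i c ∧ (∀ r, i (finRotate (k + 1) r) ≠ i r) ∧ IsNoncrossing (kerPart c) := by
  obtain ⟨τ, hne, hinv, hτ⟩ := hc.exists_partner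
  have hE' : (univ.image i).card + (univ.image c).card = Fintype.card (Fin (k + 1)) + 1 := by
    rw [hE, Fintype.card_fin]
  have hopp := fun r => extremal_opposite (i 0) (linked_finRotate i) hrel hE' (hne r).symm
    (colour_eq_iff hτ r)
  refine ⟨fun r s hrs hcs => ?_, fun r => (hopp r).1, ?_⟩
  · rcases (colour_eq_iff hτ r s).1 hcs.symm with h | h
    · exact absurd h hrs.symm
    · rw [h]; exact (hopp r).2.1
  · intro V hV W hW r u s w hru hus hsw hr hs hu hw
    by_contra hVW
    have h1 := (kerPart c).part_eq_of_mem hV hr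
    have h2 := (kerPart c).part_eq_of_mem hV hs
    have h3 := (kerPart c).part_eq_of_mem hW hu
    have h4 := (kerPart c).part_eq_of_mem hW hw
    have hcs : c s = c r := (kerPart_part_eq_iff c r s).1 (h2.trans h1.symm)
    have hsτ : s = τ r := ((colour_eq_iff hτ r s).1 hcs).resolve_left (hru.trans hus).ne'
    refine extremal_noncrossing hrel hE' hru hus hsw (fun v => ?_)
      ((kerPart_part_eq_iff c w u).1 (h3.trans h4.symm))
    rw [hsτ]
    exact colour_eq_iff hτ r v

theorem noncrossing_partner {π : Finpartition (univ : Finset (Fin (k + 1)))}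
    (hnc : IsNoncrossing π) {τ : Fin (k + 1) → Fin (k + 1)} (hinv : ∀ r, τ (τ r) = r)
    (hτ : ∀ r, π.part r = {r, τ r}) (r u : Fin (k + 1)) (hru : r < u) (hu : u < τ r) :
    r < τ u ∧ τ u < τ r := by
  have hm : ∀ v, v ∈ π.part v ∧ τ v ∈ π.part v := fun v => by rw [hτ]; simp
  have hpart : ∀ v, π.part v ∈ π.parts := fun v => π.part_mem.2 (mem_univ v)
  have hfalse : π.part r = π.part u → False := by
    intro h
    rcases (part_eq_part_iff hτ r u).1 h.symm with h | h
    · exact hru.ne' h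
    · exact hu.ne h
  constructor
  · by_contra hlt
    rcases (not_lt.1 hlt).eq_or_lt with h | h
    · have : u = τ r := by rw [← h, hinv]
      exact hu.ne this
    · exact hfalse (hnc _ (hpart u) _ (hpart r) (τ u) r u (τ r) h hru hu (hm u).2 (hm u).1
        (hm r).1 (hm r).2).symm
  · by_contra hlt
    rcases (not_lt.1 hlt).eq_or_lt with h | h
    · have : r = u := by rw [← hinv r, h, hinv]
      exact hru.ne this
    · exact hfalse (hnc _ (hpart r) _ (hpart u) r u (τ r) (τ u) hru hu h (hm r).1 (hm r).2
        (hm u).1 (hm u).2)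

/-- Using the blocks themselves as colours makes the results on colourings available for a
partition. -/
theorem kerPart_part_self (π : Finpartition (univ : Finset (Fin (k + 1)))) :
    kerPart (fun r => π.part r) = π := by
  ext V
  rw [mem_kerPart]
  have h1 : ∀ r, (univ.filter fun s => π.part s = π.part r) = π.part r := by
    intro r
    ext s
    rw [mem_filter, π.mem_part_iff_part_eq_part (mem_univ _) (mem_univ _)]
    simp
  constructor
  · rintro ⟨r, rfl⟩
    rw [h1]
    exact π.part_mem.2 (mem_univ r)
  · intro hV
    obtain ⟨r, hr⟩ := π.nonempty_of_mem_parts hV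
    exact ⟨r, by rw [h1, π.part_eq_of_mem hV hr]⟩

open scoped Classical in
/-- The number of extremal opposite walks for a non-crossing pairing. -/
theorem card_extremal_walks [Nonempty I] {π : Finpartition (univ : Finset (Fin (k + 1)))}
    (hp : IsPairing π) (hnc : IsNoncrossing π) :
    |((univ.filter fun i : Fin (k + 1) → I => OppositeColour i (fun r => π.part r) ∧
      (univ.image i).card + π.parts.card = k + 2).card : ℝ) -
        (Fintype.card I : ℝ) ^ (π.parts.card + 1)| ≤
      (π.parts.card : ℝ) ^ (k + 1) * (Fintype.card I : ℝ) ^ π.parts.card := by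
  have hb := hp.two_mul_card
  rw [Fintype.card_fin] at hb
  obtain ⟨τ, hne, hinv, hτ⟩ := hp.exists_partner
  have hopp : ∀ i : Fin (k + 1) → I, OppositeColour i (fun r => π.part r) ↔ OppositeWalk τ i := by
    intro i
    constructor
    · intro h r
      exact h r (τ r) (hne r).symm ((part_eq_part_iff hτ r _).2 (Or.inr rfl)).symm
    · intro h r s hrs hcs
      rcases (part_eq_part_iff hτ r s).1 hcs.symm with h' | h'
      · exact absurd h' hrs.symm
      · rw [h r, h']
  have hle : ∀ i : Fin (k + 1) → I, OppositeColour i (fun r => π.part r) →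
      (univ.image i).card + π.parts.card ≤ k + 2 := by
    intro i hi
    have hrel := hi.relations (by rw [kerPart_part_self]; exact hp)
    have := (card_add_card_le_of_relations _ i _ (i 0) (linked_finRotate i) hrel).1
    rw [← card_kerPart (fun r => π.part r), kerPart_part_self, Fintype.card_fin] at this
    exact this
  have hcard : (univ.filter fun i : Fin (k + 1) → I =>
      OppositeColour i (fun r => π.part r)).card = Fintype.card I ^ (π.parts.card + 1) := by
    rw [← card_oppositeWalk hinv hne (fun r u => noncrossing_partner hnc hinv hτ r u) hb,
      Nat.card_eq_fintype_card, Fintype.card_subtype]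
    congr 1
    ext i
    simp [hopp]
  -- As `2 b = k + 1`, an opposite walk is extremal when it has `b + 1` vertices. The others have at
  -- most `b` and are of lower order.
  have hsplit : (univ.filter fun i : Fin (k + 1) → I =>
      OppositeColour i (fun r => π.part r)).card ≤
      (univ.filter fun i : Fin (k + 1) → I => OppositeColour i (fun r => π.part r) ∧
      (univ.image i).card + π.parts.card = k + 2).card +
      (univ.filter fun i : Fin (k + 1) → I => (univ.image i).card ≤ π.parts.card).card := by
    refine (card_le_card ?_).trans (card_union_le _ _)
    intro i hi
    have hi' := (mem_filter.1 hi).2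
    have := hle i hi'
    rw [mem_union, mem_filter, mem_filter]
    by_cases h : (univ.image i).card + π.parts.card = k + 2
    · exact Or.inl ⟨mem_univ _, hi', h⟩
    · exact Or.inr ⟨mem_univ _, by omega⟩
  have hle2 : (univ.filter fun i : Fin (k + 1) → I => OppositeColour i (fun r => π.part r) ∧
      (univ.image i).card + π.parts.card = k + 2).card ≤
      (univ.filter fun i : Fin (k + 1) → I => OppositeColour i (fun r => π.part r)).card :=
    card_le_card fun i hi => by
      rw [mem_filter] at hi ⊢
      exact ⟨hi.1, hi.2.1⟩
  have h3 := card_filter_image_le (R := Fin (k + 1)) (I := I) π.parts.card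
  rw [Fintype.card_fin] at h3
  rw [hcard] at hsplit hle2
  have h4 : ((Fintype.card I : ℝ) ^ (π.parts.card + 1)) ≤
      ((univ.filter fun i : Fin (k + 1) → I => OppositeColour i (fun r => π.part r) ∧
      (univ.image i).card + π.parts.card = k + 2).card : ℝ) +
      (π.parts.card : ℝ) ^ (k + 1) * (Fintype.card I : ℝ) ^ π.parts.card := by
    exact_mod_cast hsplit.trans (Nat.add_le_add_left h3 _)
  have h5 : ((univ.filter fun i : Fin (k + 1) → I => OppositeColour i (fun r => π.part r) ∧
      (univ.image i).card + π.parts.card = k + 2).card : ℝ) ≤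
      (Fintype.card I : ℝ) ^ (π.parts.card + 1) := by exact_mod_cast hle2
  rw [abs_le]
  constructor
  · linarith
  · have : (0 : ℝ) ≤ (π.parts.card : ℝ) ^ (k + 1) * (Fintype.card I : ℝ) ^ π.parts.card := by
      positivity
    linarith

end Opposite

section Expectation

open Finset

variable {Ω : Type*} [MeasurableSpace Ω] {P : Measure Ω} [IsProbabilityMeasure P]
  {C I : Type*} [Fintype C] [Fintype I] [DecidableEq C] [DecidableEq I]
  {x y : C → I → Ω → ℝ} {ρ : C → ℝ} {B : ℕ → ℝ} {k : ℕ}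

/-- A bound for the expectations of the products of `m` terms. -/
def termBound (B : ℕ → ℝ) (m : ℕ) : ℝ := m * (2 ^ m * (4 * B (2 * m) + 1))

/-- The value of an extremal walk. -/
theorem IsEntryModel.integral_extremal (h : IsEntryModel P x y ρ B) (β : Fin (k + 1) → Bool)
    (a : Fin (k + 1) → C → ℝ) (kv : Finset (Fin (k + 1)) → ℝ)
    (hkv : ∀ r s, r ≠ s → ∀ z, a r z ≠ 0 → a s z ≠ 0 →
      kv {r, s} = if β r = β s then ρ z ^ 2 else 1)
    (i : Fin (k + 1) → I) (c : Fin (k + 1) → C) (hc : IsPairing (kerPart c))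
    (hopp : OppositeColour i c) (hE : (univ.image i).card + (univ.image c).card = k + 2) :
    (∏ r, a r (c r)) * ∫ ω, walkTerm x y ρ (finRotate (k + 1)) β i c ω ∂P =
      (∏ r, a r (c r)) * ∏ V ∈ (kerPart c).parts, kv V := by
  -- The value of `kv` is prescribed only where the weights do not vanish; elsewhere both sides are
  -- zero.
  by_cases hw : ∏ r, a r (c r) = 0
  · rw [hw, zero_mul, zero_mul]
  congr 1
  have ha : ∀ r, a r (c r) ≠ 0 := fun r => (Finset.prod_ne_zero_iff.1 hw) r (mem_univ r)
  obtain ⟨-, hloop, -⟩ := extremal_oppositeColour hc (hopp.relations hc) hE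
  obtain ⟨τ, hne, hinv, hτ⟩ := hc.exists_partner
  rw [h.integral_walkTerm_eq_prod]
  refine Finset.prod_bij (fun z _ => univ.filter fun s => c s = z) ?_ ?_ ?_ ?_
  · intro z hz
    obtain ⟨r, -, rfl⟩ := mem_image.1 hz
    exact mem_kerPart.2 ⟨r, rfl⟩
  · intro z hz z' hz' heq
    obtain ⟨r, -, rfl⟩ := mem_image.1 hz
    have : r ∈ (univ.filter fun s => c s = c r) := by simp
    rw [heq] at this
    simpa using this
  · intro V hV
    obtain ⟨r, rfl⟩ := mem_kerPart.1 hV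
    exact ⟨c r, mem_image_of_mem _ (mem_univ r), rfl⟩
  · intro z hz
    obtain ⟨r, -, rfl⟩ := mem_image.1 hz
    have hset : (univ.filter fun s => c s = c r) = {r, τ r} := by
      rw [← kerPart_part, hτ]
    have hcτ : c (τ r) = c r := (colour_eq_iff hτ r _).2 (Or.inr rfl)
    simp only [hset, Finset.prod_pair (hne r).symm]
    rw [hcτ, hopp (τ r) r (hne r) hcτ, hopp r (τ r) (hne r).symm hcτ.symm,
      h.integral_opposite (c r) (fun heq => hloop r (by
        rw [hopp r (τ r) (hne r).symm hcτ.symm]; exact heq.symm)),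
      hkv r (τ r) (hne r).symm (c r) (ha r) (hcτ ▸ ha (τ r))]

/-- The constant in the quantitative moment asymptotics. -/
def momentConst (m : ℕ) (K : ℝ) : ℝ :=
  Fintype.card (Finpartition (univ : Finset (Fin m))) *
    ((Fintype.card (Finpartition (univ : Finset (Fin m))) + (m : ℝ) ^ m) +
      2 * (K * ((m + 1 : ℕ) : ℝ) ^ m))

open scoped Classical in
/-- The finset of non-crossing pairings. -/
def ncPairings (m : ℕ) : Finset (Finpartition (univ : Finset (Fin m))) :=
  univ.filter fun π => IsPairing π ∧ IsNoncrossing π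

/-- The contribution of the walks which are not extremal is small. -/
theorem IsEntryModel.abs_sum_nonextremal_le [Nonempty I] (h : IsEntryModel P x y ρ B)
    (hB : ∀ j, 0 ≤ B j) (β : Fin (k + 1) → Bool) {a : Fin (k + 1) → C → ℝ} {η s : ℝ} (hs : 0 < s)
    (ha : IsWeight a (η / s)) (hη : 0 ≤ η) (hη1 : η ≤ 1) (hI : (Fintype.card I : ℝ) = s ^ 2)
    (S : Finset ((Fin (k + 1) → I) × (Fin (k + 1) → C)))
    (hS : ∀ z ∈ S, ¬ (IsPairing (kerPart z.2) ∧ OppositeColour z.1 z.2 ∧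
      (univ.image z.1).card + (univ.image z.2).card = k + 2)) :
    |∑ z ∈ S, (∏ r, a r (z.2 r)) *
      ∫ ω, walkTerm x y ρ (finRotate (k + 1)) β z.1 z.2 ω ∂P| ≤
      termBound B (k + 1) * (Fintype.card (Finpartition (univ : Finset (Fin (k + 1)))) *
        ((k + 2 : ℕ) ^ (k + 1) * (η + 1 / s ^ 2) * s ^ (k + 3))) := by
  classical
  have hw : ∀ c : Fin (k + 1) → C, 0 ≤ ∏ r, a r (c r) := fun c =>
    Finset.prod_nonneg fun r _ => ha.nonneg r _
  -- An admissible non-extremal walk either has a colour used more than twice (`S1`, gaining `η`) or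
  -- misses the vertex bound (`S2`, gaining `1 / s ^ 2`).
  set S1 := S.filter fun z => Admissible (finRotate (k + 1)) z.1 z.2 ∧
    2 * (univ.image z.2).card + 1 ≤ k + 1 with hS1
  set S2 := S.filter fun z => Admissible (finRotate (k + 1)) z.1 z.2 ∧
    (univ.image z.1).card + (univ.image z.2).card ≤ k + 1 with hS2
  have hterm : ∀ i c, |∫ ω, walkTerm x y ρ (finRotate (k + 1)) β i c ω ∂P| ≤
      termBound B (k + 1) := by
    intro i c
    have := h.abs_integral_walkTerm_le (finRotate (k + 1)) β i c
    rw [Fintype.card_fin] at this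
    exact this
  have hK : 0 ≤ termBound B (k + 1) := by
    have := hB (2 * (k + 1))
    rw [termBound]; positivity
  have hadm : ∀ z ∈ S, Admissible (finRotate (k + 1)) z.1 z.2 → z ∈ S1 ∨ z ∈ S2 := by
    intro z hz hz'
    have hle := (card_add_card_le_of_relations _ z.1 z.2 (z.1 0) (linked_finRotate z.1)
      hz'.relations).1
    rw [Fintype.card_fin] at hle
    by_cases h1 : (univ.image z.1).card + (univ.image z.2).card = k + 2
    · left
      rw [hS1, mem_filter]
      refine ⟨hz, hz', ?_⟩
      have h2 := two_mul_card_le (kerPart z.2) hz'.two_le_card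
      rw [Fintype.card_fin, card_kerPart] at h2
      refine Nat.succ_le_of_lt (lt_of_le_of_ne h2 fun heq => hS z hz ?_)
      have hp : IsPairing (kerPart z.2) := isPairing_of_two_mul_card hz'.two_le_card (by
        rw [card_kerPart, heq, Fintype.card_fin])
      exact ⟨hp, (extremal_oppositeColour hp hz'.relations h1).1, h1⟩
    · right
      rw [hS2, mem_filter]
      exact ⟨hz, hz', by omega⟩
  have hpt : ∀ z ∈ S, |(∏ r, a r (z.2 r)) *
      ∫ ω, walkTerm x y ρ (finRotate (k + 1)) β z.1 z.2 ω ∂P| ≤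
      termBound B (k + 1) * ((if z ∈ S1 then ∏ r, a r (z.2 r) else 0) +
        (if z ∈ S2 then ∏ r, a r (z.2 r) else 0)) := by
    intro z hz
    have hnn : 0 ≤ (if z ∈ S1 then ∏ r, a r (z.2 r) else 0) := by
      split_ifs
      · exact hw _
      · exact le_rfl
    have hnn' : 0 ≤ (if z ∈ S2 then ∏ r, a r (z.2 r) else 0) := by
      split_ifs
      · exact hw _
      · exact le_rfl
    by_cases hz' : Admissible (finRotate (k + 1)) z.1 z.2
    · have h1 : (∏ r, a r (z.2 r)) ≤ (if z ∈ S1 then ∏ r, a r (z.2 r) else 0) +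
          (if z ∈ S2 then ∏ r, a r (z.2 r) else 0) := by
        rcases hadm z hz hz' with h1 | h1
        · rw [if_pos h1]; linarith
        · rw [if_pos h1]; linarith
      rw [abs_mul, abs_of_nonneg (hw _), mul_comm]
      exact mul_le_mul (hterm _ _) h1 (hw _) hK
    · rw [h.integral_walkTerm_eq_zero _ _ _ _ hz', mul_zero, abs_zero]
      positivity
  refine (Finset.abs_sum_le_sum_abs _ _).trans ((Finset.sum_le_sum hpt).trans ?_)
  rw [← Finset.mul_sum, Finset.sum_add_distrib]
  refine mul_le_mul_of_nonneg_left ?_ hK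
  have e1 : ∑ z ∈ S, (if z ∈ S1 then ∏ r, a r (z.2 r) else 0) =
      ∑ z ∈ S1, ∏ r, a r (z.2 r) := by
    rw [Finset.sum_ite_mem, Finset.inter_eq_right.2 (filter_subset _ _)]
  have e2 : ∑ z ∈ S, (if z ∈ S2 then ∏ r, a r (z.2 r) else 0) =
      ∑ z ∈ S2, ∏ r, a r (z.2 r) := by
    rw [Finset.sum_ite_mem, Finset.inter_eq_right.2 (filter_subset _ _)]
  rw [e1, e2]
  have b1 := ha.sum_le hs hη hη1 hI S1 (k + 2) 1 (by rw [Fintype.card_fin]; omega) (by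
    intro z hz
    obtain ⟨hz, hz', hz''⟩ := mem_filter.1 hz
    have hle := (card_add_card_le_of_relations _ z.1 z.2 (z.1 0) (linked_finRotate z.1)
      hz'.relations).1
    rw [Fintype.card_fin] at hle ⊢
    exact ⟨hz'.two_le_card, by omega, hz''⟩)
  have b2 := ha.sum_le hs hη hη1 hI S2 (k + 1) 0 (by rw [Fintype.card_fin]; omega) (by
    intro z hz
    obtain ⟨hz, hz', hz''⟩ := mem_filter.1 hz
    have h2 := two_mul_card_le (kerPart z.2) hz'.two_le_card
    rw [card_kerPart] at h2
    exact ⟨hz'.two_le_card, hz'', by omega⟩)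
  rw [Fintype.card_fin] at b1 b2
  refine (add_le_add b1 b2).trans ?_
  rw [← mul_add]
  refine mul_le_mul_of_nonneg_left ?_ (by positivity)
  have p1 : 2 * (k + 2) - (k + 1) = k + 3 := by omega
  have p2 : 2 * (k + 1) - (k + 1) = k + 1 := by omega
  rw [p1, p2, pow_one, pow_zero, mul_one]
  have p3 : (((k + 1 : ℕ) : ℝ)) ^ (k + 1) ≤ ((k + 2 : ℕ) : ℝ) ^ (k + 1) := by
    gcongr; omega
  have p4 : s ^ (k + 3) * (1 / s ^ 2) = s ^ (k + 1) := by
    field_simp; ring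
  calc ((k + 2 : ℕ) : ℝ) ^ (k + 1) * η * s ^ (k + 3) + ((k + 1 : ℕ) : ℝ) ^ (k + 1) * s ^ (k + 1)
      ≤ ((k + 2 : ℕ) : ℝ) ^ (k + 1) * η * s ^ (k + 3) +
        ((k + 2 : ℕ) : ℝ) ^ (k + 1) * s ^ (k + 1) := by gcongr
    _ = _ := by rw [← p4]; ring

set_option maxHeartbeats 1000000 in
open scoped Classical in
/-- Quantitative asymptotics for the weighted sum of the expectations of all walks. -/
theorem IsEntryModel.abs_sum_sub_wick_le [Nonempty I] (h : IsEntryModel P x y ρ B)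
    (hB : ∀ j, 0 ≤ B j) (β : Fin (k + 1) → Bool) {a : Fin (k + 1) → C → ℝ} {η s : ℝ} (hs : 0 < s)
    (ha : IsWeight a (η / s)) (hη : 0 ≤ η) (hη1 : η ≤ 1) (hI : (Fintype.card I : ℝ) = s ^ 2)
    (kv : Finset (Fin (k + 1)) → ℝ)
    (hkv : ∀ r s, r ≠ s → ∀ z, a r z ≠ 0 → a s z ≠ 0 →
      kv {r, s} = if β r = β s then ρ z ^ 2 else 1) (hkv1 : ∀ V, |kv V| ≤ 1) :
    |∑ z : (Fin (k + 1) → I) × (Fin (k + 1) → C), (∏ r, a r (z.2 r)) *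
      ∫ ω, walkTerm x y ρ (finRotate (k + 1)) β z.1 z.2 ω ∂P -
      s ^ (k + 3) * ∑ π ∈ ncPairings (k + 1), ∏ V ∈ π.parts, (kv V * ∑ z, ∏ r ∈ V, a r z)| ≤
      momentConst (k + 1) (termBound B (k + 1)) * (η + 1 / s ^ 2) * s ^ (k + 3) := by
  set T := s ^ (k + 3) with hT
  set D : ℝ := ((Fintype.card (Finpartition (univ : Finset (Fin (k + 1)))) : ℕ) : ℝ) with hD
  have hs1 : 1 ≤ s := by
    have h1 : (1 : ℝ) ≤ Fintype.card I := by exact_mod_cast Fintype.card_pos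
    rw [hI] at h1
    by_contra hlt
    nlinarith
  have hδ : η / s ≤ η := div_le_self hη hs1
  have hδ0 : 0 ≤ η / s := by positivity
  have hT0 : 0 < T := by positivity
  have hw : ∀ c : Fin (k + 1) → C, 0 ≤ ∏ r, a r (c r) := fun c =>
    Finset.prod_nonneg fun r _ => ha.nonneg r _
  set f : (Fin (k + 1) → I) × (Fin (k + 1) → C) → ℝ := fun z => (∏ r, a r (z.2 r)) *
      ∫ ω, walkTerm x y ρ (finRotate (k + 1)) β z.1 z.2 ω ∂P with hf
  set M : Finset ((Fin (k + 1) → I) × (Fin (k + 1) → C)) := univ.filter fun z =>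
    IsPairing (kerPart z.2) ∧ OppositeColour z.1 z.2 ∧
      (univ.image z.1).card + (univ.image z.2).card = k + 2 with hM
  have hrest := h.abs_sum_nonextremal_le hB β hs ha hη hη1 hI Mᶜ (fun z hz hz' => by
    rw [mem_compl] at hz
    exact hz (mem_filter.2 ⟨mem_univ _, hz'⟩))
  -- The extremal walks are grouped by the kernel of the colouring, which is a non-crossing pairing.
  have hfib : ∑ z ∈ M, f z = ∑ π ∈ ncPairings (k + 1),
      ∑ z ∈ M.filter (fun z => kerPart z.2 = π), f z := by
    rw [Finset.sum_fiberwise_of_maps_to]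
    intro z hz
    obtain ⟨-, h1, h2, h3⟩ := mem_filter.1 hz
    exact mem_filter.2 ⟨mem_univ _, h1, (extremal_oppositeColour h1 (h2.relations h1) h3).2.2⟩
  have hmain : ∀ π ∈ ncPairings (k + 1),
      |∑ z ∈ M.filter (fun z => kerPart z.2 = π), f z -
        T * ∏ V ∈ π.parts, (kv V * ∑ z, ∏ r ∈ V, a r z)| ≤
      T * ((D + ((k + 1 : ℕ) : ℝ) ^ (k + 1)) * (η + 1 / s ^ 2)) := by
    intro π hπ
    obtain ⟨-, hp, hnc⟩ := mem_filter.1 hπ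
    have hb := hp.two_mul_card
    rw [Fintype.card_fin] at hb
    set F := univ.filter fun i : Fin (k + 1) → I => OppositeColour i (fun r => π.part r) ∧
      (univ.image i).card + π.parts.card = k + 2 with hF
    set G := univ.filter fun c : Fin (k + 1) → C => kerPart c = π with hG
    set A := ∑ c ∈ G, ∏ r, a r (c r) with hA
    set κ := ∏ V ∈ π.parts, kv V with hκ
    set χ := ∏ V ∈ π.parts, ∑ z, ∏ r ∈ V, a r z with hχ
    -- Being opposite depends on the colours only through their kernel, so rows and colours can be
    -- summed separately.
    have hset : M.filter (fun z => kerPart z.2 = π) = F ×ˢ G := by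
      ext z
      simp only [hM, hF, hG, mem_filter, mem_univ, true_and, mem_product]
      constructor
      · rintro ⟨⟨-, h2, h3⟩, rfl⟩
        refine ⟨⟨fun r s hrs hc => h2 r s hrs ?_, ?_⟩, rfl⟩
        · exact ((kerPart_part_eq_iff z.2 r s).1 hc.symm).symm
        · rw [card_kerPart]; exact h3
      · rintro ⟨⟨h2, h3⟩, rfl⟩
        refine ⟨⟨hp, fun r s hrs hc => h2 r s hrs ?_, ?_⟩, rfl⟩
        · exact ((kerPart_part_eq_iff z.2 r s).2 hc.symm).symm
        · rw [card_kerPart] at h3; exact h3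
    have hsum : ∑ z ∈ M.filter (fun z => kerPart z.2 = π), f z = κ * (A * F.card) := by
      have h1 : ∀ z ∈ M.filter (fun z => kerPart z.2 = π),
          f z = (∏ r, a r (z.2 r)) * κ := by
        intro z hz
        obtain ⟨hz, hzπ⟩ := mem_filter.1 hz
        obtain ⟨-, h1, h2, h3⟩ := mem_filter.1 hz
        rw [hκ, ← hzπ]
        exact h.integral_extremal β a kv hkv z.1 z.2 h1 h2 h3
      rw [Finset.sum_congr rfl h1, hset, Finset.sum_product]
      simp only [← Finset.sum_mul, sum_const, nsmul_eq_mul]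
      ring
    have hκ1 : |κ| ≤ 1 := by
      rw [hκ, Finset.abs_prod]
      exact Finset.prod_le_one (fun V _ => abs_nonneg _) fun V _ => hkv1 V
    have hA0 : 0 ≤ A := Finset.sum_nonneg fun c _ => hw c
    have hA1 : A ≤ 1 := by
      have h1 := ha.sum_constOn_le π fun V hV => (hp V hV).ge
      rw [Fintype.card_fin, hb, Nat.sub_self, pow_zero] at h1
      refine le_trans (Finset.sum_le_sum_of_subset_of_nonneg ?_ fun c _ _ => hw c) h1
      intro c hc
      obtain ⟨-, rfl⟩ := mem_filter.1 hc
      exact mem_filter.2 ⟨mem_univ _, constOn_kerPart c⟩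
    have hAχ : |A - χ| ≤ D * η :=
      (ha.abs_sum_ker_sub_le hδ0 (hδ.trans hη1) hp).trans
        (mul_le_mul_of_nonneg_left hδ (Nat.cast_nonneg _))
    have hN := card_extremal_walks (I := I) hp hnc
    have hTI : (Fintype.card I : ℝ) ^ (π.parts.card + 1) = T := by
      rw [hI, ← pow_mul, hT]; congr 1; omega
    have hTI' : (Fintype.card I : ℝ) ^ π.parts.card = T * (1 / s ^ 2) := by
      rw [← hTI, hI, pow_succ (s ^ 2), mul_assoc, mul_one_div_cancel (by positivity), mul_one]
    rw [hTI, hTI'] at hN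
    have hbm : (π.parts.card : ℝ) ^ (k + 1) ≤ ((k + 1 : ℕ) : ℝ) ^ (k + 1) := by
      gcongr; omega
    rw [hsum, Finset.prod_mul_distrib]
    -- The error splits into that of the number of walks, of relative size `1 / s ^ 2`, and that of
    -- the colour weight, of size `η`.
    calc |κ * (A * F.card) - T * (κ * χ)| = |κ| * |A * (F.card - T) + T * (A - χ)| := by
          rw [← abs_mul]; congr 1; ring
      _ ≤ 1 * |A * (F.card - T) + T * (A - χ)| := by gcongr
      _ ≤ |A * (F.card - T)| + |T * (A - χ)| := by rw [one_mul]; exact abs_add_le _ _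
      _ = A * |F.card - T| + T * |A - χ| := by
          rw [abs_mul, abs_mul, abs_of_nonneg hA0, abs_of_pos hT0]
      _ ≤ 1 * ((π.parts.card : ℝ) ^ (k + 1) * (T * (1 / s ^ 2))) + T * (D * η) := by
          gcongr
      _ ≤ 1 * (((k + 1 : ℕ) : ℝ) ^ (k + 1) * (T * (1 / s ^ 2))) + T * (D * η) := by gcongr
      _ = T * (D * η + ((k + 1 : ℕ) : ℝ) ^ (k + 1) * (1 / s ^ 2)) := by ring
      _ ≤ _ := by
          refine mul_le_mul_of_nonneg_left ?_ hT0.le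
          have h1 : 0 ≤ D * (1 / s ^ 2) := by positivity
          have h2 : 0 ≤ ((k + 1 : ℕ) : ℝ) ^ (k + 1) * η := by positivity
          linarith [add_mul D (((k + 1 : ℕ) : ℝ) ^ (k + 1)) (η + 1 / s ^ 2), mul_add D η (1 / s ^ 2),
            mul_add (((k + 1 : ℕ) : ℝ) ^ (k + 1)) η (1 / s ^ 2)]
  have hK : 0 ≤ termBound B (k + 1) := by
    have := hB (2 * (k + 1))
    rw [termBound]; positivity
  have hcard : ((ncPairings (k + 1)).card : ℝ) ≤ D := by
    rw [hD, ← card_univ]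
    exact_mod_cast card_le_card (filter_subset _ _)
  rw [← Finset.sum_add_sum_compl M, hfib, Finset.mul_sum]
  calc |∑ π ∈ ncPairings (k + 1), ∑ z ∈ M.filter (fun z => kerPart z.2 = π), f z + ∑ z ∈ Mᶜ, f z -
        ∑ π ∈ ncPairings (k + 1), T * ∏ V ∈ π.parts, (kv V * ∑ z, ∏ r ∈ V, a r z)|
      = |∑ π ∈ ncPairings (k + 1), (∑ z ∈ M.filter (fun z => kerPart z.2 = π), f z -
          T * ∏ V ∈ π.parts, (kv V * ∑ z, ∏ r ∈ V, a r z)) + ∑ z ∈ Mᶜ, f z| := by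
        rw [Finset.sum_sub_distrib]; congr 1; ring
    _ ≤ ∑ π ∈ ncPairings (k + 1), |∑ z ∈ M.filter (fun z => kerPart z.2 = π), f z -
          T * ∏ V ∈ π.parts, (kv V * ∑ z, ∏ r ∈ V, a r z)| + |∑ z ∈ Mᶜ, f z| :=
        (abs_add_le _ _).trans (add_le_add (Finset.abs_sum_le_sum_abs _ _) le_rfl)
    _ ≤ ∑ π ∈ ncPairings (k + 1), T * ((D + ((k + 1 : ℕ) : ℝ) ^ (k + 1)) * (η + 1 / s ^ 2)) +
          termBound B (k + 1) * (D * ((k + 2 : ℕ) ^ (k + 1) * (η + 1 / s ^ 2) * s ^ (k + 3))) :=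
        add_le_add (Finset.sum_le_sum hmain) hrest
    _ ≤ D * (T * ((D + ((k + 1 : ℕ) : ℝ) ^ (k + 1)) * (η + 1 / s ^ 2))) +
          2 * (termBound B (k + 1) * (D * ((k + 2 : ℕ) ^ (k + 1) * (η + 1 / s ^ 2) * s ^ (k + 3)))) := by
        rw [sum_const, nsmul_eq_mul]
        have h1 : 0 ≤ termBound B (k + 1) * (D * ((k + 2 : ℕ) ^ (k + 1) * (η + 1 / s ^ 2) *
          s ^ (k + 3))) := by positivity
        have h2 : 0 ≤ T * ((D + ((k + 1 : ℕ) : ℝ) ^ (k + 1)) * (η + 1 / s ^ 2)) := by positivity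
        have h3 := mul_le_mul_of_nonneg_right hcard h2
        linarith
    _ = _ := by
        rw [momentConst, ← hT, ← hD]
        push_cast
        ring

end Expectation

/-! ### Variance of sums over closed walks -/

section WalkSum

open Finset

variable {Ω : Type*} [MeasurableSpace Ω] {P : Measure Ω} [IsProbabilityMeasure P]
  {C I : Type*} [Fintype C] [Fintype I] [DecidableEq C] [DecidableEq I]
  {x y : C → I → Ω → ℝ} {ρ : C → ℝ} {B : ℕ → ℝ} {k : ℕ}

/-- The weighted sum of the contributions of all closed walks of length `k + 1`. -/
def walkSum (x y : C → I → Ω → ℝ) (ρ : C → ℝ) (β : Fin (k + 1) → Bool) (a : Fin (k + 1) → C → ℝ)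
    (ω : Ω) : ℝ :=
  ∑ z : (Fin (k + 1) → I) × (Fin (k + 1) → C), (∏ r, a r (z.2 r)) *
    walkTerm x y ρ (finRotate (k + 1)) β z.1 z.2 ω

theorem IsEntryModel.integrable_walkSum (h : IsEntryModel P x y ρ B) (β : Fin (k + 1) → Bool)
    (a : Fin (k + 1) → C → ℝ) : Integrable (walkSum x y ρ β a) P :=
  integrable_finsetSum _ fun _ _ => (h.integrable_walkTerm _ _ _ _).const_mul _

theorem IsEntryModel.integral_walkSum (h : IsEntryModel P x y ρ B) (β : Fin (k + 1) → Bool)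
    (a : Fin (k + 1) → C → ℝ) : ∫ ω, walkSum x y ρ β a ω ∂P =
      ∑ z : (Fin (k + 1) → I) × (Fin (k + 1) → C), (∏ r, a r (z.2 r)) *
        ∫ ω, walkTerm x y ρ (finRotate (k + 1)) β z.1 z.2 ω ∂P := by
  simp only [walkSum]
  rw [integral_finsetSum _ fun _ _ => (h.integrable_walkTerm _ _ _ _).const_mul _]
  exact Finset.sum_congr rfl fun _ _ => integral_const_mul _ _

/-- A sum over coloured walks on a disjoint union is a double sum. -/
theorem sum_walk_sum {R R' M : Type*} [Fintype R] [Fintype R'] [DecidableEq R] [DecidableEq R']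
    [AddCommMonoid M] (f : (R ⊕ R' → I) × (R ⊕ R' → C) → M) :
    ∑ z, f z = ∑ u : (R → I) × (R → C), ∑ v : (R' → I) × (R' → C),
      f (Sum.elim u.1 v.1, Sum.elim u.2 v.2) := by
  rw [← Fintype.sum_prod_type']
  let e : (R ⊕ R' → I) × (R ⊕ R' → C) ≃ ((R → I) × (R → C)) × ((R' → I) × (R' → C)) :=
    (Equiv.prodCongr (Equiv.sumArrowEquivProdArrow R R' I)
      (Equiv.sumArrowEquivProdArrow R R' C)).trans (Equiv.prodProdProdComm _ _ _ _)
  refine (e.symm.sum_comp f).symm.trans (Finset.sum_congr rfl fun z _ => ?_)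
  rfl

/-- A pair of closed walks is one family of steps on a disjoint union, with the sum of the two
rotations as successor map; this is why walks were set up for arbitrary permutations. -/
theorem walkSum_sq (β : Fin (k + 1) → Bool) (a : Fin (k + 1) → C → ℝ) (ω : Ω) :
    walkSum x y ρ β a ω ^ 2 =
      ∑ z : (Fin (k + 1) ⊕ Fin (k + 1) → I) × (Fin (k + 1) ⊕ Fin (k + 1) → C),
        (∏ r, Sum.elim a a r (z.2 r)) * walkTerm x y ρ
          (Equiv.sumCongr (finRotate (k + 1)) (finRotate (k + 1))) (Sum.elim β β) z.1 z.2 ω := by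
  rw [sum_walk_sum, sq, walkSum, Finset.sum_mul_sum]
  refine Finset.sum_congr rfl fun u _ => Finset.sum_congr rfl fun v _ => ?_
  rw [walkTerm_sum, Fintype.prod_sum_type]
  simp only [Sum.elim_comp_inl, Sum.elim_comp_inr, Sum.elim_inl, Sum.elim_inr]
  ring

theorem IsEntryModel.integrable_walkSum_sq (h : IsEntryModel P x y ρ B) (β : Fin (k + 1) → Bool)
    (a : Fin (k + 1) → C → ℝ) : Integrable (fun ω => walkSum x y ρ β a ω ^ 2) P := by
  simp only [walkSum_sq]
  exact integrable_finsetSum _ fun _ _ => (h.integrable_walkTerm _ _ _ _).const_mul _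

/-- Vertices of a union of two closed walks sharing a vertex are linked. -/
theorem linked_sum {i : Fin (k + 1) ⊕ Fin (k + 1) → I} {γ : Equiv.Perm (Fin (k + 1))}
    (hγ : γ = finRotate (k + 1)) {r r' : Fin (k + 1)} {b : I}
    (hb : b = i (Sum.inl r) ∨ b = i (Sum.inl (γ r)))
    (hb' : b = i (Sum.inr r') ∨ b = i (Sum.inr (γ r'))) (u : Fin (k + 1) ⊕ Fin (k + 1)) :
    Linked (Equiv.sumCongr γ γ) i (i u) b := by
  have hl : ∀ s, Linked (Equiv.sumCongr γ γ) i (i (Sum.inl s)) (i (Sum.inl 0)) := by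
    subst hγ
    intro s
    induction s using Fin.induction with
    | zero => exact Linked.refl _ _ _
    | succ s ih =>
      have := linked_step (Equiv.sumCongr (finRotate (k + 1)) (finRotate (k + 1))) i
        (Sum.inl s.castSucc)
      rw [Equiv.sumCongr_apply, Sum.map_inl, finRotate_castSucc] at this
      exact this.trans ih
  have hr : ∀ s, Linked (Equiv.sumCongr γ γ) i (i (Sum.inr s)) (i (Sum.inr 0)) := by
    subst hγ
    intro s
    induction s using Fin.induction with
    | zero => exact Linked.refl _ _ _
    | succ s ih =>
      have := linked_step (Equiv.sumCongr (finRotate (k + 1)) (finRotate (k + 1))) i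
        (Sum.inr s.castSucc)
      rw [Equiv.sumCongr_apply, Sum.map_inr, finRotate_castSucc] at this
      exact this.trans ih
  have h1 : Linked (Equiv.sumCongr γ γ) i b (i (Sum.inl 0)) := by
    rcases hb with rfl | rfl <;> exact hl _
  have h2 : Linked (Equiv.sumCongr γ γ) i b (i (Sum.inr 0)) := by
    rcases hb' with h | h <;> (rw [h]; exact hr _)
  rcases u with u | u
  · exact (hl u).trans h1.symm
  · exact (hr u).trans h2.symm

/-- The constant in the variance bound. -/
def varConst (m : ℕ) (B : ℕ → ℝ) : ℝ :=
  (termBound B (m + m) + termBound B m ^ 2) *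
    (Fintype.card (Finpartition (univ : Finset (Fin m ⊕ Fin m))) * ((m + m : ℕ) : ℝ) ^ (m + m))

/-- Concentration: the variance of the weighted sum over all closed walks is of lower order. -/
theorem IsEntryModel.variance_walkSum_le [Nonempty I] (h : IsEntryModel P x y ρ B)
    (hB : ∀ j, 0 ≤ B j) (β : Fin (k + 1) → Bool) {a : Fin (k + 1) → C → ℝ} {η s : ℝ} (hs : 0 < s)
    (ha : IsWeight (Sum.elim a a) (η / s)) (hη : 0 ≤ η) (hη1 : η ≤ 1)
    (hI : (Fintype.card I : ℝ) = s ^ 2) :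
    ∫ ω, walkSum x y ρ β a ω ^ 2 ∂P - (∫ ω, walkSum x y ρ β a ω ∂P) ^ 2 ≤
      varConst (k + 1) B * s ^ (2 * (k + 1)) := by
  classical
  set γ := finRotate (k + 1) with hγ
  -- Only these pairs of walks can have a non-zero covariance.
  set S := univ.filter fun z : (Fin (k + 1) ⊕ Fin (k + 1) → I) × (Fin (k + 1) ⊕ Fin (k + 1) → C) =>
    Admissible (Equiv.sumCongr γ γ) z.1 z.2 ∧
      ∃ r r', z.2 (Sum.inl r) = z.2 (Sum.inr r') ∧
        ∃ b, (b = z.1 (Sum.inl r) ∨ b = z.1 (Sum.inl (γ r))) ∧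
          (b = z.1 (Sum.inr r') ∨ b = z.1 (Sum.inr (γ r'))) with hS
  set K := termBound B (k + 1 + (k + 1)) + termBound B (k + 1) ^ 2 with hK
  have hw : ∀ c : Fin (k + 1) ⊕ Fin (k + 1) → C, 0 ≤ ∏ r, Sum.elim a a r (c r) := fun c =>
    Finset.prod_nonneg fun r _ => ha.nonneg r _
  have hsq : (∫ ω, walkSum x y ρ β a ω ∂P) ^ 2 =
      ∑ z : (Fin (k + 1) ⊕ Fin (k + 1) → I) × (Fin (k + 1) ⊕ Fin (k + 1) → C),
        (∏ r, Sum.elim a a r (z.2 r)) *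
          ((∫ ω, walkTerm x y ρ γ β (z.1 ∘ Sum.inl) (z.2 ∘ Sum.inl) ω ∂P) *
            ∫ ω, walkTerm x y ρ γ β (z.1 ∘ Sum.inr) (z.2 ∘ Sum.inr) ω ∂P) := by
    rw [h.integral_walkSum, sum_walk_sum, sq, Finset.sum_mul_sum]
    refine Finset.sum_congr rfl fun u _ => Finset.sum_congr rfl fun v _ => ?_
    rw [Fintype.prod_sum_type]
    simp only [Sum.elim_comp_inl, Sum.elim_comp_inr, Sum.elim_inl, Sum.elim_inr]
    ring
  have hint : ∫ ω, walkSum x y ρ β a ω ^ 2 ∂P =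
      ∑ z : (Fin (k + 1) ⊕ Fin (k + 1) → I) × (Fin (k + 1) ⊕ Fin (k + 1) → C),
        (∏ r, Sum.elim a a r (z.2 r)) *
          ∫ ω, walkTerm x y ρ (Equiv.sumCongr γ γ) (Sum.elim β β) z.1 z.2 ω ∂P := by
    simp only [walkSum_sq]
    rw [integral_finsetSum _ fun _ _ => (h.integrable_walkTerm _ _ _ _).const_mul _]
    exact Finset.sum_congr rfl fun _ _ => integral_const_mul _ _
  have hone : ∀ i c, |∫ ω, walkTerm x y ρ γ β i c ω ∂P| ≤ termBound B (k + 1) := by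
    intro i c
    have := h.abs_integral_walkTerm_le γ β i c
    rwa [Fintype.card_fin] at this
  have htwo : ∀ i c, |∫ ω, walkTerm x y ρ (Equiv.sumCongr γ γ) (Sum.elim β β) i c ω ∂P| ≤
      termBound B (k + 1 + (k + 1)) := by
    intro i c
    have := h.abs_integral_walkTerm_le (Equiv.sumCongr γ γ) (Sum.elim β β) i c
    rwa [Fintype.card_sum, Fintype.card_fin] at this
  have hK0 : 0 ≤ termBound B (k + 1) := by
    have := hB (2 * (k + 1))
    rw [termBound]; positivity
  have hterm : ∀ z : (Fin (k + 1) ⊕ Fin (k + 1) → I) × (Fin (k + 1) ⊕ Fin (k + 1) → C),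
      (∏ r, Sum.elim a a r (z.2 r)) *
          (∫ ω, walkTerm x y ρ (Equiv.sumCongr γ γ) (Sum.elim β β) z.1 z.2 ω ∂P) -
        (∏ r, Sum.elim a a r (z.2 r)) *
          ((∫ ω, walkTerm x y ρ γ β (z.1 ∘ Sum.inl) (z.2 ∘ Sum.inl) ω ∂P) *
            ∫ ω, walkTerm x y ρ γ β (z.1 ∘ Sum.inr) (z.2 ∘ Sum.inr) ω ∂P) ≤
      if z ∈ S then K * ∏ r, Sum.elim a a r (z.2 r) else 0 := by
    intro z
    split_ifs with hz
    · rw [← mul_sub, mul_comm K]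
      refine mul_le_mul_of_nonneg_left ?_ (hw _)
      have h1 := (abs_le.1 (htwo z.1 z.2)).2
      have h2 := abs_mul (∫ ω, walkTerm x y ρ γ β (z.1 ∘ Sum.inl) (z.2 ∘ Sum.inl) ω ∂P)
        (∫ ω, walkTerm x y ρ γ β (z.1 ∘ Sum.inr) (z.2 ∘ Sum.inr) ω ∂P)
      have h3 := mul_le_mul (hone (z.1 ∘ Sum.inl) (z.2 ∘ Sum.inl))
        (hone (z.1 ∘ Sum.inr) (z.2 ∘ Sum.inr)) (abs_nonneg _) hK0
      rw [← h2, ← sq] at h3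
      linarith [(abs_le.1 h3).1]
    · rw [h.cov_walkTerm_eq_zero γ β γ β z.1 z.2 fun hz' => hz (mem_filter.2 ⟨mem_univ _, hz'⟩),
        sub_self]
  -- The steps of the first walk form an invariant set separating two steps of a common colour, so
  -- the improved vertex bound applies. No gain in `η` is needed, hence the exponent `0`.
  have hbound := ha.sum_le hs hη hη1 hI S (k + 1 + (k + 1)) 0
    (by rw [Fintype.card_sum, Fintype.card_fin]; omega) (by
    intro z hz
    obtain ⟨-, hadm, r, r', hc, b, hb, hb'⟩ := mem_filter.1 hz
    have h2 := two_mul_card_le (kerPart z.2) hadm.two_le_card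
    rw [card_kerPart] at h2
    refine ⟨hadm.two_le_card, ?_, by omega⟩
    have := hadm.card_add_card_le_of_crossing b (linked_sum hγ hb hb')
      (univ.filter fun u => u.isLeft = true) (by
        rintro (u | u) <;> simp) (r₁ := Sum.inl r) (r₂ := Sum.inr r') (by simp) (by simp) hc
    rwa [Fintype.card_sum, Fintype.card_fin] at this)
  rw [Fintype.card_sum, Fintype.card_fin, pow_zero, mul_one] at hbound
  rw [hint, hsq, ← Finset.sum_sub_distrib]
  refine (Finset.sum_le_sum fun z _ => hterm z).trans ?_
  rw [Finset.sum_ite_mem, Finset.univ_inter, ← Finset.mul_sum, varConst, ← hK, mul_assoc, mul_assoc]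
  have hK0' : 0 ≤ K := by
    have := hB (2 * (k + 1 + (k + 1)))
    have h1 : 0 ≤ termBound B (k + 1 + (k + 1)) := by rw [termBound]; positivity
    positivity
  refine mul_le_mul_of_nonneg_left (hbound.trans (le_of_eq ?_)) hK0'
  have : 2 * (k + 1 + (k + 1)) - (k + 1 + (k + 1)) = 2 * (k + 1) := by omega
  rw [this]

end WalkSum

/-! ### Non-crossing pairings and the limiting moments -/

section Wick

open Finset

/-- The openers of a partition: the points which are not the largest of their block. -/
def openers {m : ℕ} (π : Finpartition (univ : Finset (Fin m))) : Set (Fin m) :=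
  {r | ∃ s ∈ π.part r, r < s}

theorem mem_openers {m : ℕ} {π : Finpartition (univ : Finset (Fin m))} {τ : Fin m → Fin m}
    (hτ : ∀ r, π.part r = {r, τ r}) (r : Fin m) : r ∈ openers π ↔ r < τ r := by
  simp [openers, hτ]

/-- A non-crossing pairing is determined by its openers. -/
theorem partner_eq_of_openers {k : ℕ} {π σ : Finpartition (univ : Finset (Fin (k + 1)))}
    (hπ : IsNoncrossing π) (hσ : IsNoncrossing σ) {τ υ : Fin (k + 1) → Fin (k + 1)}
    (hne : ∀ r, τ r ≠ r) (hinv : ∀ r, τ (τ r) = r) (hτ : ∀ r, π.part r = {r, τ r})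
    (hne' : ∀ r, υ r ≠ r) (hinv' : ∀ r, υ (υ r) = r) (hυ : ∀ r, σ.part r = {r, υ r})
    (ho : openers π = openers σ) (j : Fin (k + 1)) (hj : τ j < j) : τ j = υ j := by
  have key : ∀ r, r < τ r ↔ r < υ r := fun r => by
    rw [← mem_openers hτ, ← mem_openers hυ, ho]
  have key' : ∀ r, τ r < r ↔ υ r < r := fun r => by
    have h1 := key r
    have h2 := hne r
    have h3 := hne' r
    constructor
    · intro h; exact lt_of_le_of_ne (not_lt.1 fun h' => absurd (h1.2 h') h.not_gt) h3
    · intro h; exact lt_of_le_of_ne (not_lt.1 fun h' => absurd (h1.1 h') h.not_gt) h2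
  -- Suppose the partners of the closer `j` differ, and consider the larger one. It opens a pair in
  -- both pairings and lies under the arc ending at `j` in the other one, where its closer is
  -- smaller than `j`. By induction the pairings agree at that closer, so it would equal `j`.
  induction j using WellFoundedLT.induction with
  | ind j ih =>
    by_contra hcon
    have hj' := (key' j).1 hj
    rcases lt_or_gt_of_ne hcon with h | h
    · have h1 := noncrossing_partner hπ hinv hτ (τ j) (υ j) h (by rw [hinv]; exact hj')
      rw [hinv] at h1
      have h2 : υ j < τ (υ j) := (key _).2 (by rw [hinv']; exact hj')
      have h3 := ih (τ (υ j)) h1.2 (by rw [hinv]; exact h2)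
      rw [hinv] at h3
      have h4 : j = τ (υ j) := by
        have := congrArg υ h3
        rwa [hinv', hinv'] at this
      exact h1.2.ne' h4
    · have h1 := noncrossing_partner hσ hinv' hυ (υ j) (τ j) h (by rw [hinv']; exact hj)
      rw [hinv'] at h1
      have h2 : τ j < υ (τ j) := (key _).1 (by rw [hinv]; exact hj)
      have h3 := ih (υ (τ j)) h1.2 ((key' _).2 (by rw [hinv']; exact h2))
      rw [hinv'] at h3
      have h4 : j = υ (τ j) := by
        have := congrArg τ h3
        rwa [hinv, hinv, eq_comm] at this
      exact h1.2.ne' h4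

/-- There are at most `2 ^ m` non-crossing pairings of `m` points. -/
theorem card_ncPairings_le (k : ℕ) : (ncPairings (k + 1)).card ≤ 2 ^ (k + 1) := by
  classical
  have h := Finset.card_le_card_of_injOn (s := ncPairings (k + 1))
    (t := (univ : Finset (Fin (k + 1))).powerset) (fun π => univ.filter fun r => r ∈ openers π)
    (fun π _ => mem_coe.2 (mem_powerset.2 (subset_univ _))) (by
      intro π hπ σ hσ ho
      obtain ⟨-, hp, hn⟩ := mem_filter.1 (mem_coe.1 hπ)
      obtain ⟨-, hp', hn'⟩ := mem_filter.1 (mem_coe.1 hσ)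
      have ho' : openers π = openers σ := by
        ext r
        have := congrArg (fun s => r ∈ s) ho
        simpa using this
      obtain ⟨τ, hne, hinv, hτ⟩ := hp.exists_partner
      obtain ⟨υ, hne', hinv', hυ⟩ := hp'.exists_partner
      have h1 := partner_eq_of_openers hn hn' hne hinv hτ hne' hinv' hυ ho'
      have heq : ∀ j, τ j = υ j := by
        intro j
        rcases lt_or_gt_of_ne (hne j) with hj | hj
        · exact h1 j hj
        · have := h1 (τ j) (by rw [hinv]; exact hj)
          rw [hinv] at this
          have h2 := congrArg υ this
          rw [hinv'] at h2
          exact h2.symm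
      rw [← kerPart_part_self π, ← kerPart_part_self σ]
      congr 1
      funext r
      rw [hτ, hυ, heq])
  rwa [card_powerset, card_univ, Fintype.card_fin] at h

variable {ι : Type*} [DecidableEq ι]

/-- The covariance of two letters in the limit. -/
def letterCov (ρ : ι → ℝ) (u v : ι × Bool) : ℝ :=
  if u.1 = v.1 then (if u.2 = v.2 then ρ u.1 ^ 2 else 1) else 0

theorem letterCov_comm (ρ : ι → ℝ) (u v : ι × Bool) : letterCov ρ u v = letterCov ρ v u := by
  simp only [letterCov, eq_comm (a := v.1), eq_comm (a := v.2)]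
  split_ifs with h1 h2 <;> simp_all

theorem abs_letterCov_le {ρ : ι → ℝ} (hρ : ∀ l, |ρ l| ≤ 1) (u v : ι × Bool) :
    |letterCov ρ u v| ≤ 1 := by
  rw [letterCov]
  split_ifs
  · rw [abs_pow]; exact pow_le_one₀ (abs_nonneg _) (hρ _)
  · simp
  · simp

/-- The contribution of a block to the limit of the moments. -/
def blockCov (ρ : ι → ℝ) {m : ℕ} (w : Fin m → ι × Bool) (V : Finset (Fin m)) : ℝ :=
  match V.sort.map w with
  | [u, v] => letterCov ρ u v
  | _ => 0

theorem blockCov_pair (ρ : ι → ℝ) {m : ℕ} (w : Fin m → ι × Bool) {i j : Fin m} (hij : i ≠ j) :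
    blockCov ρ w {i, j} = letterCov ρ (w i) (w j) := by
  have key : ∀ {i j : Fin m}, i < j → blockCov ρ w {i, j} = letterCov ρ (w i) (w j) := by
    intro i j hij
    have : ({i, j} : Finset (Fin m)).sort = [i, j] := by
      rw [show ({i, j} : Finset (Fin m)) = insert i {j} from rfl, Finset.sort_insert]
      · simp
      · intro b hb
        rw [Finset.mem_singleton] at hb
        exact hb ▸ hij.le
      · simpa using hij.ne
    rw [blockCov, this]
    rfl
  rcases lt_or_gt_of_ne hij with h | h
  · exact key h
  · rw [pair_comm, key h, letterCov_comm]

theorem blockCov_of_card_ne (ρ : ι → ℝ) {m : ℕ} (w : Fin m → ι × Bool) {V : Finset (Fin m)}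
    (hV : V.card ≠ 2) : blockCov ρ w V = 0 := by
  rw [blockCov]
  split
  · rename_i u v h
    have := congrArg List.length h
    rw [List.length_map, Finset.length_sort] at this
    exact absurd this hV
  · rfl

theorem abs_blockCov_le {ρ : ι → ℝ} (hρ : ∀ l, |ρ l| ≤ 1) {m : ℕ} (w : Fin m → ι × Bool)
    (V : Finset (Fin m)) : |blockCov ρ w V| ≤ 1 := by
  by_cases hV : V.card = 2
  · obtain ⟨i, j, hij, rfl⟩ := card_eq_two.1 hV
    rw [blockCov_pair ρ w hij]
    exact abs_letterCov_le hρ _ _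
  · rw [blockCov_of_card_ne ρ w hV]; simp

/-- The limit of the moment of a word: a sum over non-crossing pairings. -/
def wickMoment (ρ : ι → ℝ) {m : ℕ} (w : Fin m → ι × Bool) : ℝ :=
  ∑ π : NC m, ∏ V ∈ π.1.parts, blockCov ρ w V

/-- `blockCov` vanishes on blocks whose size is not two, so only pairings contribute. -/
theorem wickMoment_eq_sum_ncPairings (ρ : ι → ℝ) {m : ℕ} (w : Fin m → ι × Bool) :
    wickMoment ρ w = ∑ π ∈ ncPairings m, ∏ V ∈ π.parts, blockCov ρ w V := by
  classical
  have h1 : ∑ π ∈ ncPairings m, ∏ V ∈ π.parts, blockCov ρ w V =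
      ∑ π ∈ univ.filter (fun π : Finpartition (univ : Finset (Fin m)) => IsNoncrossing π),
        ∏ V ∈ π.parts, blockCov ρ w V := by
    refine Finset.sum_subset (fun π hπ => ?_) fun π hπ hπ' => ?_
    · obtain ⟨-, -, hn⟩ := mem_filter.1 hπ
      exact mem_filter.2 ⟨mem_univ _, hn⟩
    · have hnp : ¬ IsPairing π := fun hp =>
        hπ' (mem_filter.2 ⟨mem_univ _, hp, (mem_filter.1 hπ).2⟩)
      rw [IsPairing] at hnp
      push Not at hnp
      obtain ⟨V, hV, hV2⟩ := hnp
      exact Finset.prod_eq_zero hV (blockCov_of_card_ne ρ w hV2)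
  rw [h1, wickMoment]
  exact (Finset.sum_subtype (p := fun π => IsNoncrossing π) (F := instFintypeNC m)
    (univ.filter fun π : Finpartition (univ : Finset (Fin m)) => IsNoncrossing π)
    (fun π => by simp) fun π => ∏ V ∈ π.parts, blockCov ρ w V).symm

theorem wickMoment_zero (ρ : ι → ℝ) (w : Fin 0 → ι × Bool) : wickMoment ρ w = 1 := by
  have h : ∀ π : NC 0, ∏ V ∈ π.1.parts, blockCov ρ w V = 1 := by
    intro π
    refine Finset.prod_eq_one fun V hV => ?_
    obtain ⟨r, -⟩ := π.1.nonempty_of_mem_parts hV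
    exact r.elim0
  rw [wickMoment, Finset.sum_congr rfl fun π _ => h π, sum_const, nsmul_one]
  have : (univ : Finset (NC 0)).card = 1 := by
    rw [card_eq_one]
    refine ⟨NC.one 0, ?_⟩
    ext π
    simp only [mem_univ, mem_singleton, true_iff]
    apply Subtype.ext
    apply Finpartition.ext
    ext V
    constructor
    · intro hV
      obtain ⟨r, -⟩ := π.1.nonempty_of_mem_parts hV
      exact r.elim0
    · intro hV
      obtain ⟨r, -⟩ := (NC.one 0).1.nonempty_of_mem_parts hV
      exact r.elim0
  rw [this, Nat.cast_one]

theorem wickMoment_two (ρ : ι → ℝ) (w : Fin 2 → ι × Bool) :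
    wickMoment ρ w = letterCov ρ (w 0) (w 1) := by
  have hu : (univ : Finset (Fin 2)) = {0, 1} := rfl
  rw [wickMoment, Finset.sum_eq_single (NC.one 2)]
  · rw [NC.one_parts (by norm_num), prod_singleton, hu, blockCov_pair ρ w (by decide)]
  · intro π _ hπ
    by_cases h : ∀ V ∈ π.1.parts, V.card = 2
    · refine absurd ?_ hπ
      have h1 : ∀ V ∈ π.1.parts, V = univ := fun V hV => by
        rw [← card_eq_iff_eq_univ, h V hV, Fintype.card_fin]
      apply Subtype.ext
      apply Finpartition.ext
      rw [NC.one_parts (by norm_num)]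
      have hne : (univ : Finset (Fin 2)) ≠ ⊥ := Finset.Nonempty.ne_empty ⟨0, mem_univ _⟩
      obtain ⟨V, hV⟩ := π.1.parts_nonempty hne
      refine Finset.eq_singleton_iff_unique_mem.2 ⟨h1 V hV ▸ hV, h1⟩
    · push Not at h
      obtain ⟨V, hV, hV2⟩ := h
      exact Finset.prod_eq_zero hV (blockCov_of_card_ne ρ w hV2)
  · intro h; exact absurd (mem_univ _) h

theorem abs_wickMoment_le {ρ : ι → ℝ} (hρ : ∀ l, |ρ l| ≤ 1) {m : ℕ} (w : Fin m → ι × Bool) :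
    |wickMoment ρ w| ≤ 2 ^ m := by
  rcases m with _ | k
  · simp [wickMoment_zero]
  · rw [wickMoment_eq_sum_ncPairings]
    refine (Finset.abs_sum_le_sum_abs _ _).trans ?_
    calc ∑ π ∈ ncPairings (k + 1), |∏ V ∈ π.parts, blockCov ρ w V|
        ≤ ∑ _π ∈ ncPairings (k + 1), (1 : ℝ) := Finset.sum_le_sum fun π _ => by
          rw [Finset.abs_prod]
          exact Finset.prod_le_one (fun _ _ => abs_nonneg _) fun V _ => abs_blockCov_le hρ w V
      _ ≤ 2 ^ (k + 1) := by
          rw [sum_const, nsmul_one]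
          exact_mod_cast card_ncPairings_le k

end Wick

/-! ### Traces of products as sums over closed walks -/

section Trace

open Finset

/-- For a path with inner vertices `i` from `a` to `b`, `Fin.cons a i` lists the starting points of
the steps and `Fin.snoc i b` their end points. -/
theorem list_ofFn_prod_apply {S I : Type*} [CommRing S] [Fintype I] [DecidableEq I] (k : ℕ)
    (L : Fin (k + 1) → Matrix I I S) (a b : I) :
    (List.ofFn L).prod a b = ∑ i : Fin k → I, ∏ r : Fin (k + 1),
      L r ((Fin.cons a i : Fin (k + 1) → I) r) ((Fin.snoc i b : Fin (k + 1) → I) r) := by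
  induction k generalizing a with
  | zero => simp [Fin.snoc]
  | succ k ih =>
    rw [List.ofFn_succ, List.prod_cons, Matrix.mul_apply,
      ← (Fin.consEquiv fun _ : Fin (k + 1) => I).sum_comp, Fintype.sum_prod_type]
    refine Finset.sum_congr rfl fun c _ => ?_
    rw [ih, Finset.mul_sum]
    refine Finset.sum_congr rfl fun i _ => ?_
    have e : (Fin.snoc (Fin.consEquiv (fun _ : Fin (k + 1) => I) (c, i)) b : Fin (k + 1 + 1) → I) =
        Fin.cons c (Fin.snoc i b : Fin (k + 1) → I) := (Fin.cons_snoc_eq_snoc_cons c i b).symm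
    rw [Fin.prod_univ_succ (n := k + 1), e]
    simp only [Fin.consEquiv_apply, Fin.cons_zero, Fin.cons_succ]

theorem trace_list_ofFn_prod {S I : Type*} [CommRing S] [Fintype I] [DecidableEq I] (k : ℕ)
    (L : Fin (k + 1) → Matrix I I S) :
    (List.ofFn L).prod.trace =
      ∑ i : Fin (k + 1) → I, ∏ r, L r (i r) (i (finRotate (k + 1) r)) := by
  rw [← (Fin.consEquiv fun _ : Fin (k + 1) => I).sum_comp, Fintype.sum_prod_type, Matrix.trace]
  refine Finset.sum_congr rfl fun a _ => ?_
  rw [Matrix.diag_apply, list_ofFn_prod_apply]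
  refine Finset.sum_congr rfl fun i _ => Finset.prod_congr rfl fun r _ => ?_
  simp only [Fin.consEquiv_apply]
  congr 1
  induction r using Fin.lastCases with
  | last => simp
  | cast r => rw [finRotate_castSucc]; simp

end Trace

/-! ### Words in the rescaled cross-covariance matrices -/

section CrossCovModel

open Finset

variable {Ω : Type*} [MeasurableSpace Ω] {P : Measure Ω} [IsProbabilityMeasure P]
  {p t : ℕ} {N : Fin t → ℕ} {X Y : ∀ l : Fin t, Ω → Matrix (Fin p) (Fin (N l)) ℝ}
  {ρ : Fin t → ℝ} {B : ℕ → ℝ} {k : ℕ}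

/-- The entries of several matrices with `p` rows, indexed by all their columns. -/
def columnEntry (X : ∀ l : Fin t, Ω → Matrix (Fin p) (Fin (N l)) ℝ) (c : Σ l, Fin (N l))
    (i : Fin p) (ω : Ω) : ℝ := X c.1 ω i c.2

/-- The weight of a column of the matrix with index `l`. -/
def columnWeight (N : Fin t → ℕ) (l : Fin t) (c : Σ l, Fin (N l)) : ℝ :=
  if c.1 = l then (√(N l))⁻¹ else 0

theorem columnWeight_nonneg (l : Fin t) (c : Σ l, Fin (N l)) : 0 ≤ columnWeight N l c := by
  rw [columnWeight]; split_ifs <;> positivity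

/-- The `N l` columns have squared weight `1 / N l` each, and matrices with different indices share
no column; the latter is the source of freeness. -/
theorem sum_columnWeight_mul (hN : ∀ l, 1 ≤ N l) (l l' : Fin t) :
    ∑ c, columnWeight N l c * columnWeight N l' c = if l = l' then 1 else 0 := by
  rw [Fintype.sum_sigma, Finset.sum_eq_single l]
  · simp only [columnWeight, if_true]
    split_ifs with h
    · subst h
      have : (0 : ℝ) < N l := by exact_mod_cast hN l
      rw [sum_const, card_univ, Fintype.card_fin, nsmul_eq_mul, ← mul_inv,
        Real.mul_self_sqrt this.le, mul_inv_cancel₀ this.ne']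
    · simp
  · intro m _ hm
    simp [columnWeight, hm]
  · simp

/-- Two factors of the block have total weight at most one, and each remaining factor is at most
`δ`. -/
theorem isWeight_columnWeight {R : Type*} [Fintype R] [DecidableEq R] (hN : ∀ l, 1 ≤ N l)
    {δ : ℝ} (hδ : ∀ l, (√(N l))⁻¹ ≤ δ) (u : R → Fin t) :
    IsWeight (fun r => columnWeight N (u r)) δ where
  nonneg _ _ := columnWeight_nonneg _ _
  block V hV := by
    obtain ⟨r, hr, s, hs, hrs⟩ := one_lt_card.1 hV
    have hδ0 : 0 ≤ δ := le_trans (by positivity) (hδ (u r))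
    have hle : ∀ l c, columnWeight N l c ≤ δ := fun l c => by
      rw [columnWeight]; split_ifs
      · exact hδ l
      · exact hδ0
    have hs' : s ∈ V.erase r := mem_erase.2 ⟨hrs.symm, hs⟩
    calc ∑ z, ∏ r ∈ V, columnWeight N (u r) z
        = ∑ z, columnWeight N (u r) z * columnWeight N (u s) z *
            ∏ q ∈ (V.erase r).erase s, columnWeight N (u q) z := by
          refine Finset.sum_congr rfl fun z _ => ?_
          rw [mul_assoc, Finset.mul_prod_erase _ (fun q => columnWeight N (u q) z) hs',
            Finset.mul_prod_erase _ (fun q => columnWeight N (u q) z) hr]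
      _ ≤ ∑ z, columnWeight N (u r) z * columnWeight N (u s) z * δ ^ (V.card - 2) := by
          refine Finset.sum_le_sum fun z _ => mul_le_mul_of_nonneg_left ?_
            (mul_nonneg (columnWeight_nonneg _ _) (columnWeight_nonneg _ _))
          refine (Finset.prod_le_prod (fun q _ => columnWeight_nonneg _ _)
            fun q _ => hle (u q) z).trans (le_of_eq ?_)
          rw [prod_const, card_erase_of_mem hs', card_erase_of_mem hr, Nat.sub_sub]
      _ ≤ δ ^ (V.card - 2) := by
          rw [← Finset.sum_mul, sum_columnWeight_mul hN]
          split_ifs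
          · rw [one_mul]
          · rw [zero_mul]; positivity

/-- The entries of the rescaled cross-covariance matrix as weighted sums over the columns. -/
theorem starPow_rescaledCov_apply (l : Fin t) (b : Bool) (i j : Fin p) (ω : Ω) :
    starPow (rescaledCov (ρ l) (X l ω) (Y l ω)) b i j = ∑ c, (columnWeight N l c *
      (√p)⁻¹) * centredTerm (columnEntry X) (columnEntry Y) (fun c => ρ c.1) c b i j ω := by
  have hsum : ∀ f : (Σ l, Fin (N l)) → ℝ, ∑ c, (columnWeight N l c * (√p)⁻¹) * f c =
      ((√(N l))⁻¹ * (√p)⁻¹) * ∑ q, f ⟨l, q⟩ := by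
    intro f
    rw [Fintype.sum_sigma, Finset.sum_eq_single l, Finset.mul_sum]
    · simp [columnWeight]
    · intro m _ hm
      simp [columnWeight, hm]
    · simp
  have key : ∀ i j : Fin p, rescaledCov (ρ l) (X l ω) (Y l ω) i j =
      ((√(N l))⁻¹ * (√p)⁻¹) * ∑ q, (X l ω i q * Y l ω j q - if i = j then ρ l else 0) := by
    intro i j
    have hp : 0 < p := i.pos
    -- Without columns the rescaling factor is `√0`, so both sides vanish.
    rcases Nat.eq_zero_or_pos (N l) with h0 | h0
    · have : IsEmpty (Fin (N l)) := by rw [h0]; infer_instance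
      simp [rescaledCov, h0]
    · have hp' : (0 : ℝ) < p := by exact_mod_cast hp
      have h0' : (0 : ℝ) < N l := by exact_mod_cast h0
      simp only [rescaledCov, crossCov, Matrix.smul_apply, Matrix.sub_apply, Matrix.mul_apply,
        Matrix.transpose_apply, Matrix.one_apply, smul_eq_mul, mul_ite, mul_one, mul_zero]
      rw [Finset.sum_sub_distrib, sum_const, card_univ, Fintype.card_fin, nsmul_eq_mul,
        Real.sqrt_div h0'.le]
      have h1 : √(N l : ℝ) ≠ 0 := by positivity
      have h2 : √(p : ℝ) ≠ 0 := by positivity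
      have h3 : (N l : ℝ) = √(N l : ℝ) * √(N l : ℝ) := (Real.mul_self_sqrt h0'.le).symm
      generalize √(N l : ℝ) = u at *
      rw [h3]
      field_simp
  rw [hsum]
  cases b
  · simp only [starPow, Bool.false_eq_true, if_false, key, centredTerm, columnEntry]
  · simp only [starPow, if_true, Matrix.star_apply, key, centredTerm, columnEntry, star_trivial,
      eq_comm (a := i)]

theorem trace_word_eq (w : Fin (k + 1) → Fin t × Bool) (ω : Ω) :
    (List.ofFn fun r => starPow (rescaledCov (ρ (w r).1) (X (w r).1 ω) (Y (w r).1 ω))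
      (w r).2).prod.trace = (√p)⁻¹ ^ (k + 1) *
      walkSum (columnEntry X) (columnEntry Y) (fun c => ρ c.1) (fun r => (w r).2)
        (fun r => columnWeight N (w r).1) ω := by
  rw [trace_list_ofFn_prod, walkSum, Fintype.sum_prod_type, Finset.mul_sum]
  refine Finset.sum_congr rfl fun i _ => ?_
  simp only [starPow_rescaledCov_apply]
  rw [Finset.prod_univ_sum, Fintype.piFinset_univ, Finset.mul_sum]
  refine Finset.sum_congr rfl fun c _ => ?_
  rw [Finset.prod_mul_distrib, Finset.prod_mul_distrib, prod_const, card_univ, Fintype.card_fin,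
    walkTerm]
  ring

/-- The normalised trace of a word in the rescaled cross-covariance matrices. -/
def wordTrace {m : ℕ} (ρ : Fin t → ℝ) (X Y : ∀ l : Fin t, Ω → Matrix (Fin p) (Fin (N l)) ℝ)
    (w : Fin m → Fin t × Bool) (ω : Ω) : ℝ :=
  (p : ℝ)⁻¹ * (List.ofFn fun r => starPow (rescaledCov (ρ (w r).1) (X (w r).1 ω) (Y (w r).1 ω))
      (w r).2).prod.trace

/-- The normalisation `p⁻¹` adds two factors `(√p)⁻¹` to the `k + 1` coming from the letters,
matching the order `s ^ (k + 3)` of the extremal walks. -/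
theorem wordTrace_eq (w : Fin (k + 1) → Fin t × Bool) (ω : Ω) :
    wordTrace ρ X Y w ω = (√p)⁻¹ ^ (k + 3) *
      walkSum (columnEntry X) (columnEntry Y) (fun c => ρ c.1) (fun r => (w r).2)
        (fun r => columnWeight N (w r).1) ω := by
  have h : (p : ℝ)⁻¹ = (√p)⁻¹ ^ 2 := by
    rw [inv_pow, Real.sq_sqrt (Nat.cast_nonneg _)]
  rw [wordTrace, trace_word_eq, h]
  ring

variable (hmodel : IsEntryModel P (columnEntry X) (columnEntry Y) (fun c => ρ c.1) B)
include hmodel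

theorem integrable_wordTrace (w : Fin (k + 1) → Fin t × Bool) :
    Integrable (wordTrace ρ X Y w) P := by
  have : wordTrace ρ X Y w = fun ω => _ := funext fun ω => wordTrace_eq w ω
  rw [this]
  exact (hmodel.integrable_walkSum _ _).const_mul _

theorem integrable_wordTrace_sq (w : Fin (k + 1) → Fin t × Bool) :
    Integrable (fun ω => wordTrace ρ X Y w ω ^ 2) P := by
  simp only [wordTrace_eq, mul_pow]
  exact (hmodel.integrable_walkSum_sq _ _).const_mul _

/-- This fixes the parameters `s = √p` and `η = ∑ l, √(p / N l)`, so that `p / n_l → 0` makes `η`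
small. -/
theorem inv_sqrt_le_ratio (hp : 1 ≤ p) (l : Fin t) :
    (√(N l : ℝ))⁻¹ ≤ (∑ l, √((p : ℝ) / N l)) / √p := by
  have hp' : (0 : ℝ) < √p := Real.sqrt_pos.2 (by exact_mod_cast hp)
  rw [le_div_iff₀ hp']
  refine le_trans (le_of_eq ?_) (Finset.single_le_sum (f := fun l => √((p : ℝ) / N l))
    (fun l _ => Real.sqrt_nonneg _) (mem_univ l))
  rw [Real.sqrt_div (Nat.cast_nonneg _)]
  field_simp

theorem abs_integral_wordTrace_sub_le (hB : ∀ j, 0 ≤ B j) (hp : 1 ≤ p) (hN : ∀ l, 1 ≤ N l)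
    (hρ : ∀ l, |ρ l| ≤ 1) (hη : ∑ l, √((p : ℝ) / N l) ≤ 1) (w : Fin (k + 1) → Fin t × Bool) :
    |∫ ω, wordTrace ρ X Y w ω ∂P - wickMoment ρ w| ≤
      momentConst (k + 1) (termBound B (k + 1)) * (∑ l, √((p : ℝ) / N l) + 1 / p) := by
  have hp' : (0 : ℝ) < p := by exact_mod_cast hp
  have hs : (0 : ℝ) < √p := Real.sqrt_pos.2 hp'
  have hsq : √(p : ℝ) ^ 2 = p := Real.sq_sqrt hp'.le
  have : Nonempty (Fin p) := ⟨⟨0, hp⟩⟩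
  have hpair : ∀ r s : Fin (k + 1), ∀ z : (Σ l, Fin (N l)), columnWeight N (w r).1 z ≠ 0 →
      columnWeight N (w s).1 z ≠ 0 → z.1 = (w r).1 ∧ z.1 = (w s).1 := by
    intro r s z h1 h2
    constructor
    · by_contra h; exact h1 (if_neg h)
    · by_contra h; exact h2 (if_neg h)
  have main := hmodel.abs_sum_sub_wick_le hB (fun r => (w r).2)
    (a := fun r => columnWeight N (w r).1) hs
    (isWeight_columnWeight hN (inv_sqrt_le_ratio hmodel hp) fun r => (w r).1)
    (Finset.sum_nonneg fun l _ => Real.sqrt_nonneg _) hη (by rw [hsq, Fintype.card_fin])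
    (blockCov ρ w) (by
      intro r s hrs z h1 h2
      obtain ⟨e1, e2⟩ := hpair r s z h1 h2
      rw [blockCov_pair ρ w hrs, letterCov, if_pos (e1.symm.trans e2), e1]) (abs_blockCov_le hρ w)
  -- A pair of letters with different matrix indices has weight zero, and so has its covariance.
  have hwick : ∑ π ∈ ncPairings (k + 1), ∏ V ∈ π.parts,
      (blockCov ρ w V * ∑ z, ∏ r ∈ V, columnWeight N (w r).1 z) = wickMoment ρ w := by
    classical
    rw [wickMoment_eq_sum_ncPairings]
    refine Finset.sum_congr rfl fun π hπ => Finset.prod_congr rfl fun V hV => ?_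
    obtain ⟨-, hpi, -⟩ := mem_filter.1 hπ
    obtain ⟨r, s, hrs, rfl⟩ := card_eq_two.1 (hpi V hV)
    simp only [Finset.prod_pair hrs]
    rw [sum_columnWeight_mul hN, blockCov_pair ρ w hrs]
    split_ifs with h
    · rw [mul_one]
    · rw [mul_zero, letterCov, if_neg h]
  rw [hwick, ← hmodel.integral_walkSum, hsq] at main
  simp only [wordTrace_eq]
  rw [integral_const_mul]
  have hpos : 0 < √(p : ℝ) ^ (k + 3) := by positivity
  rw [← mul_le_mul_iff_left₀ hpos, ← abs_of_pos hpos, ← abs_mul, abs_of_pos hpos]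
  refine le_trans (le_of_eq ?_) main
  congr 1
  rw [sub_mul, inv_pow, mul_right_comm, inv_mul_cancel₀ hpos.ne', one_mul, mul_comm (wickMoment ρ w)]

theorem variance_wordTrace_le (hB : ∀ j, 0 ≤ B j) (hp : 1 ≤ p) (hN : ∀ l, 1 ≤ N l)
    (hη : ∑ l, √((p : ℝ) / N l) ≤ 1) (w : Fin (k + 1) → Fin t × Bool) :
    ∫ ω, (wordTrace ρ X Y w ω - ∫ ω', wordTrace ρ X Y w ω' ∂P) ^ 2 ∂P ≤
      varConst (k + 1) B * (1 / (p : ℝ) ^ 2) := by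
  have hp' : (0 : ℝ) < p := by exact_mod_cast hp
  have hs : (0 : ℝ) < √p := Real.sqrt_pos.2 hp'
  have hsq : √(p : ℝ) ^ 2 = p := Real.sq_sqrt hp'.le
  have : Nonempty (Fin p) := ⟨⟨0, hp⟩⟩
  have ha : IsWeight (Sum.elim (fun r => columnWeight N (w r).1) (fun r => columnWeight N (w r).1))
      ((∑ l, √((p : ℝ) / N l)) / √p) := by
    have := isWeight_columnWeight hN (inv_sqrt_le_ratio hmodel hp)
      (Sum.elim (fun r => (w r).1) (fun r => (w r).1) : Fin (k + 1) ⊕ Fin (k + 1) → Fin t)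
    convert this using 1
    funext r
    rcases r with r | r <;> rfl
  have main := hmodel.variance_walkSum_le hB (fun r => (w r).2) hs ha
    (Finset.sum_nonneg fun l _ => Real.sqrt_nonneg _) hη (by rw [hsq, Fintype.card_fin])
  have h1 := integrable_wordTrace hmodel w
  have h2 := integrable_wordTrace_sq hmodel w
  set m := ∫ ω', wordTrace ρ X Y w ω' ∂P with hm
  have h3 : ∫ ω, (wordTrace ρ X Y w ω - m) ^ 2 ∂P = ∫ ω, wordTrace ρ X Y w ω ^ 2 ∂P - m ^ 2 := by
    have : ∀ ω, (wordTrace ρ X Y w ω - m) ^ 2 =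
        wordTrace ρ X Y w ω ^ 2 - 2 * m * wordTrace ρ X Y w ω + m ^ 2 := fun ω => by ring
    simp only [this]
    rw [integral_add (f := fun ω => wordTrace ρ X Y w ω ^ 2 - 2 * m * wordTrace ρ X Y w ω)
      (h2.sub (h1.const_mul _)) (integrable_const _), integral_sub h2 (h1.const_mul _), integral_const_mul, ← hm, integral_const]
    simp
    ring
  rw [h3, hm]
  simp only [wordTrace_eq, mul_pow]
  rw [integral_const_mul, integral_const_mul, mul_pow, ← mul_sub]
  refine (mul_le_mul_of_nonneg_left main (by positivity)).trans (le_of_eq ?_)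
  have h4 : (p : ℝ) ^ 2 = √(p : ℝ) ^ 4 := by
    rw [show 4 = 2 * 2 from rfl, pow_mul, hsq]
  -- The normalisation exceeds the order of the variance by four powers of `√p`, leaving the
  -- summable `1 / p ^ 2`.
  have h5 : ((√(p : ℝ))⁻¹ ^ (k + 3)) ^ 2 * √(p : ℝ) ^ (2 * (k + 1)) = (√(p : ℝ))⁻¹ ^ 4 := by
    rw [← pow_mul, show (k + 3) * 2 = 4 + 2 * (k + 1) by ring, pow_add, mul_assoc, ← mul_pow,
      inv_mul_cancel₀ hs.ne', one_pow, mul_one]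
  rw [h4, one_div, ← inv_pow, ← h5]
  ring

theorem memLp_entry (l : Fin t) (b : Bool) (i j : Fin p) (q : ℕ) :
    MemLp (fun ω => starPow (rescaledCov (ρ l) (X l ω) (Y l ω)) b i j) q P := by
  simp only [starPow_rescaledCov_apply]
  refine memLp_finsetSum _ fun c _ => MemLp.const_mul ?_ _
  have hmeas := (hmodel.measurable_centred c b i j).aestronglyMeasurable (μ := P)
  rcases Nat.eq_zero_or_pos q with rfl | hq
  · simpa using hmeas
  · rw [← integrable_norm_rpow_iff hmeas (by simpa using hq.ne') (by simp)]
    simpa using hmodel.integrable_centredTerm_pow c b i j q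

end CrossCovModel

/-! ### Convergence of words in mean and almost surely -/

section Limits

variable {Ω : Type*} [MeasurableSpace Ω] {P : Measure Ω} [IsProbabilityMeasure P]

/-- A sequence with summable second moments converges to zero almost surely. -/
theorem ae_tendsto_zero_of_summable_sq {f : ℕ → Ω → ℝ}
    (hf : ∀ q, Integrable (fun ω => f q ω ^ 2) P) (hs : Summable fun q => ∫ ω, f q ω ^ 2 ∂P) :
    ∀ᵐ ω ∂P, Tendsto (fun q => f q ω) atTop (𝓝 0) := by
  have hm : ∀ q, AEMeasurable (fun ω => ENNReal.ofReal (f q ω ^ 2)) P := fun q =>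
    (hf q).aestronglyMeasurable.aemeasurable.ennreal_ofReal
  -- The sum of the squares has finite integral, so it is finite almost surely and its terms tend to
  -- zero.
  have h1 : ∫⁻ ω, ∑' q, ENNReal.ofReal (f q ω ^ 2) ∂P ≠ ∞ := by
    rw [lintegral_tsum hm]
    have : ∀ q, ∫⁻ ω, ENNReal.ofReal (f q ω ^ 2) ∂P = ENNReal.ofReal (∫ ω, f q ω ^ 2 ∂P) :=
      fun q => (ofReal_integral_eq_lintegral_ofReal (hf q) (ae_of_all _ fun ω => sq_nonneg _)).symm
    simp only [this]
    rw [← ENNReal.ofReal_tsum_of_nonneg (fun q => integral_nonneg fun ω => sq_nonneg _) hs]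
    exact ENNReal.ofReal_ne_top
  filter_upwards [ae_lt_top' (AEMeasurable.tsum hm) h1] with ω hω
  have h2 := ENNReal.tendsto_cofinite_zero_of_tsum_ne_top hω.ne
  rw [Nat.cofinite_eq_atTop] at h2
  have h3 := (ENNReal.tendsto_toReal ENNReal.zero_ne_top).comp h2
  have h4 : Tendsto (fun q => f q ω ^ 2) atTop (𝓝 0) := by
    refine h3.congr fun q => ?_
    simp only [Function.comp_apply]
    exact ENNReal.toReal_ofReal (sq_nonneg _)
  have h5 := h4.sqrt
  simp only [Real.sqrt_sq_eq_abs, Real.sqrt_zero] at h5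
  exact (tendsto_zero_iff_abs_tendsto_zero _).2 h5

variable {t : ℕ} {n : Fin t → ℕ → ℕ} {ρ : Fin t → ℝ}
  {X Y : ∀ (p : ℕ) (l : Fin t), Ω → Matrix (Fin p) (Fin (n l p)) ℝ} {B : ℕ → ℝ}

/-- The hypotheses on the entries give an entry model with moment bounds uniform in `p`. -/
theorem exists_isEntryModel
    (hX : ∀ p l i j, Measurable (fun ω => X p l ω i j))
    (hY : ∀ p l i j, Measurable (fun ω => Y p l ω i j))
    (hindep : ∀ p : ℕ, iIndepFun
      (fun (q : Σ l : Fin t, Fin p × Fin (n l p)) (ω : Ω) =>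
        ((X p q.1 ω q.2.1 q.2.2, Y p q.1 ω q.2.1 q.2.2) : ℝ × ℝ)) P)
    (hXmean : ∀ p l i j, ∫ ω, X p l ω i j ∂P = 0)
    (hYmean : ∀ p l i j, ∫ ω, Y p l ω i j ∂P = 0)
    (hXvar : ∀ p l i j, ∫ ω, (X p l ω i j) ^ 2 ∂P = 1)
    (hYvar : ∀ p l i j, ∫ ω, (Y p l ω i j) ^ 2 ∂P = 1)
    (hcorr : ∀ p l i j, ∫ ω, X p l ω i j * Y p l ω i j ∂P = ρ l)
    (hmom : ∀ (l : Fin t) (k : ℕ), 1 ≤ k → ∃ B : ℝ, ∀ (p : ℕ) (i : Fin p) (j : Fin (n l p)),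
      Integrable (fun ω => |X p l ω i j| ^ k) P ∧ Integrable (fun ω => |Y p l ω i j| ^ k) P ∧
        ∫ ω, (|X p l ω i j| ^ k + |Y p l ω i j| ^ k) ∂P < B) :
    ∃ B : ℕ → ℝ, (∀ j, 0 ≤ B j) ∧
      ∀ p, IsEntryModel P (columnEntry (X p)) (columnEntry (Y p)) (fun c => ρ c.1) B := by
  choose! b hb using hmom
  have hint : ∀ (p : ℕ) (l : Fin t) (i : Fin p) (j : Fin (n l p)) (k : ℕ),
      Integrable (fun ω => |X p l ω i j| ^ k) P ∧ Integrable (fun ω => |Y p l ω i j| ^ k) P := by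
    intro p l i j k
    rcases Nat.eq_zero_or_pos k with rfl | hk
    · simp only [pow_zero]
      exact ⟨integrable_const 1, integrable_const 1⟩
    · exact ⟨(hb l k hk p i j).1, (hb l k hk p i j).2.1⟩
  have hle : ∀ (p : ℕ) (l : Fin t) (i : Fin p) (j : Fin (n l p)) (k : ℕ),
      ∫ ω, |X p l ω i j| ^ k ∂P ≤ 1 + ∑ l, |b l k| ∧
        ∫ ω, |Y p l ω i j| ^ k ∂P ≤ 1 + ∑ l, |b l k| := by
    intro p l i j k
    have hs : |b l k| ≤ ∑ l, |b l k| :=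
      Finset.single_le_sum (f := fun l => |b l k|) (fun _ _ => abs_nonneg _) (Finset.mem_univ l)
    rcases Nat.eq_zero_or_pos k with rfl | hk
    · have : 0 ≤ ∑ l, |b l 0| := Finset.sum_nonneg fun _ _ => abs_nonneg _
      simp [this]
    · have h1 := (hb l k hk p i j).2.2
      rw [integral_add (hint p l i j k).1 (hint p l i j k).2] at h1
      have h2 : 0 ≤ ∫ ω, |X p l ω i j| ^ k ∂P :=
        integral_nonneg fun ω => pow_nonneg (abs_nonneg _) _
      have h3 : 0 ≤ ∫ ω, |Y p l ω i j| ^ k ∂P :=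
        integral_nonneg fun ω => pow_nonneg (abs_nonneg _) _
      have h4 := le_abs_self (b l k)
      constructor <;> linarith
  -- The summand one covers the moment of order zero, for which nothing is assumed.
  refine ⟨fun k => 1 + ∑ l, |b l k|, fun j => ?_, fun p => ?_⟩
  · have : 0 ≤ ∑ l, |b l j| := Finset.sum_nonneg fun _ _ => abs_nonneg _
    linarith
  · refine ⟨fun c i => hX p c.1 i c.2, fun c i => hY p c.1 i c.2, ?_, fun c i => hXmean p c.1 i c.2,
      fun c i => hYmean p c.1 i c.2, fun c i => hXvar p c.1 i c.2, fun c i => hYvar p c.1 i c.2,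
      fun c i => hcorr p c.1 i c.2, fun c i k => (hint p c.1 i c.2 k).1,
      fun c i k => (hint p c.1 i c.2 k).2, fun c i k => (hle p c.1 i c.2 k).1,
      fun c i k => (hle p c.1 i c.2 k).2⟩
    have hinj : Function.Injective (fun q : (Σ l, Fin (n l p)) × Fin p =>
        (⟨q.1.1, (q.2, q.1.2)⟩ : Σ l : Fin t, Fin p × Fin (n l p))) := by
      rintro ⟨⟨l, j⟩, i⟩ ⟨⟨l', j'⟩, i'⟩ h
      simp only [Sigma.mk.injEq] at h
      obtain ⟨rfl, h⟩ := h
      simp only [heq_eq_eq, Prod.mk.injEq] at h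
      rw [h.1, h.2]
    exact (hindep p).precomp hinj

variable (hB : ∀ j, 0 ≤ B j)
  (hmodel : ∀ p, IsEntryModel P (columnEntry (X p)) (columnEntry (Y p)) (fun c => ρ c.1) B)
  (hn : ∀ l, Tendsto (n l) atTop atTop)
  (hy : ∀ l, Tendsto (fun p : ℕ => (p : ℝ) / (n l p : ℝ)) atTop (𝓝 0))

-- The Cauchy-Schwarz bound needs an actual entry, hence some `p ≥ 1` for which there is at least
-- one column.
include hmodel hn in
theorem abs_corr_le_one (l : Fin t) : |ρ l| ≤ 1 := by
  obtain ⟨p, hp, hp1⟩ := (((hn l).eventually_ge_atTop 1).and (eventually_ge_atTop 1)).exists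
  exact (hmodel p).abs_corr_le_one ⟨l, ⟨0, hp⟩⟩ ⟨0, hp1⟩

include hy in
theorem tendsto_sum_sqrt_ratio :
    Tendsto (fun p : ℕ => ∑ l, √((p : ℝ) / n l p)) atTop (𝓝 0) := by
  have h := tendsto_finsetSum (Finset.univ : Finset (Fin t)) fun l _ => (hy l).sqrt
  simpa using h

include hn hy in
theorem eventually_regular : ∀ᶠ p : ℕ in atTop,
    1 ≤ p ∧ (∀ l, 1 ≤ n l p) ∧ ∑ l, √((p : ℝ) / n l p) ≤ 1 := by
  filter_upwards [eventually_ge_atTop 1, eventually_all.2 fun l => (hn l).eventually_ge_atTop 1,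
    (tendsto_sum_sqrt_ratio hy).eventually_le_const zero_lt_one] with p h1 h2 h3
  exact ⟨h1, h2, h3⟩

theorem wordTrace_empty (p : ℕ) (hp : 1 ≤ p) (w : Fin 0 → Fin t × Bool) (ω : Ω) :
    wordTrace ρ (X p) (Y p) w ω = 1 := by
  have : (p : ℝ) ≠ 0 := by positivity
  simp [wordTrace, this]

include hB hmodel hn hy in
theorem tendsto_integral_wordTrace {m : ℕ} (w : Fin m → Fin t × Bool) :
    Tendsto (fun p => ∫ ω, wordTrace ρ (X p) (Y p) w ω ∂P) atTop (𝓝 (wickMoment ρ w)) := by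
  rcases m with _ | k
  · rw [wickMoment_zero]
    refine tendsto_const_nhds.congr' ?_
    filter_upwards [eventually_ge_atTop 1] with p hp
    simp only [wordTrace_empty p hp]
    simp
  · rw [tendsto_iff_norm_sub_tendsto_zero]
    have h0 : Tendsto (fun p : ℕ => momentConst (k + 1) (termBound B (k + 1)) *
        (∑ l, √((p : ℝ) / n l p) + 1 / p)) atTop (𝓝 0) := by
      have := ((tendsto_sum_sqrt_ratio hy).add tendsto_one_div_atTop_nhds_zero_nat).const_mul
        (momentConst (k + 1) (termBound B (k + 1)))
      simpa using this
    refine squeeze_zero' (Eventually.of_forall fun p => norm_nonneg _) ?_ h0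
    filter_upwards [eventually_regular hn hy] with p ⟨h1, h2, h3⟩
    exact abs_integral_wordTrace_sub_le (hmodel p) hB h1 h2 (abs_corr_le_one hmodel hn) h3 w

include hB hmodel hn hy in
/-- Almost surely, the normalised traces of all words converge. -/
theorem ae_tendsto_wordTrace : ∀ᵐ ω ∂P, ∀ (m : ℕ) (w : Fin m → Fin t × Bool),
    Tendsto (fun p => wordTrace ρ (X p) (Y p) w ω) atTop (𝓝 (wickMoment ρ w)) := by
  rw [ae_all_iff]
  intro m
  rw [ae_all_iff]
  intro w
  rcases m with _ | k
  · refine ae_of_all _ fun ω => ?_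
    rw [wickMoment_zero]
    refine tendsto_const_nhds.congr' ?_
    filter_upwards [eventually_ge_atTop 1] with p hp
    rw [wordTrace_empty p hp]
  · have hsum : Summable fun p => ∫ ω, (wordTrace ρ (X p) (Y p) w ω -
        ∫ ω', wordTrace ρ (X p) (Y p) w ω' ∂P) ^ 2 ∂P := by
      have h0 : Summable fun p : ℕ => varConst (k + 1) B * (1 / (p : ℝ) ^ 2) :=
        (Real.summable_one_div_nat_pow.2 (by norm_num)).mul_left _
      refine h0.of_norm_bounded_eventually_nat ?_
      filter_upwards [eventually_regular hn hy] with p ⟨h1, h2, h3⟩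
      rw [Real.norm_of_nonneg (integral_nonneg fun ω => sq_nonneg _)]
      exact variance_wordTrace_le (hmodel p) hB h1 h2 h3 w
    have hint : ∀ p, Integrable (fun ω => (wordTrace ρ (X p) (Y p) w ω -
        ∫ ω', wordTrace ρ (X p) (Y p) w ω' ∂P) ^ 2) P := by
      intro p
      have h1 := integrable_wordTrace (hmodel p) w
      have h2 := integrable_wordTrace_sq (hmodel p) w
      have : ∀ m : ℝ, Integrable (fun ω => (wordTrace ρ (X p) (Y p) w ω - m) ^ 2) P := by
        intro m
        have h3 : ∀ ω, (wordTrace ρ (X p) (Y p) w ω - m) ^ 2 =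
          wordTrace ρ (X p) (Y p) w ω ^ 2 - 2 * m * wordTrace ρ (X p) (Y p) w ω + m ^ 2 :=
          fun ω => by ring
        simp only [h3]
        exact (h2.sub (h1.const_mul _)).add (integrable_const _)
      exact this _
    filter_upwards [ae_tendsto_zero_of_summable_sq hint hsum] with ω hω
    have := hω.add (tendsto_integral_wordTrace hB hmodel hn hy w)
    simpa using this

end Limits

/-! ### Noncommutative polynomials and the limiting functional -/

section Polynomials

variable {𝕜 : Type*} [CommSemiring 𝕜] {ι : Type*}

theorem map_starPow {A B F : Type*} [Star A] [Star B] [FunLike F A B] (f : F)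
    (hf : ∀ x, f (star x) = star (f x)) (a : A) (b : Bool) : f (starPow a b) = starPow (f a) b := by
  cases b <;> simp [starPow, hf]

theorem star_starPow {A : Type*} [InvolutiveStar A] (a : A) (b : Bool) :
    star (starPow a b) = starPow a (!b) := by
  cases b <;> simp [starPow]

theorem polyEval_ι {A : Type*} [Ring A] [StarRing A] [Algebra 𝕜 A] (a : ι → A) (x : ι × Bool) :
    polyEval 𝕜 a (FreeAlgebra.ι 𝕜 x) = starPow (a x.1) x.2 := by
  rw [polyEval, FreeAlgebra.lift_ι_apply]

theorem map_polyEval {A B : Type*} [Ring A] [StarRing A] [Algebra 𝕜 A] [Ring B] [StarRing B]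
    [Algebra 𝕜 B] (f : A →ₐ[𝕜] B) (hf : ∀ x, f (star x) = star (f x)) (a : ι → A)
    (Q : FreeAlgebra 𝕜 (ι × Bool)) : f (polyEval 𝕜 a Q) = polyEval 𝕜 (fun l => f (a l)) Q := by
  have : f.comp (polyEval 𝕜 a) = polyEval 𝕜 (fun l => f (a l)) := by
    apply FreeAlgebra.hom_ext
    funext x
    simp only [Function.comp_apply, AlgHom.coe_comp]
    rw [polyEval_ι, polyEval_ι, map_starPow f hf]
  exact DFunLike.congr_fun this Q

theorem polyEval_pi {J : Type*} {A : J → Type*} [∀ j, Ring (A j)] [∀ j, StarRing (A j)]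
    [∀ j, Algebra 𝕜 (A j)] (a : ι → ∀ j, A j) (Q : FreeAlgebra 𝕜 (ι × Bool)) (j : J) :
    polyEval 𝕜 a Q j = polyEval 𝕜 (fun l => a l j) Q :=
  map_polyEval (Pi.evalAlgHom 𝕜 A j) (fun _ => rfl) a Q

/-- The monomial of a word. -/
def monomial (𝕜 : Type*) [CommSemiring 𝕜] {m : ℕ} (w : Fin m → ι × Bool) :
    FreeAlgebra 𝕜 (ι × Bool) :=
  (List.ofFn fun r => FreeAlgebra.ι 𝕜 (w r)).prod

theorem polyEval_monomial {A : Type*} [Ring A] [StarRing A] [Algebra 𝕜 A] (a : ι → A) {m : ℕ}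
    (w : Fin m → ι × Bool) :
    polyEval 𝕜 a (monomial 𝕜 w) = (List.ofFn fun r => starPow (a (w r).1) (w r).2).prod := by
  rw [monomial, map_list_prod, List.map_ofFn]
  congr 2
  funext r
  exact polyEval_ι a (w r)

theorem basisFreeMonoid_apply (w : FreeMonoid (ι × Bool)) :
    FreeAlgebra.basisFreeMonoid 𝕜 (ι × Bool) w = monomial 𝕜 (FreeMonoid.toList w).get := by
  have h1 : FreeAlgebra.basisFreeMonoid 𝕜 (ι × Bool) w = FreeMonoid.lift (FreeAlgebra.ι 𝕜) w := by
    simp [FreeAlgebra.basisFreeMonoid, FreeAlgebra.equivMonoidAlgebraFreeMonoid]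
  rw [h1, monomial, FreeMonoid.lift_apply]
  congr 1
  conv_lhs => rw [← List.ofFn_get (FreeMonoid.toList w)]
  rw [List.map_ofFn]
  rfl

/-- A linear property of polynomials holds for all polynomials if it holds for monomials. -/
theorem mem_of_monomial_mem {R : Type*} [CommRing R] (S : Submodule R (FreeAlgebra R (ι × Bool)))
    (h : ∀ (m : ℕ) (w : Fin m → ι × Bool), monomial R w ∈ S) (Q : FreeAlgebra R (ι × Bool)) :
    Q ∈ S := by
  have : S = ⊤ := by
    rw [eq_top_iff, ← (FreeAlgebra.basisFreeMonoid R (ι × Bool)).span_eq, Submodule.span_le]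
    rintro _ ⟨w, rfl⟩
    rw [basisFreeMonoid_apply]
    exact h _ _
  rw [this]; trivial

/-- The limiting functional on noncommutative polynomials. -/
def wickFunctional [DecidableEq ι] (ρ : ι → ℝ) : FreeAlgebra ℂ (ι × Bool) →ₗ[ℂ] ℂ :=
  (FreeAlgebra.basisFreeMonoid ℂ (ι × Bool)).constr ℂ
    fun w => (wickMoment ρ (FreeMonoid.toList w).get : ℂ)

theorem wickFunctional_monomial [DecidableEq ι] (ρ : ι → ℝ) {m : ℕ} (w : Fin m → ι × Bool) :
    wickFunctional ρ (monomial ℂ w) = (wickMoment ρ w : ℂ) := by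
  have key : ∀ v : FreeMonoid (ι × Bool), wickFunctional ρ
      (monomial ℂ (FreeMonoid.toList v).get) = (wickMoment ρ (FreeMonoid.toList v).get : ℂ) := by
    intro v
    rw [← basisFreeMonoid_apply, wickFunctional, Module.Basis.constr_basis]
  have h2 : ∀ v : List (ι × Bool), v = List.ofFn w → wickFunctional ρ (monomial ℂ v.get) =
      (wickMoment ρ v.get : ℂ) := fun v _ => key (FreeMonoid.ofList v)
  -- The length of `List.ofFn w` is `m` only up to a proof, so the word is transported along an
  -- equality of lengths.
  have h3 : ∀ (m' : ℕ) (e : m' = m) (w' : Fin m' → ι × Bool), (∀ r, w' r = w (Fin.cast e r)) →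
      wickFunctional ρ (monomial ℂ w') = (wickMoment ρ w' : ℂ) →
      wickFunctional ρ (monomial ℂ w) = (wickMoment ρ w : ℂ) := by
    intro m' e w' hw h
    subst e
    have : w' = w := funext hw
    rwa [this] at h
  exact h3 _ (List.length_ofFn) (List.ofFn w).get (fun r => by simp [Fin.cast]) (h2 _ rfl)

end Polynomials

/-! ### Complexification of real matrices -/

section ComplexMatrix

theorem toComplex_mul {p : ℕ} (M N : Matrix (Fin p) (Fin p) ℝ) :
    toComplex (M * N) = toComplex M * toComplex N := by
  rw [toComplex, toComplex, toComplex]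
  exact Matrix.map_mul (f := Complex.ofRealHom)

theorem toComplex_one {p : ℕ} : toComplex (1 : Matrix (Fin p) (Fin p) ℝ) = 1 :=
  Matrix.map_one _ Complex.ofReal_zero Complex.ofReal_one

theorem toComplex_add {p : ℕ} (M N : Matrix (Fin p) (Fin p) ℝ) :
    toComplex (M + N) = toComplex M + toComplex N := by
  ext i j; simp [toComplex]

theorem toComplex_star {p : ℕ} (M : Matrix (Fin p) (Fin p) ℝ) :
    toComplex (star M) = star (toComplex M) := by
  ext i j; simp [toComplex, Matrix.star_apply]

theorem toComplex_starPow {p : ℕ} (M : Matrix (Fin p) (Fin p) ℝ) (b : Bool) :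
    toComplex (starPow M b) = starPow (toComplex M) b := by
  cases b
  · rfl
  · exact toComplex_star M

theorem toComplex_list_prod {p : ℕ} (L : List (Matrix (Fin p) (Fin p) ℝ)) :
    toComplex L.prod = (L.map toComplex).prod := by
  induction L with
  | nil => exact toComplex_one
  | cons M L ih => rw [List.prod_cons, toComplex_mul, ih, List.map_cons, List.prod_cons]

theorem trace_toComplex {p : ℕ} (M : Matrix (Fin p) (Fin p) ℝ) :
    (toComplex M).trace = (M.trace : ℂ) := by
  simp [Matrix.trace, toComplex]

theorem ntr_toComplex {p : ℕ} (M : Matrix (Fin p) (Fin p) ℝ) :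
    ntr (toComplex M) = (((p : ℝ)⁻¹ * M.trace : ℝ) : ℂ) := by
  rw [ntr, trace_toComplex]; push_cast; rfl

end ComplexMatrix

/-! ### Convergence of traces of polynomials -/

section Convergence

variable {Ω : Type*} [MeasurableSpace Ω] {P : Measure Ω} [IsProbabilityMeasure P]
  {t : ℕ} {n : Fin t → ℕ → ℕ} {ρ : Fin t → ℝ}
  {X Y : ∀ (p : ℕ) (l : Fin t), Ω → Matrix (Fin p) (Fin (n l p)) ℝ} {B : ℕ → ℝ}

/-- The matrices `E_l` as complex matrices. -/
abbrev complexCov (ρ : Fin t → ℝ)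
    (X Y : ∀ (p : ℕ) (l : Fin t), Ω → Matrix (Fin p) (Fin (n l p)) ℝ) (p : ℕ) (ω : Ω)
    (l : Fin t) : Matrix (Fin p) (Fin p) ℂ :=
  toComplex (rescaledCov (ρ l) (X p l ω) (Y p l ω))

theorem ntr_polyEval_monomial (p : ℕ) (ω : Ω) {m : ℕ} (w : Fin m → Fin t × Bool) :
    ntr (polyEval ℂ (complexCov ρ X Y p ω) (monomial ℂ w)) =
      (wordTrace ρ (X p) (Y p) w ω : ℂ) := by
  rw [polyEval_monomial, wordTrace, ← ntr_toComplex, toComplex_list_prod, List.map_ofFn]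
  congr 3
  funext r
  exact (toComplex_starPow _ _).symm

theorem ntr_add {p : ℕ} (M N : Matrix (Fin p) (Fin p) ℂ) : ntr (M + N) = ntr M + ntr N := by
  rw [ntr, ntr, ntr, Matrix.trace_add, mul_add]

theorem ntr_smul {p : ℕ} (c : ℂ) (M : Matrix (Fin p) (Fin p) ℂ) : ntr (c • M) = c * ntr M := by
  rw [ntr, ntr, Matrix.trace_smul, smul_eq_mul]; ring

/-- Convergence of all words gives convergence of all polynomials. -/
theorem tendsto_ntr_polyEval {ω : Ω} (h : ∀ (m : ℕ) (w : Fin m → Fin t × Bool),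
      Tendsto (fun p => wordTrace ρ (X p) (Y p) w ω) atTop (𝓝 (wickMoment ρ w)))
    (Q : FreeAlgebra ℂ (Fin t × Bool)) :
    Tendsto (fun p => ntr (polyEval ℂ (complexCov ρ X Y p ω) Q)) atTop
      (𝓝 (wickFunctional ρ Q)) := by
  refine mem_of_monomial_mem (R := ℂ)
    { carrier := {Q | Tendsto (fun p => ntr (polyEval ℂ (complexCov ρ X Y p ω) Q)) atTop
        (𝓝 (wickFunctional ρ Q))}
      add_mem' := fun {Q R} hQ hR => ?_
      zero_mem' := ?_
      smul_mem' := fun c Q hQ => ?_ } (fun m w => ?_) Q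
  · simp only [Set.mem_ofPred_eq, map_add, ntr_add] at hQ hR ⊢
    exact hQ.add hR
  · simp [ntr]
  · simp only [Set.mem_ofPred_eq, map_smul, ntr_smul, smul_eq_mul] at hQ ⊢
    exact hQ.const_mul c
  · change Tendsto _ _ _
    rw [wickFunctional_monomial]
    simp only [ntr_polyEval_monomial]
    exact (Complex.continuous_ofReal.tendsto _).comp (h m w)

/-- Convergence of the expected traces of all polynomials. -/
theorem tendsto_expNtr_polyEval (hB : ∀ j, 0 ≤ B j)
    (hmodel : ∀ p, IsEntryModel P (columnEntry (X p)) (columnEntry (Y p)) (fun c => ρ c.1) B)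
    (hn : ∀ l, Tendsto (n l) atTop atTop)
    (hy : ∀ l, Tendsto (fun p : ℕ => (p : ℝ) / (n l p : ℝ)) atTop (𝓝 0))
    (Q : FreeAlgebra ℂ (Fin t × Bool)) :
    Tendsto (fun p => expNtr P fun ω => polyEval ℂ (complexCov ρ X Y p ω) Q) atTop
      (𝓝 (wickFunctional ρ Q)) := by
  have hexp : ∀ Q p, (expNtr P fun ω => polyEval ℂ (complexCov ρ X Y p ω) Q) =
      ∫ ω, ntr (polyEval ℂ (complexCov ρ X Y p ω) Q) ∂P := fun Q p => by
    rw [expNtr, ← integral_const_mul]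
    rfl
  simp only [hexp]
  -- Integrability is carried along because additivity of the integral depends on it.
  suffices h : (∀ p, Integrable (fun ω => ntr (polyEval ℂ (complexCov ρ X Y p ω) Q)) P) ∧
      Tendsto (fun p => ∫ ω, ntr (polyEval ℂ (complexCov ρ X Y p ω) Q) ∂P) atTop
        (𝓝 (wickFunctional ρ Q)) from h.2
  refine mem_of_monomial_mem (R := ℂ)
    { carrier := {Q | (∀ p, Integrable (fun ω => ntr (polyEval ℂ (complexCov ρ X Y p ω) Q)) P) ∧
        Tendsto (fun p => ∫ ω, ntr (polyEval ℂ (complexCov ρ X Y p ω) Q) ∂P) atTop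
          (𝓝 (wickFunctional ρ Q))}
      add_mem' := fun {Q R} hQ hR => ?_
      zero_mem' := ?_
      smul_mem' := fun c Q hQ => ?_ } (fun m w => ?_) Q
  · simp only [Set.mem_ofPred_eq, map_add, ntr_add] at hQ hR ⊢
    refine ⟨fun p => (hQ.1 p).add (hR.1 p), ?_⟩
    simp only [fun p => integral_add (hQ.1 p) (hR.1 p)]
    exact hQ.2.add hR.2
  · simp [ntr]
  · simp only [Set.mem_ofPred_eq, map_smul, ntr_smul, smul_eq_mul] at hQ ⊢
    refine ⟨fun p => (hQ.1 p).const_mul c, ?_⟩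
    simp only [integral_const_mul]
    exact hQ.2.const_mul c
  · refine ⟨fun p => ?_, ?_⟩
    · simp only [ntr_polyEval_monomial]
      suffices h : Integrable (wordTrace ρ (X p) (Y p) w) P from h.ofReal
      rcases m with _ | k
      · have : wordTrace ρ (X p) (Y p) w = fun _ => (p : ℝ)⁻¹ * (1 : Matrix (Fin p) (Fin p) ℝ).trace := by
          funext ω; simp [wordTrace]
        rw [this]
        exact integrable_const _
      · exact integrable_wordTrace (hmodel p) w
    · rw [wickFunctional_monomial]
      simp only [ntr_polyEval_monomial, integral_complex_ofReal]
      exact (Complex.continuous_ofReal.tendsto _).comp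
        (tendsto_integral_wordTrace hB hmodel hn hy w)

end Convergence

/-! ### The limiting star-probability space -/

section LimitSpace

variable {ι : Type}

/-- The star-algebra of sequences of matrices which are polynomials in given sequences. -/
def seqAlgebra (E : ∀ p : ℕ, ι → Matrix (Fin p) (Fin p) ℂ) :
    StarSubalgebra ℂ (∀ p : ℕ, Matrix (Fin p) (Fin p) ℂ) where
  toSubalgebra := (polyEval ℂ fun l p => E p l).range
  star_mem' := by
    rintro _ ⟨Q, rfl⟩
    induction Q using FreeAlgebra.induction with
    | grade0 c =>
      refine ⟨algebraMap ℂ _ (star c), ?_⟩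
      simp only [AlgHom.toRingHom_eq_coe, RingHom.coe_coe, AlgHom.commutes]
      exact algebraMap_star_comm c
    | grade1 x =>
      refine ⟨FreeAlgebra.ι ℂ (x.1, !x.2), ?_⟩
      simp only [AlgHom.toRingHom_eq_coe, RingHom.coe_coe, polyEval_ι, star_starPow]
    | mul Q R hQ hR =>
      simp only [AlgHom.toRingHom_eq_coe, RingHom.coe_coe, map_mul, star_mul] at hQ hR ⊢
      exact Subalgebra.mul_mem _ hR hQ
    | add Q R hQ hR =>
      simp only [AlgHom.toRingHom_eq_coe, RingHom.coe_coe, map_add, star_add] at hQ hR ⊢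
      exact Subalgebra.add_mem _ hQ hR

variable {E : ∀ p : ℕ, ι → Matrix (Fin p) (Fin p) ℂ}

theorem exists_polyEval_of_mem (b : seqAlgebra E) :
    ∃ Q, ∀ p, (b : ∀ p : ℕ, Matrix (Fin p) (Fin p) ℂ) p = polyEval ℂ (E p) Q := by
  obtain ⟨Q, hQ⟩ := b.2
  refine ⟨Q, fun p => ?_⟩
  rw [← hQ]
  exact polyEval_pi (fun l p => E p l) Q p

/-- The generators of the algebra of sequences. -/
def seqGen (E : ∀ p : ℕ, ι → Matrix (Fin p) (Fin p) ℂ) (l : ι) : seqAlgebra E :=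
  ⟨fun p => E p l, FreeAlgebra.ι ℂ (l, false), by
    simp only [AlgHom.toRingHom_eq_coe, RingHom.coe_coe, polyEval_ι]; rfl⟩

theorem polyEval_seqGen (Q : FreeAlgebra ℂ (ι × Bool)) (p : ℕ) :
    (polyEval ℂ (seqGen E) Q : ∀ p : ℕ, Matrix (Fin p) (Fin p) ℂ) p = polyEval ℂ (E p) Q := by
  have := map_polyEval (seqAlgebra E).subtype.toAlgHom (fun _ => rfl) (seqGen E) Q
  have h2 := congrFun this p
  rw [polyEval_pi] at h2
  exact h2

theorem ntr_mul_comm {p : ℕ} (M N : Matrix (Fin p) (Fin p) ℂ) : ntr (M * N) = ntr (N * M) := by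
  rw [ntr, ntr, Matrix.trace_mul_comm]

theorem ntr_mul_star {p : ℕ} (M : Matrix (Fin p) (Fin p) ℂ) :
    0 ≤ (ntr (M * star M)).re ∧ (ntr (M * star M)).im = 0 := by
  have h : ntr (M * star M) = (((p : ℝ)⁻¹ * ∑ i, ∑ j, ‖M i j‖ ^ 2 : ℝ) : ℂ) := by
    rw [ntr, Matrix.trace]
    push_cast
    congr 1
    refine Finset.sum_congr rfl fun i _ => ?_
    rw [Matrix.diag_apply, Matrix.mul_apply]
    refine Finset.sum_congr rfl fun j _ => ?_
    rw [Matrix.star_apply, Complex.star_def, Complex.mul_conj']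
  rw [h, Complex.ofReal_re, Complex.ofReal_im]
  exact ⟨by positivity, rfl⟩

variable {L : FreeAlgebra ℂ (ι × Bool) →ₗ[ℂ] ℂ}
  (hL : ∀ Q, Tendsto (fun p => ntr (polyEval ℂ (E p) Q)) atTop (𝓝 (L Q)))
include hL

theorem exists_tendsto_ntr (b : seqAlgebra E) :
    ∃ z, Tendsto (fun p => ntr ((b : ∀ p : ℕ, Matrix (Fin p) (Fin p) ℂ) p)) atTop (𝓝 z) := by
  obtain ⟨Q, hQ⟩ := exists_polyEval_of_mem b
  exact ⟨L Q, by simpa only [hQ] using hL Q⟩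

/-- Taking the limit of the sequence itself makes the state independent of the polynomial chosen to
represent an element. -/
theorem tendsto_ntr_limUnder (b : seqAlgebra E) :
    Tendsto (fun p => ntr ((b : ∀ p : ℕ, Matrix (Fin p) (Fin p) ℂ) p)) atTop
      (𝓝 (limUnder atTop fun p => ntr ((b : ∀ p : ℕ, Matrix (Fin p) (Fin p) ℂ) p))) :=
  tendsto_nhds_limUnder (exists_tendsto_ntr hL b)

/-- The limit of the normalised traces. -/
def limitState : seqAlgebra E →ₗ[ℂ] ℂ where
  toFun b := limUnder atTop fun p => ntr ((b : ∀ p : ℕ, Matrix (Fin p) (Fin p) ℂ) p)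
  map_add' a b := by
    refine tendsto_nhds_unique (tendsto_ntr_limUnder hL (a + b)) ?_
    refine ((tendsto_ntr_limUnder hL a).add (tendsto_ntr_limUnder hL b)).congr fun p => ?_
    exact (ntr_add _ _).symm
  map_smul' c a := by
    refine tendsto_nhds_unique (tendsto_ntr_limUnder hL (c • a)) ?_
    refine ((tendsto_ntr_limUnder hL a).const_mul c).congr fun p => ?_
    exact (ntr_smul _ _).symm

theorem tendsto_limitState (b : seqAlgebra E) :
    Tendsto (fun p => ntr ((b : ∀ p : ℕ, Matrix (Fin p) (Fin p) ℂ) p)) atTop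
      (𝓝 (limitState hL b)) :=
  tendsto_ntr_limUnder hL b

theorem limitState_polyEval (Q : FreeAlgebra ℂ (ι × Bool)) :
    limitState hL (polyEval ℂ (seqGen E) Q) = L Q := by
  refine tendsto_nhds_unique (tendsto_limitState hL _) ?_
  simp only [polyEval_seqGen]
  exact hL Q

theorem isState_limitState : IsState (limitState hL) where
  map_one := by
    refine tendsto_nhds_unique (tendsto_limitState hL _) (tendsto_const_nhds.congr' ?_)
    -- The empty matrix has normalised trace zero, so `p = 0` is left out.
    filter_upwards [eventually_ge_atTop 1] with p hp
    have : (p : ℂ) ≠ 0 := by exact_mod_cast (by omega : p ≠ 0)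
    change 1 = ntr 1
    simp [ntr, this]
  nonneg a := by
    have h := tendsto_limitState hL (a * star a)
    constructor
    · exact ge_of_tendsto ((Complex.continuous_re.tendsto _).comp h)
        (Eventually.of_forall fun p => (ntr_mul_star _).1)
    · refine tendsto_nhds_unique ((Complex.continuous_im.tendsto _).comp h)
        (tendsto_const_nhds.congr fun p => ?_)
      exact (ntr_mul_star _).2.symm

theorem isTracial_limitState : IsTracial (limitState hL) := by
  intro a b
  refine tendsto_nhds_unique (tendsto_limitState hL _) ?_
  refine (tendsto_limitState hL (b * a)).congr fun p => ?_
  exact ntr_mul_comm _ _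

end LimitSpace

/-! ### Free cumulants of the limit variables -/

section Cumulants

variable {A : Type*} [Ring A] [StarRing A] [Algebra ℂ A] [StarModule ℂ A] {ι : Type*}
  [DecidableEq ι] {φ : A →ₗ[ℂ] ℂ} {e : ι → A} {ρ : ι → ℝ}
  (hφ : ∀ Q : FreeAlgebra ℂ (ι × Bool), φ (polyEval ℂ e Q) = wickFunctional ρ Q)
include hφ

theorem state_word {m : ℕ} (w : Fin m → ι × Bool) :
    φ (List.ofFn fun r => starPow (e (w r).1) (w r).2).prod = (wickMoment ρ w : ℂ) := by
  rw [← polyEval_monomial (𝕜 := ℂ), hφ, wickFunctional_monomial]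

theorem state_pair (u v : ι × Bool) :
    φ (starPow (e u.1) u.2 * starPow (e v.1) v.2) = (letterCov ρ u v : ℂ) := by
  have := state_word hφ ![u, v]
  rw [wickMoment_two] at this
  simpa using this

/-- The limiting covariances are the second moments of the state, so the limit formula is a Wick
formula in terms of the state alone. Symmetry of `letterCov` takes care of the order inside a pair.
-/
theorem isWick_letters : IsWick φ (Set.range fun u : ι × Bool => starPow (e u.1) u.2) := by
  intro n a ha
  choose w hw using ha
  have hprod : (List.ofFn a).prod = (List.ofFn fun r => starPow (e (w r).1) (w r).2).prod := by
    congr 2; funext r; exact (hw r).symm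
  rw [hprod, state_word hφ, wickMoment, Complex.ofReal_sum]
  refine Finset.sum_congr rfl fun π _ => ?_
  rw [Complex.ofReal_prod]
  refine Finset.prod_congr rfl fun V _ => ?_
  rw [pairBlock]
  split_ifs with hV
  · obtain ⟨i, j, hij, rfl⟩ := Finset.card_eq_two.1 hV
    rw [blockCov_pair ρ w hij]
    rcases lt_or_gt_of_ne hij with h | h
    · rw [blockMoment_pair φ a h, ← hw i, ← hw j, state_pair hφ]
    · rw [Finset.pair_comm, blockMoment_pair φ a h, ← hw i, ← hw j, state_pair hφ, letterCov_comm]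
  · rw [blockCov_of_card_ne ρ w hV, Complex.ofReal_zero]

theorem freeCumulant_letters {n : ℕ} (hn : 1 ≤ n) (w : Fin n → ι × Bool) :
    freeCumulant φ (fun r => starPow (e (w r).1) (w r).2) =
      if n = 2 then (wickMoment ρ w : ℂ) else 0 := by
  rw [(isWick_letters hφ).freeCumulant_eq hn _ fun i => ⟨w i, rfl⟩, state_word hφ]

theorem freeCumulant_two (u v : ι × Bool) :
    freeCumulant φ ![starPow (e u.1) u.2, starPow (e v.1) v.2] = (letterCov ρ u v : ℂ) := by
  have h := freeCumulant_letters hφ (n := 2) (by norm_num) ![u, v]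
  rw [if_pos rfl, wickMoment_two] at h
  rw [← show _ = (letterCov ρ u v : ℂ) from h]
  congr 1
  funext r
  fin_cases r <;> rfl

theorem isElliptic_letter (hρ : ∀ l, |ρ l| ≤ 1) (l : ι) : IsElliptic φ (e l) (ρ l ^ 2) where
  neg_one_le := by nlinarith [sq_nonneg (ρ l)]
  le_one := by
    rw [← sq_abs]; exact pow_le_one₀ (abs_nonneg _) (hρ l)
  cumulant_one ε := by
    have := freeCumulant_letters hφ (n := 1) le_rfl fun r => (l, ε r)
    simpa using this
  cumulant_of_two_lt n hn ε := by
    have := freeCumulant_letters hφ (n := n) (by omega) fun r => (l, ε r)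
    rwa [if_neg (by omega)] at this
  cumulant_self_self := by
    have := freeCumulant_two hφ (l, false) (l, false)
    simpa [starPow, letterCov] using this
  cumulant_star_star := by
    have := freeCumulant_two hφ (l, true) (l, true)
    simpa [starPow, letterCov] using this
  cumulant_self_star := by
    have := freeCumulant_two hφ (l, false) (l, true)
    simpa [starPow, letterCov] using this
  cumulant_star_self := by
    have := freeCumulant_two hφ (l, true) (l, false)
    simpa [starPow, letterCov] using this

/-- Only order two could contribute, and there letters with different indices have covariance zero.
-/
theorem isFree_letters : IsFree φ e := by
  rintro n τ ε ⟨r, s, hrs⟩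
  have hn : 1 ≤ n := r.pos
  have h := freeCumulant_letters hφ hn fun r => (τ r, ε r)
  rw [show (fun r => starPow (e (τ r)) (ε r)) = fun r => starPow (e ((τ r, ε r) : ι × Bool).1)
    ((τ r, ε r) : ι × Bool).2 from rfl, h]
  split_ifs with hn2
  · subst hn2
    have h01 : τ 0 ≠ τ 1 := by
      intro h01
      apply hrs
      fin_cases r <;> fin_cases s <;> first | rfl | exact h01 | exact h01.symm
    rw [wickMoment_two, letterCov, if_neg h01, Complex.ofReal_zero]
  · rfl

theorem isSemicircular_letter (l : ι) (hl : ρ l ^ 2 = 1) (hsa : IsSelfAdjoint (e l)) :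
    IsSemicircular φ (e l) where
  isSelfAdjoint := hsa
  cumulant n hn := by
    have h := freeCumulant_letters hφ hn fun _ => (l, false)
    simp only [starPow, Bool.false_eq_true, if_false] at h
    rw [h]
    split_ifs with hn2
    · subst hn2
      rw [wickMoment_two]
      simp [letterCov, hl]
    · rfl

/-- The real and imaginary parts of `e l`, scaled by `√2`, lie in the span of the letters, and for
`ρ l = 0` they are orthonormal for `φ`. The Wick formula on the span turns orthonormality into
semicircularity and freeness. -/
theorem isCircular_letter (l : ι) (hl : ρ l = 0) : IsCircular φ (e l) := by
  set S : Submodule ℂ A := Submodule.span ℂ (Set.range fun u : ι × Bool => starPow (e u.1) u.2)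
    with hS
  set z : ℂ := (Real.sqrt 2 : ℂ)⁻¹ with hz
  have hz2 : z * z = 2⁻¹ := by
    rw [hz, ← mul_inv, ← Complex.ofReal_mul, Real.mul_self_sqrt (by norm_num)]; norm_num
  have hzs : star z = z := by
    rw [hz, star_inv₀, Complex.star_def, Complex.conj_ofReal]
  set s : Fin 2 → A := ![z • (e l + star (e l)), (-Complex.I * z) • (e l - star (e l))] with hs
  have he : e l ∈ S := Submodule.subset_span ⟨(l, false), rfl⟩
  have he' : star (e l) ∈ S := Submodule.subset_span ⟨(l, true), rfl⟩
  have hsS : ∀ i, s i ∈ S := by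
    intro i
    fin_cases i
    · exact S.smul_mem _ (S.add_mem he he')
    · exact S.smul_mem _ (S.sub_mem he he')
  have hsa : ∀ i, star (s i) = s i := by
    intro i
    fin_cases i
    · simp [hs, hzs, add_comm]
    · simp only [hs, Fin.mk_one, Matrix.cons_val_one, Matrix.cons_val_fin_one, star_smul, star_mul,
        star_neg, hzs, star_sub, star_star, Complex.star_def, Complex.conj_I]
      rw [← neg_sub, smul_neg, ← neg_smul]
      congr 1; ring
  have p00 := state_pair hφ (l, false) (l, false)
  have p01 := state_pair hφ (l, false) (l, true)
  have p10 := state_pair hφ (l, true) (l, false)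
  have p11 := state_pair hφ (l, true) (l, true)
  simp only [starPow, letterCov, hl] at p00 p01 p10 p11
  norm_num at p00 p01 p10 p11
  have hss : ∀ i j, φ (s i * s j) = if i = j then 1 else 0 := by
    intro i j
    have hI : -Complex.I * z * (-Complex.I * z) = - (2⁻¹ : ℂ) := by
      rw [← hz2]; ring_nf; simp
    fin_cases i <;> fin_cases j <;>
      simp [hs, add_mul, mul_add, sub_mul, mul_sub, p00, p01, p10, p11]
    · rw [hz2]; norm_num
    · linear_combination (-2 : ℂ) * hI
  have hW := (isWick_letters hφ).span
  refine ⟨s, fun i => ⟨hsa i, fun n hn => ?_⟩, ?_, ?_⟩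
  · rw [hW.freeCumulant_eq hn _ fun _ => hsS i]
    split_ifs with hn2
    · subst hn2
      have := hss i i
      simpa using this
    · rfl
  · rintro n τ ε ⟨r, q, hrq⟩
    have hst : ∀ i b, starPow (s i) b = s i := by
      intro i b; cases b
      · rfl
      · exact hsa i
    simp only [hst]
    rw [hW.freeCumulant_eq r.pos _ fun i => hsS _]
    split_ifs with hn2
    · subst hn2
      have h01 : τ 0 ≠ τ 1 := by
        intro h01
        apply hrq
        fin_cases r <;> fin_cases q <;> first | rfl | exact h01 | exact h01.symm
      have := hss (τ 0) (τ 1)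
      rw [if_neg h01] at this
      simpa using this
    · rfl
  · rw [← hz]
    simp only [hs, Matrix.cons_val_zero, Matrix.cons_val_one, Matrix.cons_val_fin_one, smul_smul,
      smul_add, smul_sub]
    have h1 : z * (Complex.I * (-Complex.I * z)) = 2⁻¹ := by
      rw [← hz2]; ring_nf; simp
    rw [h1, hz2]
    rw [show (2⁻¹ : ℂ) • e l + (2⁻¹ : ℂ) • star (e l) + ((2⁻¹ : ℂ) • e l - (2⁻¹ : ℂ) • star (e l)) =
      (2⁻¹ : ℂ) • e l + (2⁻¹ : ℂ) • e l by abel, ← add_smul]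
    norm_num

end Cumulants

/-! ### The method of moments -/

section MomentMethod

theorem measureReal_abs_ge_le {μ : Measure ℝ} [IsProbabilityMeasure μ] {k : ℕ}
    (hint : Integrable (fun x : ℝ => x ^ (2 * k)) μ) {R : ℝ} (hR : 0 < R) :
    μ.real {x | R ≤ |x|} ≤ (∫ x, x ^ (2 * k) ∂μ) / R ^ (2 * k) := by
  have h0 : ∀ x : ℝ, 0 ≤ x ^ (2 * k) := fun x => (even_two_mul k).pow_nonneg x
  rw [le_div_iff₀ (by positivity), mul_comm]
  refine le_trans ?_ (mul_meas_ge_le_integral_of_nonneg (ae_of_all _ h0) hint (R ^ (2 * k)))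
  refine mul_le_mul_of_nonneg_left (measureReal_mono fun x hx => ?_) (by positivity)
  change R ^ (2 * k) ≤ x ^ (2 * k)
  rw [← (even_two_mul k).pow_abs x]
  exact pow_le_pow_left₀ hR.le hx _

theorem tendsto_const_mul_ratio_pow {D R : ℝ} (hD : 0 ≤ D) (hDR : D < R) (c : ℝ) :
    Tendsto (fun k : ℕ => c * (D / R) ^ (2 * k)) atTop (𝓝 0) := by
  have hR : 0 < R := hD.trans_lt hDR
  have h1 : Tendsto (fun k : ℕ => (D / R) ^ k) atTop (𝓝 0) :=
    tendsto_pow_atTop_nhds_zero_of_lt_one (by positivity) ((div_lt_one hR).2 hDR)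
  have h2 : Tendsto (fun k : ℕ => 2 * k) atTop atTop :=
    tendsto_id.const_mul_atTop' (by norm_num)
  simpa using (h1.comp h2).const_mul c

/-- Exponentially bounded moments force compact support. -/
theorem measure_abs_ge_eq_zero {μ : Measure ℝ} [IsProbabilityMeasure μ]
    (hint : ∀ k : ℕ, Integrable (fun x : ℝ => x ^ k) μ) {M D R : ℝ} (hD : 0 ≤ D) (hDR : D < R)
    (hm : ∀ k : ℕ, |∫ x, x ^ k ∂μ| ≤ M * D ^ k) : μ {x | R ≤ |x|} = 0 := by
  have hR : 0 < R := hD.trans_lt hDR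
  have h1 : μ.real {x | R ≤ |x|} ≤ 0 := by
    refine ge_of_tendsto (tendsto_const_mul_ratio_pow hD hDR M) (Eventually.of_forall fun k => ?_)
    refine (measureReal_abs_ge_le (hint (2 * k)) hR).trans ?_
    rw [div_pow, ← mul_div_assoc]
    exact div_le_div_of_nonneg_right ((le_abs_self _).trans (hm _)) (by positivity)
  have h2 := le_antisymm h1 measureReal_nonneg
  exact (measureReal_eq_zero_iff).1 h2

theorem ae_abs_lt {μ : Measure ℝ} {R : ℝ} (hμ : μ {x | R ≤ |x|} = 0) : ∀ᵐ x ∂μ, |x| < R := by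
  rw [ae_iff]
  simpa only [not_lt] using hμ

theorem integrable_pow_of_support {μ : Measure ℝ} [IsFiniteMeasure μ] {R : ℝ}
    (hμ : μ {x | R ≤ |x|} = 0) (k : ℕ) : Integrable (fun x : ℝ => x ^ k) μ := by
  refine Integrable.of_bound (by fun_prop) (R ^ k) ?_
  filter_upwards [ae_abs_lt hμ] with x hx
  rw [norm_pow, Real.norm_eq_abs]
  exact pow_le_pow_left₀ (abs_nonneg _) hx.le _

/-- Compactly supported probability measures are determined by their moments. -/
theorem measure_eq_of_moments {μ ν : Measure ℝ} [IsProbabilityMeasure μ] [IsProbabilityMeasure ν]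
    {R : ℝ} (hμ : μ {x | R ≤ |x|} = 0) (hν : ν {x | R ≤ |x|} = 0)
    (h : ∀ k : ℕ, ∫ x, x ^ k ∂μ = ∫ x, x ^ k ∂ν) : μ = ν := by
  have hpoly : ∀ (q : Polynomial ℝ) (ξ : Measure ℝ) [IsProbabilityMeasure ξ],
      ξ {x | R ≤ |x|} = 0 → Integrable (fun x => q.eval x) ξ ∧
        ∫ x, q.eval x ∂ξ = ∑ k ∈ Finset.range (q.natDegree + 1), q.coeff k * ∫ x, x ^ k ∂ξ := by
    intro q ξ _ hξ
    simp only [Polynomial.eval_eq_sum_range]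
    refine ⟨integrable_finsetSum _ fun k _ => (integrable_pow_of_support hξ k).const_mul _, ?_⟩
    rw [integral_finsetSum _ fun k _ => (integrable_pow_of_support hξ k).const_mul _]
    exact Finset.sum_congr rfl fun k _ => integral_const_mul _ _
  refine ext_of_forall_integral_eq_of_IsFiniteMeasure fun f => ?_
  refine eq_of_forall_dist_le fun ε hε => ?_
  -- By Weierstrass, a bounded continuous test function is uniformly close to a polynomial on the
  -- common support.
  obtain ⟨q, hq⟩ := exists_polynomial_near_of_continuousOn (-R) R f f.continuous.continuousOn
    (ε / 2) (half_pos hε)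
  have happ : ∀ (ξ : Measure ℝ) [IsProbabilityMeasure ξ], ξ {x | R ≤ |x|} = 0 →
      |∫ x, f x ∂ξ - ∫ x, q.eval x ∂ξ| ≤ ε / 2 := by
    intro ξ _ hξ
    rw [← integral_sub (f.integrable ξ) (hpoly q ξ hξ).1, ← Real.norm_eq_abs]
    refine (norm_integral_le_of_norm_le_const (C := ε / 2) ?_).trans (by simp)
    filter_upwards [ae_abs_lt hξ] with x hx
    rw [Real.norm_eq_abs, abs_sub_comm]
    exact (hq x (abs_le.1 hx.le)).le
  have h1 := happ μ hμ
  have h2 := happ ν hν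
  have h3 : ∫ x, q.eval x ∂μ = ∫ x, q.eval x ∂ν := by
    rw [(hpoly q μ hμ).2, (hpoly q ν hν).2]
    simp only [h]
  rw [Real.dist_eq]
  rw [h3] at h1
  have h4 := abs_sub_le (∫ x, f x ∂μ) (∫ x, q.eval x ∂ν) (∫ x, f x ∂ν)
  rw [abs_sub_comm (∫ x, q.eval x ∂ν)] at h4
  linarith

/-- The truncation of a real number to `[-R, R]`. -/
def clamp (R x : ℝ) : ℝ := max (-R) (min R x)

theorem abs_clamp_le {R : ℝ} (hR : 0 ≤ R) (x : ℝ) : |clamp R x| ≤ R := by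
  rw [clamp, abs_le]
  exact ⟨le_max_left _ _, max_le (by linarith) (min_le_left _ _)⟩

theorem clamp_eq_self {R x : ℝ} (hx : |x| ≤ R) : clamp R x = x := by
  rw [clamp, min_eq_right (abs_le.1 hx).2, max_eq_right (abs_le.1 hx).1]

theorem continuous_clamp (R : ℝ) : Continuous (clamp R) := by
  unfold clamp; fun_prop

/-- The truncated power as a bounded continuous function. -/
def clampPow (R : ℝ) (hR : 0 ≤ R) (k : ℕ) : BoundedContinuousFunction ℝ ℝ :=
  BoundedContinuousFunction.ofNormedAddCommGroup (fun x => clamp R x ^ k)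
    ((continuous_clamp R).pow k) (R ^ k) fun x => by
      rw [norm_pow, Real.norm_eq_abs]
      exact pow_le_pow_left₀ (abs_nonneg _) (abs_clamp_le hR x) _

theorem clampPow_apply (R : ℝ) (hR : 0 ≤ R) (k : ℕ) (x : ℝ) :
    clampPow R hR k x = clamp R x ^ k := rfl

variable {F : Filter ℕ} [F.NeBot] {μs : ℕ → ProbabilityMeasure ℝ} {μ : ProbabilityMeasure ℝ}
  {m : ℕ → ℝ} {M D R : ℝ}

/-- Weak limits of measures with convergent, exponentially bounded moments have compact support
and the limiting moments. -/
theorem moments_of_tendsto (hlim : Tendsto μs F (𝓝 μ))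
    (hint : ∀ q (k : ℕ), Integrable (fun x : ℝ => x ^ k) (μs q : Measure ℝ))
    (hmom : ∀ k : ℕ, Tendsto (fun q => ∫ x, x ^ k ∂(μs q : Measure ℝ)) F (𝓝 (m k)))
    (hD : 0 ≤ D) (hDR : D < R) (hm : ∀ k : ℕ, |m k| ≤ M * D ^ k) :
    (μ : Measure ℝ) {x | R ≤ |x|} = 0 ∧ ∀ k : ℕ, ∫ x, x ^ k ∂(μ : Measure ℝ) = m k := by
  have hR : 0 < R := hD.trans_lt hDR
  have hweak : ∀ f : BoundedContinuousFunction ℝ ℝ,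
      Tendsto (fun q => ∫ x, f x ∂(μs q : Measure ℝ)) F (𝓝 (∫ x, f x ∂(μ : Measure ℝ))) :=
    ProbabilityMeasure.tendsto_iff_forall_integral_tendsto.1 hlim
  have heven : ∀ (j : ℕ) (x : ℝ), 0 ≤ x ^ (2 * j) := fun j x => (even_two_mul j).pow_nonneg x
  -- Even moments of the truncated variable pass to the weak limit and are at most `M * D ^ (2 *
  -- j)`. Markov's inequality with `j → ∞` then empties the tail.
  have hR' : ∀ R' : ℝ, D < R' → (μ : Measure ℝ) {x | R' ≤ |x|} = 0 := by
    intro R' hDR'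
    have hR' : 0 < R' := hD.trans_lt hDR'
    have h1 : ∀ j, (μ : Measure ℝ).real {x | R' ≤ |x|} ≤ M * (D / R') ^ (2 * j) := by
      intro j
      have hf0 : ∀ x, 0 ≤ clampPow R' hR'.le (2 * j) x := fun x => heven j _
      have h2 := mul_meas_ge_le_integral_of_nonneg (μ := (μ : Measure ℝ)) (ae_of_all _ hf0)
        ((clampPow R' hR'.le (2 * j)).integrable _) (R' ^ (2 * j))
      have h3 : ∫ x, clampPow R' hR'.le (2 * j) x ∂(μ : Measure ℝ) ≤ m (2 * j) := by
        refine le_of_tendsto_of_tendsto' (hweak _) (hmom (2 * j)) fun q => ?_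
        refine integral_mono ((clampPow R' hR'.le (2 * j)).integrable _) (hint q _) fun x => ?_
        simp only [clampPow_apply]
        rw [← (even_two_mul j).pow_abs (clamp R' x), ← (even_two_mul j).pow_abs x]
        refine pow_le_pow_left₀ (abs_nonneg _) ?_ _
        by_cases hx : |x| ≤ R'
        · rw [clamp_eq_self hx]
        · exact (abs_clamp_le hR'.le x).trans (not_le.1 hx).le
      have h4 : (μ : Measure ℝ).real {x | R' ≤ |x|} ≤
          (μ : Measure ℝ).real {x | R' ^ (2 * j) ≤ clampPow R' hR'.le (2 * j) x} := by
        refine measureReal_mono fun x hx => ?_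
        change R' ^ (2 * j) ≤ clamp R' x ^ (2 * j)
        have h5 : |clamp R' x| = R' := by
          rcases le_abs.1 (show R' ≤ |x| from hx) with hx | hx
          · rw [clamp, min_eq_left hx, max_eq_right (by linarith), abs_of_pos hR']
          · rw [clamp, min_eq_right (by linarith), max_eq_left (by linarith), abs_neg,
              abs_of_pos hR']
        rw [← (even_two_mul j).pow_abs (clamp R' x), h5]
      have h5 := (le_abs_self _).trans (hm (2 * j))
      rw [div_pow, ← mul_div_assoc, le_div_iff₀ (by positivity), mul_comm]
      exact (mul_le_mul_of_nonneg_left h4 (by positivity)).trans (h2.trans (h3.trans h5))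
    have h2 : (μ : Measure ℝ).real {x | R' ≤ |x|} ≤ 0 :=
      ge_of_tendsto (tendsto_const_mul_ratio_pow hD hDR' M) (Eventually.of_forall h1)
    exact (measureReal_eq_zero_iff).1 (le_antisymm h2 measureReal_nonneg)
  have hsupp := hR' R hDR
  refine ⟨hsupp, fun k => ?_⟩
  have hclamp : ∫ x, x ^ k ∂(μ : Measure ℝ) = ∫ x, clampPow R hR.le k x ∂(μ : Measure ℝ) := by
    refine integral_congr_ae ?_
    filter_upwards [ae_abs_lt hsupp] with x hx
    rw [clampPow_apply, clamp_eq_self hx.le]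
  rw [hclamp]
  -- Truncation changes `x ^ k` only where `R ≤ |x|`, and there `|x| ^ k` is dominated by a high
  -- even power, with a coefficient that decays in `j` faster than the limiting moments grow.
  have hptw : ∀ j, k ≤ 2 * j → ∀ x : ℝ,
      |x ^ k - clamp R x ^ k| ≤ 2 * R ^ k / R ^ (2 * j) * x ^ (2 * j) := by
    intro j hj x
    by_cases hx : |x| ≤ R
    · rw [clamp_eq_self hx, sub_self, abs_zero]
      have := heven j x
      positivity
    · have hx' : R ≤ |x| := (not_le.1 hx).le
      have h1 : |x ^ k - clamp R x ^ k| ≤ 2 * |x| ^ k := by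
        refine (abs_sub _ _).trans ?_
        rw [abs_pow, abs_pow, two_mul]
        exact add_le_add le_rfl (pow_le_pow_left₀ (abs_nonneg _)
          ((abs_clamp_le hR.le x).trans hx') _)
      refine h1.trans ?_
      rw [← (even_two_mul j).pow_abs x, div_mul_eq_mul_div, le_div_iff₀ (by positivity)]
      have h2 : |x| ^ (2 * j) = |x| ^ k * |x| ^ (2 * j - k) := by rw [← pow_add]; congr 1; omega
      have h3 : R ^ (2 * j) = R ^ k * R ^ (2 * j - k) := by rw [← pow_add]; congr 1; omega
      rw [h2, h3]
      have h4 : R ^ (2 * j - k) ≤ |x| ^ (2 * j - k) := pow_le_pow_left₀ hR.le hx' _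
      calc 2 * |x| ^ k * (R ^ k * R ^ (2 * j - k)) = 2 * |x| ^ k * R ^ k * R ^ (2 * j - k) := by ring
        _ ≤ 2 * |x| ^ k * R ^ k * |x| ^ (2 * j - k) := by gcongr
        _ = _ := by ring
  have hbound : ∀ j, k ≤ 2 * j →
      |m k - ∫ x, clampPow R hR.le k x ∂(μ : Measure ℝ)| ≤ 2 * R ^ k * M * (D / R) ^ (2 * j) := by
    intro j hj
    have h1 : ∀ q, |∫ x, x ^ k ∂(μs q : Measure ℝ) - ∫ x, clampPow R hR.le k x ∂(μs q : Measure ℝ)| ≤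
        2 * R ^ k / R ^ (2 * j) * ∫ x, x ^ (2 * j) ∂(μs q : Measure ℝ) := by
      intro q
      rw [← integral_sub (hint q k) ((clampPow R hR.le k).integrable _), ← integral_const_mul]
      refine abs_integral_le_integral_abs.trans ?_
      exact integral_mono ((hint q k).sub ((clampPow R hR.le k).integrable _)).abs
        ((hint q _).const_mul _) fun x => hptw j hj x
    have h2 := le_of_tendsto_of_tendsto' ((hmom k).sub (hweak _)).abs
      ((hmom (2 * j)).const_mul (2 * R ^ k / R ^ (2 * j))) h1
    refine h2.trans ?_
    have h3 := (le_abs_self _).trans (hm (2 * j))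
    calc 2 * R ^ k / R ^ (2 * j) * m (2 * j) ≤ 2 * R ^ k / R ^ (2 * j) * (M * D ^ (2 * j)) := by
          gcongr
      _ = _ := by rw [div_pow]; ring
  have hfin : |m k - ∫ x, clampPow R hR.le k x ∂(μ : Measure ℝ)| ≤ 0 := by
    refine ge_of_tendsto (tendsto_const_mul_ratio_pow hD hDR (2 * R ^ k * M)) ?_
    filter_upwards [eventually_ge_atTop k] with j hj
    exact hbound j (by omega)
  have := abs_nonpos_iff.1 hfin
  linarith

/-- Convergent second moments are bounded, and Chebyshev's inequality gives tightness. -/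
theorem isTight_of_moments
    (hint : ∀ q (k : ℕ), Integrable (fun x : ℝ => x ^ k) (μs q : Measure ℝ))
    (hmom : ∀ k : ℕ, Tendsto (fun q => ∫ x, x ^ k ∂(μs q : Measure ℝ)) atTop (𝓝 (m k))) :
    IsTightMeasureSet {((ξ : ProbabilityMeasure ℝ) : Measure ℝ) | ξ ∈ Set.range μs} := by
  obtain ⟨b, hb⟩ := (hmom (2 * 1)).bddAbove_range
  have hb' : ∀ q, ∫ x, x ^ (2 * 1) ∂(μs q : Measure ℝ) ≤ b := fun q => hb ⟨q, rfl⟩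
  rw [isTightMeasureSet_iff_exists_isCompact_measure_compl_le]
  intro ε hε
  have hlim : Tendsto (fun r : ℝ => ENNReal.ofReal (b / r ^ (2 * 1))) atTop (𝓝 0) := by
    have h1 : Tendsto (fun r : ℝ => b / r ^ (2 * 1)) atTop (𝓝 0) :=
      tendsto_const_nhds.div_atTop (tendsto_pow_atTop (by norm_num))
    have h2 := (ENNReal.continuous_ofReal.tendsto _).comp h1
    rwa [ENNReal.ofReal_zero] at h2
  obtain ⟨r, hr, hr0⟩ := ((hlim.eventually_le_const hε).and (eventually_gt_atTop 0)).exists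
  refine ⟨Set.Icc (-r) r, isCompact_Icc, ?_⟩
  rintro _ ⟨_, ⟨q, rfl⟩, rfl⟩
  refine le_trans ?_ hr
  have h1 : (Set.Icc (-r) r)ᶜ ⊆ {x : ℝ | r ≤ |x|} := by
    intro x hx
    by_contra hlt
    exact hx (abs_le.1 (not_le.1 hlt).le)
  refine (measure_mono h1).trans ?_
  rw [← ENNReal.ofReal_toReal (measure_ne_top (μs q : Measure ℝ) {x | r ≤ |x|})]
  refine ENNReal.ofReal_le_ofReal ?_
  refine (measureReal_abs_ge_le (hint q (2 * 1)) hr0).trans ?_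
  exact div_le_div_of_nonneg_right (hb' q) (by positivity)

/-- The method of moments for exponentially bounded limiting moments. -/
theorem exists_limit_measure
    (hint : ∀ q (k : ℕ), Integrable (fun x : ℝ => x ^ k) (μs q : Measure ℝ))
    (hmom : ∀ k : ℕ, Tendsto (fun q => ∫ x, x ^ k ∂(μs q : Measure ℝ)) atTop (𝓝 (m k)))
    (hD : 0 ≤ D) (hDR : D < R) (hm : ∀ k : ℕ, |m k| ≤ M * D ^ k) :
    ∃ μ : ProbabilityMeasure ℝ, (μ : Measure ℝ) {x | R ≤ |x|} = 0 ∧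
      (∀ k : ℕ, ∫ x, x ^ k ∂(μ : Measure ℝ) = m k) ∧ Tendsto μs atTop (𝓝 μ) := by
  have hcomp := isCompact_closure_of_isTightMeasureSet (isTight_of_moments hint hmom)
  -- Tightness gives a weak limit along every ultrafilter. Each limit is compactly supported with
  -- the same moments, so all limits coincide and the whole sequence converges.
  have hlim : ∀ U : Ultrafilter ℕ, (U : Filter ℕ) ≤ atTop → ∃ μ : ProbabilityMeasure ℝ,
      Tendsto μs U (𝓝 μ) ∧ (μ : Measure ℝ) {x | R ≤ |x|} = 0 ∧
        ∀ k : ℕ, ∫ x, x ^ k ∂(μ : Measure ℝ) = m k := by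
    intro U hU
    obtain ⟨μ, -, hμ⟩ := hcomp.ultrafilter_le_nhds (U.map μs)
      (le_principal_iff.2 (mem_map.2 (univ_mem' fun q => subset_closure ⟨q, rfl⟩)))
    exact ⟨μ, hμ, moments_of_tendsto hμ hint (fun k => (hmom k).mono_left hU) hD hDR hm⟩
  obtain ⟨μ, hμ, hsupp, hmu⟩ := hlim (Ultrafilter.of atTop) (Ultrafilter.of_le atTop)
  refine ⟨μ, hsupp, hmu, (Filter.tendsto_iff_ultrafilter _ _ _).2 fun U hU => ?_⟩
  obtain ⟨ν, hν, hsupp', hnu⟩ := hlim U hU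
  have : (ν : Measure ℝ) = μ := measure_eq_of_moments hsupp' hsupp fun k => by rw [hnu, hmu]
  rwa [Subtype.ext this] at hν

end MomentMethod

/-! ### Empirical spectral distributions -/

section SpectralDistribution

variable {p : ℕ} {M : Matrix (Fin p) (Fin p) ℝ}

theorem isHermitian_of_isSymm (h : M.IsSymm) : M.IsHermitian := by
  rw [Matrix.IsHermitian, Matrix.conjTranspose_eq_transpose_of_trivial]
  exact h

theorem esd_eq (h : M.IsHermitian) :
    esd M = (p : ℝ≥0∞)⁻¹ • ∑ i, Measure.dirac (h.eigenvalues i) := by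
  rw [esd, h.roots_charpoly_eq_eigenvalues, Multiset.map_map]
  rfl

theorem trace_pow_eq_sum (h : M.IsHermitian) (k : ℕ) :
    (M ^ k).trace = ∑ i, h.eigenvalues i ^ k := by
  conv_lhs => rw [h.spectral_theorem]
  rw [← map_pow, Unitary.conjStarAlgAut_apply, Matrix.trace_mul_cycle, Unitary.coe_star_mul_self,
    one_mul, Matrix.diagonal_pow, Matrix.trace_diagonal]
  rfl

/-- The measure is a finite sum of point masses; `1 ≤ p` keeps the factor `p⁻¹` finite. -/
theorem integrable_esd (h : M.IsSymm) (hp : 1 ≤ p) (f : ℝ → ℝ) : Integrable f (esd M) := by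
  rw [esd_eq (isHermitian_of_isSymm h)]
  refine Integrable.smul_measure ?_ (by
    simp only [ne_eq, ENNReal.inv_eq_top, Nat.cast_eq_zero]; omega)
  rw [integrable_finsetSum_measure]
  intro i _
  exact integrable_dirac (by simp)

theorem integral_esd (h : M.IsSymm) (f : ℝ → ℝ) :
    ∫ x, f x ∂(esd M) = (p : ℝ)⁻¹ * ∑ i, f ((isHermitian_of_isSymm h).eigenvalues i) := by
  rw [esd_eq (isHermitian_of_isSymm h), integral_smul_measure,
    integral_finsetSum_measure fun i _ => integrable_dirac (by simp)]
  simp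

theorem isProbabilityMeasure_esd (h : M.IsSymm) (hp : 1 ≤ p) : IsProbabilityMeasure (esd M) := by
  constructor
  rw [esd_eq (isHermitian_of_isSymm h)]
  have : (p : ℝ≥0∞) ≠ 0 := by simp only [ne_eq, Nat.cast_eq_zero]; omega
  simp [ENNReal.inv_mul_cancel this]

theorem integral_pow_esd (h : M.IsSymm) (k : ℕ) :
    ∫ x, x ^ k ∂(esd M) = (p : ℝ)⁻¹ * (M ^ k).trace := by
  rw [integral_esd h, trace_pow_eq_sum (isHermitian_of_isSymm h)]

end SpectralDistribution

/-! ### Real polynomials and exponential growth of the limiting moments -/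

section RealPolynomials

variable {ι : Type}

/-- Complexification of a real noncommutative polynomial. -/
theorem exists_complexify (Q : FreeAlgebra ℝ (ι × Bool)) : ∃ Q' : FreeAlgebra ℂ (ι × Bool),
    (∀ (A : Type) [Ring A] [StarRing A] [Algebra ℂ A] (a : ι → A),
      polyEval ℝ a Q = polyEval ℂ a Q') ∧
    ∀ (p : ℕ) (E : ι → Matrix (Fin p) (Fin p) ℝ),
      toComplex (polyEval ℝ E Q) = polyEval ℂ (fun l => toComplex (E l)) Q' := by
  induction Q using FreeAlgebra.induction with
  | grade0 c =>
    refine ⟨algebraMap ℂ _ (c : ℂ), fun A _ _ _ a => ?_, fun p E => ?_⟩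
    · rw [AlgHom.commutes, AlgHom.commutes]
      rfl
    · rw [AlgHom.commutes, AlgHom.commutes]
      ext i j
      simp [toComplex, Matrix.algebraMap_matrix_apply, apply_ite Complex.ofReal]
  | grade1 x =>
    refine ⟨FreeAlgebra.ι ℂ x, fun A _ _ _ a => ?_, fun p E => ?_⟩
    · rw [polyEval_ι, polyEval_ι]
    · rw [polyEval_ι, polyEval_ι, toComplex_starPow]
  | mul Q R hQ hR =>
    obtain ⟨Q', h1, h2⟩ := hQ
    obtain ⟨R', h3, h4⟩ := hR
    refine ⟨Q' * R', fun A _ _ _ a => ?_, fun p E => ?_⟩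
    · rw [map_mul, map_mul, h1, h3]
    · rw [map_mul, map_mul, toComplex_mul, h2, h4]
  | add Q R hQ hR =>
    obtain ⟨Q', h1, h2⟩ := hQ
    obtain ⟨R', h3, h4⟩ := hR
    refine ⟨Q' + R', fun A _ _ _ a => ?_, fun p E => ?_⟩
    · rw [map_add, map_add, h1, h3]
    · rw [map_add, map_add, toComplex_add, h2, h4]

variable [DecidableEq ι] {ρ : ι → ℝ}

theorem norm_wickFunctional_word_le (hρ : ∀ l, |ρ l| ≤ 1) (u : List (ι × Bool)) :
    ‖wickFunctional ρ (u.map (FreeAlgebra.ι ℂ)).prod‖ ≤ 2 ^ u.length := by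
  have h : (u.map (FreeAlgebra.ι ℂ)).prod = monomial ℂ u.get := by
    rw [monomial]
    congr 1
    conv_lhs => rw [← List.ofFn_get u]
    rw [List.map_ofFn]
    rfl
  rw [h, wickFunctional_monomial, Complex.norm_real, Real.norm_eq_abs]
  exact abs_wickMoment_le hρ _

/-- Multiplication by a polynomial enlarges the limiting functional by at most a constant. -/
theorem exists_wickFunctional_mul_bound (ρ : ι → ℝ) (Q : FreeAlgebra ℂ (ι × Bool)) :
    ∃ D : ℝ, 0 ≤ D ∧ ∀ (R : FreeAlgebra ℂ (ι × Bool)) (K : ℝ),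
      (∀ u : List (ι × Bool), ‖wickFunctional ρ (R * (u.map (FreeAlgebra.ι ℂ)).prod)‖ ≤
        K * 2 ^ u.length) →
      ∀ u : List (ι × Bool), ‖wickFunctional ρ (R * Q * (u.map (FreeAlgebra.ι ℂ)).prod)‖ ≤
        K * D * 2 ^ u.length := by
  -- Since `R` and `K` are arbitrary, the bound for a product follows by applying the two bounds in
  -- succession; the word `u` on the right absorbs the letters.
  induction Q using FreeAlgebra.induction with
  | grade0 c =>
    refine ⟨‖c‖, norm_nonneg _, fun R K h u => ?_⟩
    rw [← Algebra.commutes, mul_assoc, ← Algebra.smul_def, map_smul, norm_smul]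
    calc ‖c‖ * _ ≤ ‖c‖ * (K * 2 ^ u.length) := by gcongr; exact h u
      _ = _ := by ring
  | grade1 x =>
    -- A letter lengthens the word by one, which doubles the bound.
    refine ⟨2, by norm_num, fun R K h u => ?_⟩
    have := h (x :: u)
    rw [List.map_cons, List.prod_cons, ← mul_assoc, List.length_cons] at this
    refine this.trans (le_of_eq ?_)
    ring
  | mul Q Q' hQ hQ' =>
    obtain ⟨D, hD, h⟩ := hQ
    obtain ⟨D', hD', h'⟩ := hQ'
    refine ⟨D * D', by positivity, fun R K hR u => ?_⟩
    rw [← mul_assoc R, ← mul_assoc K]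
    exact h' (R * Q) (K * D) (h R K hR) u
  | add Q Q' hQ hQ' =>
    obtain ⟨D, hD, h⟩ := hQ
    obtain ⟨D', hD', h'⟩ := hQ'
    refine ⟨D + D', by positivity, fun R K hR u => ?_⟩
    rw [mul_add, add_mul, map_add]
    refine (norm_add_le _ _).trans ((add_le_add (h R K hR u) (h' R K hR u)).trans (le_of_eq ?_))
    ring

/-- The limiting moments of a polynomial grow at most exponentially. -/
theorem exists_norm_wickFunctional_pow_le (hρ : ∀ l, |ρ l| ≤ 1) (Q : FreeAlgebra ℂ (ι × Bool)) :
    ∃ D : ℝ, 0 ≤ D ∧ ∀ k : ℕ, ‖wickFunctional ρ (Q ^ k)‖ ≤ D ^ k := by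
  obtain ⟨D, hD, h⟩ := exists_wickFunctional_mul_bound ρ Q
  have key : ∀ (k : ℕ) (u : List (ι × Bool)),
      ‖wickFunctional ρ (Q ^ k * (u.map (FreeAlgebra.ι ℂ)).prod)‖ ≤ D ^ k * 2 ^ u.length := by
    intro k
    induction k with
    | zero =>
      intro u
      rw [pow_zero, pow_zero, one_mul, one_mul]
      exact norm_wickFunctional_word_le hρ u
    | succ k ih =>
      rw [pow_succ, pow_succ]
      exact h _ _ ih
  exact ⟨D, hD, fun k => by simpa using key k []⟩

end RealPolynomials

/-! ### Spectral limits of symmetric polynomials -/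

section SpectralLimit

variable {t : ℕ} {ρ : Fin t → ℝ}

/-- Convergence of the spectral distributions of real symmetric matrices whose traces of powers
converge to the limiting functional. -/
theorem exists_spectral_limit (Q : FreeAlgebra ℂ (Fin t × Bool))
    {D R : ℝ} (hD : 0 ≤ D) (hDR : D < R) (hbd : ∀ k : ℕ, ‖wickFunctional ρ (Q ^ k)‖ ≤ D ^ k)
    {M : ∀ p : ℕ, Matrix (Fin p) (Fin p) ℝ} (hsymm : ∀ p, (M p).IsSymm)
    (hlim : ∀ k : ℕ, Tendsto (fun p => ntr (toComplex (M p) ^ k)) atTop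
      (𝓝 (wickFunctional ρ (Q ^ k)))) :
    ∃ μ : ProbabilityMeasure ℝ, (μ : Measure ℝ) {x | R ≤ |x|} = 0 ∧
      (∀ k : ℕ, wickFunctional ρ (Q ^ k) = ((∫ x, x ^ k ∂(μ : Measure ℝ) : ℝ) : ℂ)) ∧
      ∀ f : BoundedContinuousFunction ℝ ℝ,
        Tendsto (fun p => ∫ x, f x ∂(esd (M p))) atTop (𝓝 (∫ x, f x ∂(μ : Measure ℝ))) := by
  have hpow : ∀ p k, toComplex (M p) ^ k = toComplex (M p ^ k) := by
    intro p k
    induction k with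
    | zero => rw [pow_zero, pow_zero, toComplex_one]
    | succ k ih => rw [pow_succ, pow_succ, toComplex_mul, ih]
  have hreal : ∀ p k, ntr (toComplex (M p) ^ k) = ((∫ x, x ^ k ∂(esd (M p)) : ℝ) : ℂ) := by
    intro p k
    rw [hpow, ntr_toComplex, integral_pow_esd (hsymm p)]
  simp only [hreal] at hlim
  have him : ∀ k, (wickFunctional ρ (Q ^ k)).im = 0 := fun k =>
    tendsto_nhds_unique ((Complex.continuous_im.tendsto _).comp (hlim k))
      (tendsto_const_nhds.congr fun p => (Complex.ofReal_im _).symm)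
  have hre : ∀ k, Tendsto (fun p => ∫ x, x ^ k ∂(esd (M p))) atTop
      (𝓝 (wickFunctional ρ (Q ^ k)).re) := fun k =>
    ((Complex.continuous_re.tendsto _).comp (hlim k)).congr fun p => Complex.ofReal_re _
  -- The index is shifted by one because the empty matrix has no spectral distribution of mass one.
  let μs : ℕ → ProbabilityMeasure ℝ := fun q =>
    ⟨esd (M (q + 1)), isProbabilityMeasure_esd (hsymm _) (by omega)⟩
  obtain ⟨μ, hsupp, hmu, hconv⟩ := exists_limit_measure (μs := μs) (M := 1) (D := D) (R := R)
    (m := fun k => (wickFunctional ρ (Q ^ k)).re)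
    (fun q k => integrable_esd (hsymm _) (by omega) _)
    (fun k => (hre k).comp (tendsto_add_atTop_nat 1)) hD hDR
    (fun k => by rw [one_mul]; exact (Complex.abs_re_le_norm _).trans (hbd k))
  refine ⟨μ, hsupp, fun k => ?_, fun f => ?_⟩
  · rw [hmu]
    exact Complex.ext (Complex.ofReal_re _).symm (by rw [him, Complex.ofReal_im])
  · rw [← tendsto_add_atTop_iff_nat 1]
    exact (ProbabilityMeasure.tendsto_iff_forall_integral_tendsto.1 hconv) f

end SpectralLimit

/-! ### Almost sure symmetry -/

section Symmetry

variable {Ω : Type*} [MeasurableSpace Ω] {P : Measure Ω} [IsProbabilityMeasure P]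

/-- Almost surely, all polynomials which are almost surely symmetric are symmetric. -/
theorem ae_forall_isSymm {ι : Type} [Countable ι]
    (E : ∀ p : ℕ, Ω → ι → Matrix (Fin p) (Fin p) ℝ) :
    ∀ᵐ ω ∂P, ∀ Q : FreeAlgebra ℝ (ι × Bool),
      (∀ p, ∀ᵐ ω' ∂P, (polyEval ℝ (E p ω') Q).IsSymm) → ∀ p, (polyEval ℝ (E p ω) Q).IsSymm := by
  let W : Submodule ℝ (FreeAlgebra ℝ (ι × Bool)) :=
    { carrier := {Q | ∀ p, ∀ᵐ ω' ∂P, (polyEval ℝ (E p ω') Q).IsSymm}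
      add_mem' := fun {Q R} hQ hR p => by
        filter_upwards [hQ p, hR p] with ω h1 h2
        rw [map_add]; exact h1.add h2
      zero_mem' := fun p => ae_of_all _ fun ω => by rw [map_zero]; exact Matrix.isSymm_zero
      smul_mem' := fun c Q hQ p => by
        filter_upwards [hQ p] with ω h
        rw [map_smul]; exact h.smul c }
  let b := Module.Basis.ofVectorSpace ℝ W
  -- The almost surely symmetric polynomials form a space of countable dimension, so a single null
  -- set serves a basis and hence all of the uncountably many polynomials.
  have hcount : Countable (Module.Basis.ofVectorSpaceIndex ℝ W) := by
    rw [← Cardinal.mk_le_aleph0_iff, b.mk_eq_rank'']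
    refine (Submodule.rank_le W).trans ?_
    rw [FreeAlgebra.rank_eq, Cardinal.lift_le_aleph0]
    exact Cardinal.mk_le_aleph0
  have hae : ∀ᵐ ω ∂P, ∀ i p, (polyEval ℝ (E p ω) (b i : FreeAlgebra ℝ (ι × Bool))).IsSymm :=
    ae_all_iff.2 fun i => ae_all_iff.2 fun p => (b i).2 p
  filter_upwards [hae] with ω hω Q hQ p
  let S : Submodule ℝ W :=
    { carrier := {R | (polyEval ℝ (E p ω) (R : FreeAlgebra ℝ (ι × Bool))).IsSymm}
      add_mem' := fun {Q R} hQ hR => by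
        change (polyEval ℝ (E p ω) (Q + R : FreeAlgebra ℝ (ι × Bool))).IsSymm
        rw [map_add]; exact hQ.add hR
      zero_mem' := by
        change (polyEval ℝ (E p ω) (0 : FreeAlgebra ℝ (ι × Bool))).IsSymm
        rw [map_zero]; exact Matrix.isSymm_zero
      smul_mem' := fun c Q hQ => by
        change (polyEval ℝ (E p ω) (c • (Q : FreeAlgebra ℝ (ι × Bool)))).IsSymm
        rw [map_smul]; exact hQ.smul c }
  have hS : S = ⊤ := by
    rw [eq_top_iff, ← b.span_eq, Submodule.span_le]
    rintro _ ⟨i, rfl⟩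
    exact hω i p
  have : (⟨Q, hQ⟩ : W) ∈ S := by rw [hS]; trivial
  exact this

variable {p n : ℕ} {X Y : Ω → Matrix (Fin p) (Fin n) ℝ} {ρ : ℝ}

/-- Perfectly correlated entries give a symmetric cross-covariance matrix. -/
theorem ae_isSymm_rescaledCov (hρ : ρ ^ 2 = 1)
    (hXi : ∀ i j, Integrable (fun ω => X ω i j ^ 2) P)
    (hYi : ∀ i j, Integrable (fun ω => Y ω i j ^ 2) P)
    (hX : ∀ i j, Measurable (fun ω => X ω i j)) (hY : ∀ i j, Measurable (fun ω => Y ω i j))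
    (hXvar : ∀ i j, ∫ ω, (X ω i j) ^ 2 ∂P = 1) (hYvar : ∀ i j, ∫ ω, (Y ω i j) ^ 2 ∂P = 1)
    (hcorr : ∀ i j, ∫ ω, X ω i j * Y ω i j ∂P = ρ) :
    ∀ᵐ ω ∂P, (rescaledCov ρ (X ω) (Y ω)).IsSymm := by
  have hae : ∀ i j, ∀ᵐ ω ∂P, X ω i j = ρ * Y ω i j := by
    intro i j
    have hXY : Integrable (fun ω => X ω i j * Y ω i j) P := by
      refine ((hXi i j).add (hYi i j)).mono' ((hX i j).mul (hY i j)).aestronglyMeasurable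
        (ae_of_all _ fun ω => ?_)
      rw [Real.norm_eq_abs, abs_le, Pi.add_apply]
      constructor <;> nlinarith [sq_nonneg (X ω i j + Y ω i j), sq_nonneg (X ω i j - Y ω i j),
        sq_nonneg (X ω i j), sq_nonneg (Y ω i j)]
    have hexp : ∀ ω, (X ω i j - ρ * Y ω i j) ^ 2 =
        X ω i j ^ 2 - 2 * ρ * (X ω i j * Y ω i j) + ρ ^ 2 * Y ω i j ^ 2 := fun ω => by ring
    have hint : Integrable (fun ω => X ω i j ^ 2 - 2 * ρ * (X ω i j * Y ω i j)) P :=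
      (hXi i j).sub (hXY.const_mul _)
    -- The integral is `1 - 2 ρ² + ρ² = 1 - ρ²`. Hence `X = ρ Y` almost surely, and `X Y^* = ρ Y
    -- Y^*` is symmetric.
    have h0 : ∫ ω, (X ω i j - ρ * Y ω i j) ^ 2 ∂P = 0 := by
      simp only [hexp]
      rw [integral_add hint ((hYi i j).const_mul _), integral_sub (hXi i j) (hXY.const_mul _),
        integral_const_mul, integral_const_mul, hXvar, hYvar, hcorr]
      linear_combination (-1 : ℝ) * hρ
    have h1 : Integrable (fun ω => (X ω i j - ρ * Y ω i j) ^ 2) P := by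
      simp only [hexp]
      exact hint.add ((hYi i j).const_mul _)
    have h2 := (integral_eq_zero_iff_of_nonneg (fun ω => sq_nonneg _) h1).1 h0
    filter_upwards [h2] with ω hω
    have : X ω i j - ρ * Y ω i j = 0 := by simpa using hω
    linarith
  have hall : ∀ᵐ ω ∂P, ∀ i j, X ω i j = ρ * Y ω i j :=
    ae_all_iff.2 fun i => ae_all_iff.2 fun j => hae i j
  filter_upwards [hall] with ω hω
  rw [rescaledCov]
  refine Matrix.IsSymm.smul (Matrix.IsSymm.sub ?_ (Matrix.isSymm_one.smul ρ)) _
  rw [crossCov]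
  refine Matrix.IsSymm.smul ?_ _
  refine Matrix.IsSymm.ext fun i j => ?_
  rw [Matrix.mul_apply, Matrix.mul_apply]
  refine Finset.sum_congr rfl fun k _ => ?_
  rw [Matrix.transpose_apply, Matrix.transpose_apply, hω, hω]
  ring

end Symmetry

end CrossCov

end

/-! ### Assembly of the theorem -/

theorem theorem2 {Ω : Type*} [MeasurableSpace Ω] (P : Measure Ω) [IsProbabilityMeasure P]
    (t : ℕ) (n : Fin t → ℕ → ℕ) (ρ : Fin t → ℝ)
    (X Y : ∀ (p : ℕ) (l : Fin t), Ω → Matrix (Fin p) (Fin (n l p)) ℝ)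
    (hX : ∀ p l i j, Measurable (fun ω => X p l ω i j))
    (hY : ∀ p l i j, Measurable (fun ω => Y p l ω i j))
    -- the pairs of entries are independent across `i`, `j` and `l`
    (hindep : ∀ p : ℕ, iIndepFun
      (fun (q : Σ l : Fin t, Fin p × Fin (n l p)) (ω : Ω) =>
        ((X p q.1 ω q.2.1 q.2.2, Y p q.1 ω q.2.1 q.2.2) : ℝ × ℝ)) P)
    -- means `0`, variances `1`, correlation `ρ l`
    (hXmean : ∀ p l i j, ∫ ω, X p l ω i j ∂P = 0)
    (hYmean : ∀ p l i j, ∫ ω, Y p l ω i j ∂P = 0)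
    (hXvar : ∀ p l i j, ∫ ω, (X p l ω i j) ^ 2 ∂P = 1)
    (hYvar : ∀ p l i j, ∫ ω, (Y p l ω i j) ^ 2 ∂P = 1)
    (hcorr : ∀ p l i j, ∫ ω, X p l ω i j * Y p l ω i j ∂P = ρ l)
    -- uniformly bounded moments of every order
    (hmom : ∀ (l : Fin t) (k : ℕ), 1 ≤ k → ∃ B : ℝ, ∀ (p : ℕ) (i : Fin p) (j : Fin (n l p)),
      Integrable (fun ω => |X p l ω i j| ^ k) P ∧ Integrable (fun ω => |Y p l ω i j| ^ k) P ∧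
        ∫ ω, (|X p l ω i j| ^ k + |Y p l ω i j| ^ k) ∂P < B)
    -- `n_l → ∞` and `p / n_l → 0` as `p → ∞`
    (hn : ∀ l, Tendsto (n l) atTop atTop)
    (hy : ∀ l, Tendsto (fun p : ℕ => (p : ℝ) / (n l p : ℝ)) atTop (𝓝 0)) :
    -- the matrices `E_l` have entries with finite moments of all orders
    (∀ p l, CrossCov.MemRandomMatrix P
      (fun ω => CrossCov.toComplex (CrossCov.rescaledCov (ρ l) (X p l ω) (Y p l ω)))) ∧
    -- a tracial star-probability space with free elliptic variables `e_l`
    ∃ (A : Type) (_ : Ring A) (_ : StarRing A) (_ : Algebra ℂ A) (_ : StarModule ℂ A)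
      (φ : A →ₗ[ℂ] ℂ) (e : Fin t → A),
      CrossCov.IsState φ ∧ CrossCov.IsTracial φ ∧
      (∀ l, CrossCov.IsElliptic φ (e l) (ρ l ^ 2)) ∧ CrossCov.IsFree φ e ∧
      (∀ l, ρ l = 1 ∨ ρ l = -1 → CrossCov.IsSemicircular φ (e l)) ∧
      (∀ l, ρ l = 0 → CrossCov.IsCircular φ (e l)) ∧
      -- (a) joint convergence with respect to `p⁻¹ E Tr`
      (∀ Q : FreeAlgebra ℂ (Fin t × Bool),
        Tendsto (fun p : ℕ => CrossCov.expNtr P (fun ω => CrossCov.polyEval ℂ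
            (fun l => CrossCov.toComplex (CrossCov.rescaledCov (ρ l) (X p l ω) (Y p l ω))) Q))
          atTop (𝓝 (φ (CrossCov.polyEval ℂ e Q)))) ∧
      -- (a) almost sure joint convergence with respect to `p⁻¹ Tr`
      (∀ᵐ ω ∂P, ∀ Q : FreeAlgebra ℂ (Fin t × Bool),
        Tendsto (fun p : ℕ => CrossCov.ntr (CrossCov.polyEval ℂ
            (fun l => CrossCov.toComplex (CrossCov.rescaledCov (ρ l) (X p l ω) (Y p l ω))) Q))
          atTop (𝓝 (φ (CrossCov.polyEval ℂ e Q)))) ∧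
      -- (b) almost sure weak convergence of the spectral distribution of symmetric polynomials
      (∀ Q : FreeAlgebra ℝ (Fin t × Bool),
        (∀ p : ℕ, ∀ᵐ ω ∂P, (CrossCov.polyEval ℝ
          (fun l => CrossCov.rescaledCov (ρ l) (X p l ω) (Y p l ω)) Q).IsSymm) →
        ∃ μ : Measure ℝ, CrossCov.IsLaw φ (CrossCov.polyEval ℝ e Q) μ ∧
          (∃ C : ℝ, μ (Set.Icc (-C) C)ᶜ = 0) ∧
          ∀ᵐ ω ∂P, ∀ f : BoundedContinuousFunction ℝ ℝ,
            Tendsto (fun p : ℕ => ∫ x, f x ∂(CrossCov.esd (CrossCov.polyEval ℝ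
                (fun l => CrossCov.rescaledCov (ρ l) (X p l ω) (Y p l ω)) Q)))
              atTop (𝓝 (∫ x, f x ∂μ))) := by
  obtain ⟨B, hB, hmodel⟩ := CrossCov.exists_isEntryModel hX hY hindep hXmean hYmean hXvar hYvar
    hcorr hmom
  have hρ := CrossCov.abs_corr_le_one hmodel hn
  have hsq : ∀ l, ρ l = 1 ∨ ρ l = -1 → ρ l ^ 2 = 1 := fun l h => by
    rcases h with h | h <;> rw [h] <;> norm_num
  have hint : ∀ p l i j, Integrable (fun ω => X p l ω i j ^ 2) P ∧
      Integrable (fun ω => Y p l ω i j ^ 2) P := fun p l i j => by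
    have h1 := (hmodel p).intX ⟨l, j⟩ i 2
    have h2 := (hmodel p).intY ⟨l, j⟩ i 2
    simp only [sq_abs] at h1 h2
    exact ⟨h1, h2⟩
  have hconv := CrossCov.ae_tendsto_wordTrace hB hmodel hn hy
  have hsymm := CrossCov.ae_forall_isSymm (P := P)
    (fun p ω l => CrossCov.rescaledCov (ρ l) (X p l ω) (Y p l ω))
  -- One sample point where all words converge and all almost surely symmetric polynomials are
  -- symmetric; the limit space is built from its matrices.
  obtain ⟨ω₀, hω₀, hs₀⟩ := (hconv.and hsymm).exists
  have hL := CrossCov.tendsto_ntr_polyEval hω₀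
  have hφ := CrossCov.limitState_polyEval hL
  -- Elements of the algebra are genuine sequences of matrices, so self-adjointness is checked for
  -- each `p`, not merely modulo null elements of the state.
  have hself : ∀ Q : FreeAlgebra ℝ (Fin t × Bool),
      (∀ p, ∀ᵐ ω ∂P, (CrossCov.polyEval ℝ
        (fun l => CrossCov.rescaledCov (ρ l) (X p l ω) (Y p l ω)) Q).IsSymm) →
      IsSelfAdjoint (CrossCov.polyEval ℝ
        (CrossCov.seqGen fun p => CrossCov.complexCov ρ X Y p ω₀) Q) := by
    intro Q hQ
    obtain ⟨Q', h1, h2⟩ := CrossCov.exists_complexify Q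
    rw [h1]
    refine Subtype.ext (funext fun p => ?_)
    change star ((CrossCov.polyEval ℂ _ Q' : CrossCov.seqAlgebra _).1 p) = _
    have h3 := CrossCov.isHermitian_of_isSymm (hs₀ Q hQ p)
    rw [CrossCov.polyEval_seqGen, ← h2, ← CrossCov.toComplex_star]
    exact congrArg CrossCov.toComplex h3
  refine ⟨fun p l i j k => (CrossCov.memLp_entry (hmodel p) l false i j k).ofReal,
    CrossCov.seqAlgebra fun p => CrossCov.complexCov ρ X Y p ω₀, inferInstance, inferInstance,
    inferInstance, inferInstance, CrossCov.limitState hL, CrossCov.seqGen _,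
    CrossCov.isState_limitState hL, CrossCov.isTracial_limitState hL,
    CrossCov.isElliptic_letter hφ hρ, CrossCov.isFree_letters hφ, fun l hl => ?_,
    CrossCov.isCircular_letter hφ, fun Q => ?_, ?_, fun Q hQ => ?_⟩
  · refine CrossCov.isSemicircular_letter hφ l (hsq l hl) ?_
    have h := hself (FreeAlgebra.ι ℝ (l, false)) fun p => by
      simp only [CrossCov.polyEval_ι]
      exact CrossCov.ae_isSymm_rescaledCov (hsq l hl) (fun i j => (hint p l i j).1)
        (fun i j => (hint p l i j).2) (hX p l) (hY p l) (hXvar p l) (hYvar p l) (hcorr p l)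
    rwa [CrossCov.polyEval_ι] at h
  · rw [hφ]
    exact CrossCov.tendsto_expNtr_polyEval hB hmodel hn hy Q
  · filter_upwards [hconv] with ω hω Q
    rw [hφ]
    exact CrossCov.tendsto_ntr_polyEval hω Q
  · obtain ⟨Q', h1, h2⟩ := CrossCov.exists_complexify Q
    obtain ⟨D, hD, hbd⟩ := CrossCov.exists_norm_wickFunctional_pow_le hρ Q'
    have hDR : D < D + 1 := lt_add_one D
    have hgood : ∀ ω, (∀ (m : ℕ) (w : Fin m → Fin t × Bool),
        Tendsto (fun p => CrossCov.wordTrace ρ (X p) (Y p) w ω) atTop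
          (𝓝 (CrossCov.wickMoment ρ w))) →
        (∀ p, (CrossCov.polyEval ℝ
          (fun l => CrossCov.rescaledCov (ρ l) (X p l ω) (Y p l ω)) Q).IsSymm) → _ :=
      fun ω hω hs => CrossCov.exists_spectral_limit Q' hD hDR hbd hs fun k => by
        simp only [h2, ← map_pow]
        exact CrossCov.tendsto_ntr_polyEval hω (Q' ^ k)
    obtain ⟨μ, hsupp, hmu, -⟩ := hgood ω₀ hω₀ (hs₀ Q hQ)
    have hmom' : ∀ k : ℕ, CrossCov.limitState hL (CrossCov.polyEval ℝ (CrossCov.seqGen _) Q ^ k) =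
        ((∫ x, x ^ k ∂(μ : Measure ℝ) : ℝ) : ℂ) := fun k => by
      rw [h1, ← map_pow, hφ, hmu]
    refine ⟨μ, ⟨hself Q hQ, inferInstance, fun k _ =>
      ⟨CrossCov.integrable_pow_of_support hsupp k, hmom' k⟩, fun ν hν hνm => ?_⟩, ⟨D + 1, ?_⟩, ?_⟩
    -- The competitor `ν` is not assumed compactly supported; the exponential bound on the moments
    -- forces it to be.
    · have hν' : ∀ k : ℕ, Integrable (fun x : ℝ => x ^ k) ν ∧
          ∫ x, x ^ k ∂ν = ∫ x, x ^ k ∂(μ : Measure ℝ) := by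
        intro k
        rcases Nat.eq_zero_or_pos k with rfl | hk
        · simp
        · refine ⟨(hνm k hk).1, ?_⟩
          have := (hνm k hk).2
          rw [hmom'] at this
          exact (Complex.ofReal_injective this).symm
      have hsupp' : ν {x | D + 1 ≤ |x|} = 0 := by
        refine CrossCov.measure_abs_ge_eq_zero (fun k => (hν' k).1) (M := 1) hD hDR fun k => ?_
        rw [(hν' k).2, one_mul, ← Real.norm_eq_abs, ← Complex.norm_real, ← hmu]
        exact hbd k
      exact CrossCov.measure_eq_of_moments hsupp' hsupp fun k => (hν' k).2
    · refine measure_mono_null (fun x hx => ?_) hsupp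
      by_contra hlt
      exact hx (abs_le.1 (not_le.1 hlt).le)
    · filter_upwards [hconv, ae_all_iff.2 hQ] with ω hω hs
      obtain ⟨μ', hsupp', hmu', hlim⟩ := hgood ω hω hs
      -- The limit law found at `ω` has the moments of the one found at `ω₀`, so it does not depend
      -- on the sample point.
      have : (μ' : Measure ℝ) = μ := CrossCov.measure_eq_of_moments hsupp' hsupp fun k =>
        Complex.ofReal_injective ((hmu' k).symm.trans (hmu k))
      rw [← this]
      exact hlim
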